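/- Let $n\in\mathbb N$, let $\Omega\subset\mathbb R^n$ be a convex domain (open, possibly unbounded, possibly $\Omega=\mathbb R^n$) with $0\in\Omega$, let $T>0$ and $A>0$, and write $d\gamma=(2\pi)^{-n/2}e^{-|x|^2/2}\,dx$ and $L_\gamma=\Delta-x\cdot\nabla$. Let $u$ be a classical solution of $$\partial_t u=L_\gamma u \ \text{ in } \Omega\times(-T,\infty),\qquad u=0\ \text{ on }\partial\Omega\times(-T,\infty)$$ (no boundary condition if $\Omega=\mathbb R^n$), that is, $u$ is continuous on $\overline\Omega\times(-T,\infty)$, and $\partial_tu,\nabla u,\nabla^2u$ exist and are continuous in $\Omega\times(-T,\infty)$. Suppose that $u(\cdot,t)\in W^{2,2}(\Omega;e^{-2A|x|^2}d\gamma)$ for every $t>-T$, with norm bounded on every compact interval of times $t\in(-T,\infty)$. Put $$T_0=\tfrac12\min\Big\{\log\Big(1+\frac1{8(A+\pi)}\Big),\,T\Big\},\qquad M(x,t)=(1-e^{2t})^{-n/2}\exp\Big(-\frac12\,\frac{e^{2t}|x|^2}{1-e^{2t}}\Big)\quad(t<0),$$ $$H(\tau)=\int_\Omega u^2(x,-\tau)M(x,-\tau)\,d\gamma(x),\qquad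 I(\tau)=\int_\Omega|\nabla u|^2(x,-\tau)M(x,-\tau)\,d\gamma(x).$$ Then for all $0<\tau<T_0$ the integrals $H(\tau)$ and $I(\tau)$ are finite; either $u\equiv0$ on $\Omega\times(-T_0,0)$ or $H(\tau)>0$ for all $0<\tau<T_0$; and the parabolic frequency $$N(\tau)=(1-e^{-2\tau})\,\frac{I(\tau)}{H(\tau)}$$ (read as $0$ in the trivial case $u\equiv 0$ on $\Omega\times(-T_0,0)$) is monotonically increasing (non-decreasing) on $(0,T_0)$. -/

import Mathlib

open Set MeasureTheory
open scoped ENNReal NNReal ContDiff Laplacian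

noncomputable section

/-- The standard Gaussian measure `dγ = (2π)^(-n/2) exp(-|x|²/2) dx` on `ℝⁿ`. -/
def gaussianSpaceMeasure (n : ℕ) : Measure (EuclideanSpace ℝ (Fin n)) :=
  volume.withDensity fun x =>
    ENNReal.ofReal (1 / (2 * Real.pi) ^ ((n : ℝ) / 2) * Real.exp (-‖x‖ ^ 2 / 2))

/-- The measure `exp(-2A|x|²) dγ` on `ℝⁿ`. -/
def weightedGaussianMeasure (n : ℕ) (A : ℝ) : Measure (EuclideanSpace ℝ (Fin n)) :=
  (gaussianSpaceMeasure n).withDensity fun x => ENNReal.ofReal (Real.exp (-2 * A * ‖x‖ ^ 2))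

/-- `f'` is a weak (distributional) derivative of `f` on the open set `Ω`:
`∫_Ω (∂_v φ) f = - ∫_Ω φ (f' v)` for all test functions `φ ∈ C_c^∞(Ω)` and directions `v`. -/
def IsWeakFDeriv {n : ℕ} {F : Type*} [NormedAddCommGroup F] [NormedSpace ℝ F]
    (Ω : Set (EuclideanSpace ℝ (Fin n))) (f : EuclideanSpace ℝ (Fin n) → F)
    (f' : EuclideanSpace ℝ (Fin n) → EuclideanSpace ℝ (Fin n) →L[ℝ] F) : Prop :=
  LocallyIntegrableOn f Ω ∧ LocallyIntegrableOn f' Ω ∧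
    ∀ φ : EuclideanSpace ℝ (Fin n) → ℝ, ContDiff ℝ ∞ φ → HasCompactSupport φ → tsupport φ ⊆ Ω →
      ∀ v : EuclideanSpace ℝ (Fin n),
        ∫ x in Ω, (fderiv ℝ φ x v) • f x = -∫ x in Ω, φ x • f' x v

/-- The squared `W^{2,2}(Ω; μ)` norm `∫_Ω (|f|² + |Df|² + |D²f|²) dμ`, in `[0, ∞]`, where `Df` and
`D²f` are the weak derivatives. Weak derivatives are unique almost everywhere, so the infimum only
selects them; it is `∞` if they do not exist. -/
def sobolevNormSq {n : ℕ} (Ω : Set (EuclideanSpace ℝ (Fin n)))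
    (μ : Measure (EuclideanSpace ℝ (Fin n))) (f : EuclideanSpace ℝ (Fin n) → ℝ) : ℝ≥0∞ :=
  ⨅ (f' : EuclideanSpace ℝ (Fin n) → EuclideanSpace ℝ (Fin n) →L[ℝ] ℝ)
    (f'' : EuclideanSpace ℝ (Fin n) →
      EuclideanSpace ℝ (Fin n) →L[ℝ] EuclideanSpace ℝ (Fin n) →L[ℝ] ℝ)
    (_ : IsWeakFDeriv Ω f f') (_ : IsWeakFDeriv Ω f' f''),
    ∫⁻ x in Ω, (‖f x‖ₑ ^ 2 + ‖f' x‖ₑ ^ 2 + ‖f'' x‖ₑ ^ 2) ∂μ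

/-- `f ∈ W^{2,2}(Ω; μ)`. -/
def MemW22 {n : ℕ} (Ω : Set (EuclideanSpace ℝ (Fin n)))
    (μ : Measure (EuclideanSpace ℝ (Fin n))) (f : EuclideanSpace ℝ (Fin n) → ℝ) : Prop :=
  sobolevNormSq Ω μ f < ⊤

/-- The Ornstein–Uhlenbeck operator `L_γ f = Δ f - x · ∇ f`. -/
def ornsteinUhlenbeck {n : ℕ} (f : EuclideanSpace ℝ (Fin n) → ℝ)
    (x : EuclideanSpace ℝ (Fin n)) : ℝ :=
  (Δ f) x - inner ℝ x (gradient f x)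

/-- Classical (`C^{2,1}` in the interior, continuous up to the lateral boundary) solutions of
`∂_t u = L_γ u` in `Ω × (-T, ∞)`, `u = 0` on `∂Ω × (-T, ∞)`. For `Ω = ℝⁿ` the boundary is empty. -/
structure IsOUHeatSolution {n : ℕ} (Ω : Set (EuclideanSpace ℝ (Fin n))) (T : ℝ)
    (u : EuclideanSpace ℝ (Fin n) → ℝ → ℝ) : Prop where
  continuousOn : ContinuousOn (fun p : EuclideanSpace ℝ (Fin n) × ℝ => u p.1 p.2)
    (closure Ω ×ˢ Ioi (-T))
  contDiffOn_space : ∀ t, -T < t → ContDiffOn ℝ 2 (fun x => u x t) Ω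
  differentiableAt_time : ∀ x ∈ Ω, ∀ t, -T < t → DifferentiableAt ℝ (u x) t
  continuousOn_gradient : ContinuousOn
    (fun p : EuclideanSpace ℝ (Fin n) × ℝ => gradient (fun y => u y p.2) p.1) (Ω ×ˢ Ioi (-T))
  continuousOn_hessian : ContinuousOn
    (fun p : EuclideanSpace ℝ (Fin n) × ℝ => iteratedFDeriv ℝ 2 (fun y => u y p.2) p.1)
    (Ω ×ˢ Ioi (-T))
  continuousOn_deriv_time : ContinuousOn
    (fun p : EuclideanSpace ℝ (Fin n) × ℝ => deriv (u p.1) p.2) (Ω ×ˢ Ioi (-T))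
  equation : ∀ x ∈ Ω, ∀ t, -T < t → deriv (u x) t = ornsteinUhlenbeck (fun y => u y t) x
  dirichlet : ∀ x ∈ frontier Ω, ∀ t, -T < t → u x t = 0

/-- The backward Mehler kernel starting from `(0, 0)`, for `t < 0`:
`M(x, t) = (1 - e^{2t})^{-n/2} exp(-(1/2) e^{2t} |x|² / (1 - e^{2t}))`. -/
def backwardMehlerKernel {n : ℕ} (x : EuclideanSpace ℝ (Fin n)) (t : ℝ) : ℝ :=
  1 / (1 - Real.exp (2 * t)) ^ ((n : ℝ) / 2) *
    Real.exp (-(1 / 2) * (Real.exp (2 * t) * ‖x‖ ^ 2 / (1 - Real.exp (2 * t))))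

/-- `H(τ) = ∫_Ω u²(x, -τ) M(x, -τ) dγ(x)`. -/
def freqH {n : ℕ} (Ω : Set (EuclideanSpace ℝ (Fin n))) (u : EuclideanSpace ℝ (Fin n) → ℝ → ℝ)
    (τ : ℝ) : ℝ :=
  ∫ x in Ω, u x (-τ) ^ 2 * backwardMehlerKernel x (-τ) ∂(gaussianSpaceMeasure n)

/-- `I(τ) = ∫_Ω |∇u|²(x, -τ) M(x, -τ) dγ(x)`. -/
def freqI {n : ℕ} (Ω : Set (EuclideanSpace ℝ (Fin n))) (u : EuclideanSpace ℝ (Fin n) → ℝ → ℝ)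
    (τ : ℝ) : ℝ :=
  ∫ x in Ω, ‖gradient (fun y => u y (-τ)) x‖ ^ 2 * backwardMehlerKernel x (-τ)
    ∂(gaussianSpaceMeasure n)

/-- The parabolic frequency `N(τ) = (1 - e^{-2τ}) I(τ) / H(τ)`. -/
def parabolicFrequency {n : ℕ} (Ω : Set (EuclideanSpace ℝ (Fin n)))
    (u : EuclideanSpace ℝ (Fin n) → ℝ → ℝ) (τ : ℝ) : ℝ :=
  (1 - Real.exp (-2 * τ)) * (freqI Ω u τ / freqH Ω u τ)

/-- `T₀ = (1/2) min {log (1 + 1 / (8 (A + π))), T}`. -/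
def freqTime (A T : ℝ) : ℝ :=
  1 / 2 * min (Real.log (1 + 1 / (8 * (A + Real.pi)))) T

end

/-!
In backward self-similar variables the equation is a gradient flow on a monotone family of domains,
and the frequency is its Rayleigh quotient.

Put `s = 1 - e^{-2τ}`. The measure `M(·, -τ) dγ` is the image of `dγ` under the dilation `z ↦ √s z`
(`map_smul_gaussianSpaceMeasure`). Extend `u(·, -τ)` by zero off `Ω` and let `W(τ)(z) = u(√s z, -τ)`
and `B(τ)(z) = (x · ∇u - s Δu)(√s z, -τ)`, both regarded as curves in `L²(γ)` (`solutionCurve`,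
`generatorCurve`). They belong to `L²(γ)` because for `τ < T₀` the kernel absorbs the weight
`e^{-2A|x|²}` (`backwardMehlerKernel_mul_le`). The chain rule turns the equation into `W' = B / s`
(`hasDerivAt_rescaled_reversed`), and integration by parts gives `⟨B, W⟩ = s I(τ)`, while
`‖W‖² = H(τ)`. Hence `N = ⟨B, W⟩ / ‖W‖²`.

In the variable `z` the domain is `Ω / √s`, which shrinks as `τ` increases since `Ω` is star-shaped
about `0`. So for `τ ≤ τ'` the state `W(τ')` is an admissible test function at time `τ`:
`⟨B(τ), W(τ')⟩` is the Dirichlet pairing of the two states (`inner_generatorCurve_solutionCurve`),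
and Young's inequality gives `2 ⟨B(τ), W(τ')⟩ ≤ ⟨B(τ), W(τ)⟩ + ⟨B(τ'), W(τ')⟩`
(`two_mul_inner_generatorCurve_le`). Therefore the lower right derivative of the energy `⟨B, W⟩` is
at least `2 ‖B‖² / s`, and that of `N` is nonnegative by the Cauchy–Schwarz inequality
(`rayleigh_le_of_forall_ne_zero`). The bound on `N` makes `log ‖W‖²` Lipschitz to the left of any
time, which yields the alternative `W ≡ 0` or `W ≠ 0` throughout
(`forall_eq_zero_or_forall_ne_zero`). This argument requires no boundary term, hence no regularity
of `∂Ω` or of `u` up to `∂Ω` beyond continuity.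

Two analytic points support it. The integration by parts (`integral_fderiv_gradient_of_continuous`)
is carried out for test functions that are truncated near `0`, so that they vanish near `∂Ω`, and
cut off at infinity. The regularity in time is weak: `W` is Lipschitz in `L²(γ)`, by the fundamental
theorem of calculus in `τ` for each fixed `z`, and its difference quotients as well as `B` converge
weakly, because bounded sequences that converge almost everywhere do (`tendsto_inner_toL2`). The
Sobolev norm of the hypothesis controls the classical derivatives because weak derivatives are
unique (`lintegral_le_sobolevNormSq`).
-/

open Filter Topology
open scoped InnerProductSpace

/-! ### Monotonicity of a Rayleigh quotient -/

section HilbertCurve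

variable {X : Type*} [NormedAddCommGroup X] [InnerProductSpace ℝ X]

variable {I : Set ℝ} {W B : ℝ → X} {c : ℝ → ℝ}

theorem continuousAt_of_eventually_norm_sub_le {X : Type*} [NormedAddCommGroup X] {W : ℝ → X}
    {τ : ℝ}
    (hlip : ∃ C : ℝ, ∀ᶠ τ' in 𝓝 τ, ‖W τ' - W τ‖ ≤ C * |τ' - τ|) : ContinuousAt W τ := by
  obtain ⟨C, hC⟩ := hlip
  rw [ContinuousAt, tendsto_iff_norm_sub_tendsto_zero]
  have h0 : Tendsto (fun τ' : ℝ => C * |τ' - τ|) (𝓝 τ) (𝓝 0) := by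
    have : ContinuousAt (fun τ' : ℝ => C * |τ' - τ|) τ := by fun_prop
    simpa [ContinuousAt] using this
  exact squeeze_zero' (Eventually.of_forall fun _ => norm_nonneg _) hC h0

/-- The pairing of a strongly continuous curve with a bounded, weakly continuous one is
continuous. -/
theorem continuousAt_inner_of_weak {τ : ℝ} (hW : ContinuousAt W τ)
    (hBb : ∃ C : ℝ, ∀ᶠ τ' in 𝓝 τ, ‖B τ'‖ ≤ C)
    (hBw : ∀ x : X, Tendsto (fun τ' => ⟪x, B τ'⟫_ℝ) (𝓝 τ) (𝓝 (⟪x, B τ⟫_ℝ))) :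
    ContinuousAt (fun τ' => ⟪B τ', W τ'⟫_ℝ) τ := by
  obtain ⟨C, hC⟩ := hBb
  have h1 : Tendsto (fun τ' => ⟪W τ, B τ'⟫_ℝ) (𝓝 τ) (𝓝 (⟪W τ, B τ⟫_ℝ)) := hBw _
  have h2 : Tendsto (fun τ' => ⟪W τ' - W τ, B τ'⟫_ℝ) (𝓝 τ) (𝓝 0) := by
    have h3 : Tendsto (fun τ' => ‖W τ' - W τ‖ * C) (𝓝 τ) (𝓝 0) := by
      simpa using (tendsto_iff_norm_sub_tendsto_zero.1 hW).mul_const C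
    refine squeeze_zero_norm' ?_ h3
    filter_upwards [hC] with τ' h
    exact (norm_inner_le_norm _ _).trans (mul_le_mul_of_nonneg_left h (norm_nonneg _))
  have h4 := h1.add h2
  rw [add_zero] at h4
  rw [ContinuousAt, real_inner_comm]
  refine h4.congr fun τ' => ?_
  rw [inner_sub_left, real_inner_comm (B τ') (W τ')]
  ring

/-- A weak right derivative `c B` suffices to differentiate `‖W‖²`: the quadratic remainder
`‖W τ' - W τ‖²` is `o(τ' - τ)` because `W` is Lipschitz. -/
theorem hasDerivWithinAt_norm_sq_of_weak {τ : ℝ}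
    (hlip : ∃ C : ℝ, ∀ᶠ τ' in 𝓝 τ, ‖W τ' - W τ‖ ≤ C * |τ' - τ|)
    (hder : ∀ x : X, Tendsto (fun τ' => (τ' - τ)⁻¹ * ⟪x, W τ' - W τ⟫_ℝ) (𝓝[>] τ)
      (𝓝 (c τ * ⟪x, B τ⟫_ℝ))) :
    HasDerivWithinAt (fun τ' => ‖W τ'‖ ^ 2) (2 * c τ * ⟪B τ, W τ⟫_ℝ) (Ici τ) τ := by
  rw [hasDerivWithinAt_iff_tendsto_slope]
  have hset : Ici τ \ {τ} = Ioi τ := by simp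
  rw [hset]
  have hWc := continuousAt_of_eventually_norm_sub_le hlip
  obtain ⟨C, hC⟩ := hlip
  have h1 := (hder (W τ)).const_mul 2
  have h2 : Tendsto (fun τ' => (τ' - τ)⁻¹ * ‖W τ' - W τ‖ ^ 2) (𝓝[>] τ) (𝓝 0) := by
    have h3 : Tendsto (fun τ' => C * ‖W τ' - W τ‖) (𝓝[>] τ) (𝓝 0) := by
      have := ((tendsto_iff_norm_sub_tendsto_zero.1 hWc).const_mul C)
      rw [mul_zero] at this
      exact this.mono_left nhdsWithin_le_nhds
    refine squeeze_zero_norm' ?_ h3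
    filter_upwards [nhdsWithin_le_nhds hC, self_mem_nhdsWithin] with τ' h hτ'
    have hpos : 0 < τ' - τ := sub_pos.2 hτ'
    rw [abs_of_pos hpos] at h
    rw [Real.norm_of_nonneg (by positivity), inv_mul_le_iff₀ hpos]
    nlinarith [norm_nonneg (W τ' - W τ)]
  have h4 := h1.add h2
  rw [add_zero] at h4
  have h5 : 2 * (c τ * ⟪W τ, B τ⟫_ℝ) = 2 * c τ * ⟪B τ, W τ⟫_ℝ := by
    rw [real_inner_comm]; ring
  rw [h5] at h4
  refine h4.congr fun τ' => ?_
  rw [slope_def_field, ← real_inner_self_eq_norm_sq, ← real_inner_self_eq_norm_sq,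
    ← real_inner_self_eq_norm_sq]
  simp only [inner_sub_left, inner_sub_right, real_inner_comm (W τ) (W τ')]
  rw [div_eq_inv_mul]
  ring

/-- The Rayleigh quotient `⟪B, W⟫_ℝ / ‖W‖²` does not decrease as long as `W` does not vanish. Its
lower right derivative is at least `2 c (‖B‖² ‖W‖² - ⟪B, W⟫_ℝ²) / ‖W‖⁴`, which is nonnegative by the
Cauchy–Schwarz inequality. By `hvar` the increments of the energy `⟪B, W⟫_ℝ` are bounded below by
`2 ⟪B τ, W τ' - W τ⟫_ℝ`, so that neither differentiability of `B` nor symmetry of an underlying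
operator is needed. -/
theorem rayleigh_le_of_forall_ne_zero {a b : ℝ} (hab : a ≤ b)
    (hc : ∀ τ ∈ Icc a b, 0 < c τ)
    (hlip : ∀ τ ∈ Icc a b, ∃ C : ℝ, ∀ᶠ τ' in 𝓝 τ, ‖W τ' - W τ‖ ≤ C * |τ' - τ|)
    (hder : ∀ τ ∈ Icc a b, ∀ x : X, Tendsto (fun τ' => (τ' - τ)⁻¹ * ⟪x, W τ' - W τ⟫_ℝ) (𝓝[>] τ)
      (𝓝 (c τ * ⟪x, B τ⟫_ℝ)))
    (hBb : ∀ τ ∈ Icc a b, ∃ C : ℝ, ∀ᶠ τ' in 𝓝 τ, ‖B τ'‖ ≤ C)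
    (hBw : ∀ τ ∈ Icc a b, ∀ x : X, Tendsto (fun τ' => ⟪x, B τ'⟫_ℝ) (𝓝 τ) (𝓝 (⟪x, B τ⟫_ℝ)))
    (hvar : ∀ τ ∈ Icc a b, ∀ τ' ∈ Icc a b, τ ≤ τ' →
      2 * ⟪B τ, W τ'⟫_ℝ ≤ ⟪B τ, W τ⟫_ℝ + ⟪B τ', W τ'⟫_ℝ)
    (hne : ∀ τ ∈ Icc a b, W τ ≠ 0) :
    ⟪B a, W a⟫_ℝ / ‖W a‖ ^ 2 ≤ ⟪B b, W b⟫_ℝ / ‖W b‖ ^ 2 := by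
  have hWc : ∀ τ ∈ Icc a b, ContinuousAt W τ := fun τ hτ =>
    continuousAt_of_eventually_norm_sub_le (hlip τ hτ)
  have hHpos : ∀ τ ∈ Icc a b, 0 < ‖W τ‖ ^ 2 := fun τ hτ => by
    have := norm_pos_iff.2 (hne τ hτ); positivity
  have hEc : ∀ τ ∈ Icc a b, ContinuousAt (fun τ => ⟪B τ, W τ⟫_ℝ) τ := fun τ hτ =>
    continuousAt_inner_of_weak (hWc τ hτ) (hBb τ hτ) (hBw τ hτ)
  have hFc : ContinuousOn (fun τ => -(⟪B τ, W τ⟫_ℝ / ‖W τ‖ ^ 2)) (Icc a b) := fun τ hτ =>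
    (((hEc τ hτ).div ((hWc τ hτ).norm.pow 2) (hHpos τ hτ).ne').neg).continuousWithinAt
  have key := image_le_of_liminf_slope_right_le_deriv_boundary hFc
    (B := fun _ => -(⟪B a, W a⟫_ℝ / ‖W a‖ ^ 2)) (B' := fun _ => 0) le_rfl continuousOn_const
    (fun x _ => hasDerivWithinAt_const ..) ?_ (right_mem_Icc.2 hab)
  · simpa using key
  intro x hx r hr
  have hxI : x ∈ Icc a b := ⟨hx.1, hx.2.le⟩
  apply Eventually.frequently
  have hq := hder x hxI (B x)
  have hH := (hasDerivWithinAt_iff_tendsto_slope.1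
    (hasDerivWithinAt_norm_sq_of_weak (c := c) (hlip x hxI) (hder x hxI)))
  have hset : Ici x \ {x} = Ioi x := by simp
  rw [hset] at hH
  have hWn : Tendsto (fun z => ‖W x‖ ^ 2 * ‖W z‖ ^ 2) (𝓝[>] x) (𝓝 (‖W x‖ ^ 2 * ‖W x‖ ^ 2)) :=
    (((hWc x hxI).norm.pow 2).const_mul _).mono_left nhdsWithin_le_nhds
  have hx2 := hHpos x hxI
  have hQ := (((hq.const_mul 2).mul_const (‖W x‖ ^ 2)).sub (hH.const_mul (⟪B x, W x⟫_ℝ))).div hWn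
    (by positivity)
  have hlim : 0 ≤ (2 * (c x * ⟪B x, B x⟫_ℝ) * ‖W x‖ ^ 2 - ⟪B x, W x⟫_ℝ * (2 * c x * ⟪B x, W x⟫_ℝ)) /
      (‖W x‖ ^ 2 * ‖W x‖ ^ 2) := by
    apply div_nonneg _ (by positivity)
    have hcs := real_inner_mul_inner_self_le (B x) (W x)
    rw [real_inner_self_eq_norm_sq (W x)] at hcs
    nlinarith [hc x hxI]
  have hev := hQ.eventually (lt_mem_nhds (lt_of_lt_of_le (neg_lt_zero.2 hr) hlim))
  have hI : ∀ᶠ z in 𝓝[>] x, z ∈ Ioc x b :=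
    Ioc_mem_nhdsGT hx.2
  filter_upwards [hev, hI] with z hz hzI
  have hzI' : z ∈ Icc a b := ⟨hx.1.trans hzI.1.le, hzI.2⟩
  have hz2 := hHpos z hzI'
  have hpos : 0 < z - x := sub_pos.2 hzI.1
  have hv := hvar x hxI z hzI' hzI.1.le
  refine lt_of_le_of_lt ?_ (neg_lt.1 hz)
  simp only [Pi.div_apply]
  rw [slope_def_field, slope_def_field, ← neg_div (‖W x‖ ^ 2 * ‖W z‖ ^ 2),
    div_le_div_iff₀ hpos (by positivity), inner_sub_right]
  have e1 : -(2 * ((z - x)⁻¹ * (⟪B x, W z⟫_ℝ - ⟪B x, W x⟫_ℝ)) * ‖W x‖ ^ 2 -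
      ⟪B x, W x⟫_ℝ * ((‖W z‖ ^ 2 - ‖W x‖ ^ 2) / (z - x))) * (z - x) =
      -(2 * (⟪B x, W z⟫_ℝ - ⟪B x, W x⟫_ℝ) * ‖W x‖ ^ 2 -
      ⟪B x, W x⟫_ℝ * (‖W z‖ ^ 2 - ‖W x‖ ^ 2)) := by
    field_simp
  rw [e1]
  have e2 : (-(⟪B z, W z⟫_ℝ / ‖W z‖ ^ 2) - -(⟪B x, W x⟫_ℝ / ‖W x‖ ^ 2)) * (‖W x‖ ^ 2 * ‖W z‖ ^ 2) =
      -⟪B z, W z⟫_ℝ * ‖W x‖ ^ 2 + ⟪B x, W x⟫_ℝ * ‖W z‖ ^ 2 := by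
    have h1 : ‖W x‖ ≠ 0 := norm_ne_zero_iff.2 (hne x hxI)
    have h2 : ‖W z‖ ≠ 0 := norm_ne_zero_iff.2 (hne z hzI')
    field_simp
    ring
  rw [e2]
  nlinarith

/-- Backward uniqueness: a curve that vanishes at one time vanishes at all times. Before that time
`‖W‖²` is smaller; after it, the frequency bound makes `log ‖W‖²` Lipschitz, so `‖W‖²` cannot leave
the value `0`. -/
theorem forall_eq_zero_or_forall_ne_zero {T₀ : ℝ} (hcc : ContinuousOn c (Ioo 0 T₀))
    (hc : ∀ τ ∈ Ioo 0 T₀, 0 < c τ)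
    (hlip : ∀ τ ∈ Ioo 0 T₀, ∃ C : ℝ, ∀ᶠ τ' in 𝓝 τ, ‖W τ' - W τ‖ ≤ C * |τ' - τ|)
    (hder : ∀ τ ∈ Ioo 0 T₀, ∀ x : X, Tendsto (fun τ' => (τ' - τ)⁻¹ * ⟪x, W τ' - W τ⟫_ℝ) (𝓝[>] τ)
      (𝓝 (c τ * ⟪x, B τ⟫_ℝ)))
    (hE : ∀ τ ∈ Ioo 0 T₀, 0 ≤ ⟪B τ, W τ⟫_ℝ)
    (hmono : ∀ a ∈ Ioo 0 T₀, ∀ b ∈ Ioo 0 T₀, a ≤ b → (∀ τ ∈ Icc a b, W τ ≠ 0) →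
      ⟪B a, W a⟫_ℝ / ‖W a‖ ^ 2 ≤ ⟪B b, W b⟫_ℝ / ‖W b‖ ^ 2) :
    (∀ τ ∈ Ioo 0 T₀, W τ = 0) ∨ ∀ τ ∈ Ioo 0 T₀, W τ ≠ 0 := by
  have hWc : ∀ τ ∈ Ioo 0 T₀, ContinuousAt W τ := fun τ hτ =>
    continuousAt_of_eventually_norm_sub_le (hlip τ hτ)
  have hsub : ∀ {a b : ℝ}, a ∈ Ioo 0 T₀ → b ∈ Ioo 0 T₀ → Icc a b ⊆ Ioo 0 T₀ :=
    fun ha hb x hx => ⟨ha.1.trans_le hx.1, hx.2.trans_lt hb.2⟩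
  have hHc : ∀ {a b : ℝ}, a ∈ Ioo 0 T₀ → b ∈ Ioo 0 T₀ →
      ContinuousOn (fun τ => ‖W τ‖ ^ 2) (Icc a b) := fun ha hb τ hτ =>
    ((hWc τ (hsub ha hb hτ)).norm.pow 2).continuousWithinAt
  have hHd : ∀ τ ∈ Ioo 0 T₀,
      HasDerivWithinAt (fun τ' => ‖W τ'‖ ^ 2) (2 * c τ * ⟪B τ, W τ⟫_ℝ) (Ici τ) τ :=
    fun τ hτ => hasDerivWithinAt_norm_sq_of_weak (hlip τ hτ) (hder τ hτ)
  by_contra! hcon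
  obtain ⟨⟨b, hb, hWb⟩, a, ha, hWa⟩ := hcon
  -- `‖W‖²` is nondecreasing, so the zero `a` lies before the nonzero value at `b`
  have hab : a < b := by
    by_contra! hba
    have hmonoH := image_le_of_deriv_right_le_deriv_boundary (f := fun τ => -‖W τ‖ ^ 2)
      (f' := fun τ => -(2 * c τ * ⟪B τ, W τ⟫_ℝ)) (B := fun _ => -‖W b‖ ^ 2) (B' := fun _ => 0)
      (a := b) (b := a)
      (hHc hb ha).neg (fun τ hτ => (hHd τ (hsub hb ha ⟨hτ.1, hτ.2.le⟩)).neg) le_rfl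
      continuousOn_const (fun x _ => hasDerivWithinAt_const ..)
      (fun τ hτ => by
        have hτ' := hsub hb ha ⟨hτ.1, hτ.2.le⟩
        have := mul_nonneg (hc τ hτ').le (hE τ hτ')
        linarith) (right_mem_Icc.2 hba)
    have h1 : ‖W b‖ ^ 2 ≤ ‖W a‖ ^ 2 := by simpa using hmonoH
    rw [hWa, norm_zero] at h1
    have := norm_pos_iff.2 hWb
    nlinarith
  -- the last zero `m` before `b`
  set Z : Set ℝ := {τ | τ ∈ Icc a b ∧ ‖W τ‖ ^ 2 = 0} with hZ
  have hZne : Z.Nonempty := ⟨a, left_mem_Icc.2 hab.le, by simp [hWa]⟩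
  have hZcl : IsClosed Z :=
    ContinuousOn.preimage_isClosed_of_isClosed (hHc ha hb) isClosed_Icc isClosed_singleton
  have hZbdd : BddAbove Z := ⟨b, fun x hx => hx.1.2⟩
  set m := sSup Z with hm
  have hmZ : m ∈ Z := hZcl.csSup_mem hZne hZbdd
  have hmI : m ∈ Ioo 0 T₀ := hsub ha hb hmZ.1
  have hmb : m < b := lt_of_le_of_ne hmZ.1.2 (by
    rintro h
    have h2 := hmZ.2
    rw [h] at h2
    exact hWb (by simpa using h2))
  have hpos : ∀ τ ∈ Ioc m b, W τ ≠ 0 := fun τ hτ h0 =>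
    absurd (le_csSup hZbdd (show τ ∈ Z from ⟨⟨hmZ.1.1.trans hτ.1.le, hτ.2⟩, by simp [h0]⟩))
      (not_le.2 hτ.1)
  obtain ⟨K, hK⟩ := isCompact_Icc.exists_bound_of_continuousOn (hcc.mono (hsub hmI hb))
  set N := ⟪B b, W b⟫_ℝ / ‖W b‖ ^ 2 with hN
  set L := 2 * K * N with hL
  have hexp : ∀ x : ℝ, HasDerivAt (fun τ => Real.exp (-(L * τ)))
      (Real.exp (-(L * x)) * -(L * 1)) x := fun x =>
    (((hasDerivAt_id x).const_mul L).neg).exp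
  -- `‖W‖² exp (-L τ)` is nonincreasing on `(m, b]`
  have hdec : ∀ τ ∈ Ioo m b, ‖W b‖ ^ 2 * Real.exp (-(L * b)) ≤ ‖W τ‖ ^ 2 * Real.exp (-(L * τ)) := by
    intro τ₁ hτ₁
    have hτ₁I : τ₁ ∈ Ioo 0 T₀ := hsub hmI hb ⟨hτ₁.1.le, hτ₁.2.le⟩
    refine image_le_of_deriv_right_le_deriv_boundary
      (f := fun τ => ‖W τ‖ ^ 2 * Real.exp (-(L * τ)))
      (f' := fun τ => 2 * c τ * ⟪B τ, W τ⟫_ℝ * Real.exp (-(L * τ)) +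
        ‖W τ‖ ^ 2 * (Real.exp (-(L * τ)) * -(L * 1)))
      (B := fun _ => ‖W τ₁‖ ^ 2 * Real.exp (-(L * τ₁))) (B' := fun _ => 0)
      ((hHc hτ₁I hb).mul (by fun_prop))
      (fun τ hτ => (hHd τ (hsub hτ₁I hb ⟨hτ.1, hτ.2.le⟩)).mul (hexp τ).hasDerivWithinAt) le_rfl
      continuousOn_const (fun x _ => hasDerivWithinAt_const ..) ?_ (right_mem_Icc.2 hτ₁.2.le)
    intro τ hτ
    have hτI : τ ∈ Ioo 0 T₀ := hsub hτ₁I hb ⟨hτ.1, hτ.2.le⟩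
    have hW0 : 0 < ‖W τ‖ ^ 2 := by
      have := norm_pos_iff.2 (hpos τ ⟨hτ₁.1.trans_le hτ.1, hτ.2.le⟩); positivity
    have h1 := hmono τ hτI b hb hτ.2.le
      (fun r hr => hpos r ⟨hτ₁.1.trans_le (hτ.1.trans hr.1), hr.2⟩)
    rw [← hN, div_le_iff₀ hW0] at h1
    have h2 : c τ ≤ K := (le_abs_self _).trans
      (hK τ ⟨hτ₁.1.le.trans hτ.1, hτ.2.le⟩)
    have h3 : c τ * ⟪B τ, W τ⟫_ℝ ≤ K * (N * ‖W τ‖ ^ 2) :=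
      mul_le_mul h2 h1 (hE τ hτI) ((hc τ hτI).le.trans h2)
    have h4 : 2 * c τ * ⟪B τ, W τ⟫_ℝ * Real.exp (-(L * τ)) +
        ‖W τ‖ ^ 2 * (Real.exp (-(L * τ)) * -(L * 1)) =
        (2 * (c τ * ⟪B τ, W τ⟫_ℝ) - L * ‖W τ‖ ^ 2) * Real.exp (-(L * τ)) := by ring
    rw [h4]
    apply mul_nonpos_of_nonpos_of_nonneg _ (Real.exp_pos _).le
    rw [hL]; nlinarith
  have hlim : Tendsto (fun τ => ‖W τ‖ ^ 2 * Real.exp (-(L * τ))) (𝓝[>] m)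
      (𝓝 (‖W m‖ ^ 2 * Real.exp (-(L * m)))) := by
    have : ContinuousAt (fun τ : ℝ => Real.exp (-(L * τ))) m := by fun_prop
    exact (((hWc m hmI).norm.pow 2).mul this).mono_left nhdsWithin_le_nhds
  have hge := ge_of_tendsto hlim (eventually_of_mem (Ioo_mem_nhdsGT hmb) hdec)
  rw [hmZ.2, zero_mul] at hge
  have h5 := norm_pos_iff.2 hWb
  have h6 : 0 < ‖W b‖ ^ 2 * Real.exp (-(L * b)) := by positivity
  linarith

end HilbertCurve

/-! ### Weak convergence of bounded, pointwise convergent families in `L²` -/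

section WeakConvergence

variable {α ι : Type*} [MeasurableSpace α] {μ : Measure α}

/-- For every `M > 0`, `|g d| ≤ min |g d| (M g²) + d² / M`: the first term is dominated by `M g²`,
the integral of the second is at most `C / M`. -/
theorem tendsto_integral_mul_of_bounded {l : Filter ι} [l.IsCountablyGenerated]
    {g : α → ℝ} {d : ι → α → ℝ} (hg : MemLp g 2 μ) (hd : ∀ᶠ k in l, MemLp (d k) 2 μ) {C : ℝ}
    (hC : ∀ᶠ k in l, ∫ x, d k x ^ 2 ∂μ ≤ C)
    (hae : ∀ᵐ x ∂μ, Tendsto (fun k => d k x) l (𝓝 0)) :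
    Tendsto (fun k => ∫ x, g x * d k x ∂μ) l (𝓝 0) := by
  rw [Metric.tendsto_nhds]
  intro ε hε
  obtain ⟨M, hM, hCM⟩ : ∃ M : ℝ, 0 < M ∧ C / M < ε / 2 := by
    refine ⟨2 * (|C| + 1) / ε, by positivity, ?_⟩
    rw [div_div_eq_mul_div, div_lt_iff₀ (by positivity)]
    nlinarith [le_abs_self C]
  have hg2 : Integrable (fun x => g x ^ 2) μ := hg.integrable_sq
  have hmin : Tendsto (fun k => ∫ x, min |g x * d k x| (M * g x ^ 2) ∂μ) l
      (𝓝 (∫ _, (0 : ℝ) ∂μ)) := by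
    refine tendsto_integral_filter_of_dominated_convergence (fun x => M * g x ^ 2) ?_ ?_
      (hg2.const_mul M) ?_
    · filter_upwards [hd] with k hk
      exact ((hg.1.mul hk.1).norm).inf (hg2.1.const_mul M)
    · refine Eventually.of_forall fun k => Eventually.of_forall fun x => ?_
      rw [Real.norm_of_nonneg (by positivity)]
      exact min_le_right _ _
    · filter_upwards [hae] with x hx
      have h1 : Tendsto (fun k => |g x * d k x|) l (𝓝 0) := by
        simpa using (hx.const_mul (g x)).abs
      exact squeeze_zero (fun k => by positivity) (fun k => min_le_left _ _) h1
  rw [integral_zero, Metric.tendsto_nhds] at hmin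
  filter_upwards [hmin (ε / 2) (by positivity), hd, hC] with k hk hdk hCk
  rw [dist_zero_right, Real.norm_eq_abs] at hk ⊢
  have hi1 : Integrable (fun x => min |g x * d k x| (M * g x ^ 2)) μ :=
    (hg2.const_mul M).mono' (((hg.1.mul hdk.1).norm).inf (hg2.1.const_mul M))
      (Eventually.of_forall fun x => by
        rw [Real.norm_of_nonneg (by positivity)]; exact min_le_right _ _)
  have hi2 : Integrable (fun x => d k x ^ 2 / M) μ := hdk.integrable_sq.div_const M
  calc |∫ x, g x * d k x ∂μ| ≤ ∫ x, |g x * d k x| ∂μ := abs_integral_le_integral_abs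
    _ ≤ ∫ x, (min |g x * d k x| (M * g x ^ 2) + d k x ^ 2 / M) ∂μ := by
      refine integral_mono (hg.integrable_mul hdk).abs (hi1.add hi2) fun x => ?_
      dsimp only
      rcases le_total |g x * d k x| (M * g x ^ 2) with h | h
      · rw [min_eq_left h]; have : 0 ≤ d k x ^ 2 / M := by positivity
        linarith
      · rw [min_eq_right h]
        have h1 : |g x * d k x| ≤ d k x ^ 2 / M := by
          rw [le_div_iff₀ hM, abs_mul]
          rw [abs_mul, ← sq_abs (g x)] at h
          rw [← sq_abs (d k x)]
          rcases eq_or_lt_of_le (abs_nonneg (g x)) with h0 | h0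
          · rw [← h0]; simp; positivity
          · have h3 : M * |g x| ≤ |d k x| := le_of_mul_le_mul_left (by nlinarith) h0
            nlinarith [abs_nonneg (d k x)]
        have : 0 ≤ M * g x ^ 2 := by positivity
        linarith
    _ = ∫ x, min |g x * d k x| (M * g x ^ 2) ∂μ + (∫ x, d k x ^ 2 ∂μ) / M := by
      rw [integral_add hi1 hi2, integral_div]
    _ < ε := by
      have h1 := le_abs_self (∫ x, min |g x * d k x| (M * g x ^ 2) ∂μ)
      have h2 : (∫ x, d k x ^ 2 ∂μ) / M ≤ C / M := by gcongr
      linarith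

open Classical in
/-- The class in `L²(μ)` of a square integrable function; `0` if the function is not square
integrable. -/
noncomputable def toL2 (μ : Measure α) (f : α → ℝ) : Lp ℝ 2 μ :=
  if h : MemLp f 2 μ then h.toLp f else 0

theorem coeFn_toL2 {f : α → ℝ} (hf : MemLp f 2 μ) : toL2 μ f =ᵐ[μ] f := by
  rw [toL2, dif_pos hf]; exact hf.coeFn_toLp

theorem inner_toL2_right {f : α → ℝ} (hf : MemLp f 2 μ) (x : Lp ℝ 2 μ) :
    inner ℝ x (toL2 μ f) = ∫ a, x a * f a ∂μ := by
  rw [L2.inner_def]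
  refine integral_congr_ae ?_
  filter_upwards [coeFn_toL2 hf] with a h1
  rw [h1]; simp [mul_comm]

theorem inner_toL2 {f g : α → ℝ} (hf : MemLp f 2 μ) (hg : MemLp g 2 μ) :
    inner ℝ (toL2 μ f) (toL2 μ g) = ∫ a, f a * g a ∂μ := by
  rw [inner_toL2_right hg]
  refine integral_congr_ae ?_
  filter_upwards [coeFn_toL2 hf] with a h1
  rw [h1]

theorem norm_sq_toL2 {f : α → ℝ} (hf : MemLp f 2 μ) :
    ‖toL2 μ f‖ ^ 2 = ∫ a, f a ^ 2 ∂μ := by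
  rw [← real_inner_self_eq_norm_sq, inner_toL2 hf hf]; simp only [sq]

theorem toL2_sub {f g : α → ℝ} (hf : MemLp f 2 μ) (hg : MemLp g 2 μ) :
    toL2 μ f - toL2 μ g = toL2 μ (fun a => f a - g a) := by
  have h : MemLp (fun a => f a - g a) 2 μ := hf.sub hg
  rw [toL2, toL2, toL2, dif_pos hf, dif_pos hg, dif_pos h]
  exact (MemLp.toLp_sub hf hg).symm

theorem tendsto_inner_toL2 {l : Filter ι} [l.IsCountablyGenerated] {f : α → ℝ} {w : ι → α → ℝ}
    (hf : MemLp f 2 μ) (hw : ∀ᶠ k in l, MemLp (w k) 2 μ) {C : ℝ}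
    (hC : ∀ᶠ k in l, ∫ a, w k a ^ 2 ∂μ ≤ C)
    (hae : ∀ᵐ a ∂μ, Tendsto (fun k => w k a) l (𝓝 (f a))) (x : Lp ℝ 2 μ) :
    Tendsto (fun k => inner ℝ x (toL2 μ (w k))) l (𝓝 (inner ℝ x (toL2 μ f))) := by
  have h := tendsto_integral_mul_of_bounded (d := fun k a => w k a - f a) (l := l) (Lp.memLp x)
    (hw.mono fun k hk => hk.sub hf) (C := 2 * C + 2 * ∫ a, f a ^ 2 ∂μ) ?_ ?_
  · have h2 := h.add_const (inner ℝ x (toL2 μ f))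
    rw [zero_add] at h2
    refine h2.congr' ?_
    filter_upwards [hw] with k hk
    rw [inner_toL2_right hf, inner_toL2_right hk]
    refine (integral_add ((Lp.memLp x).integrable_mul (hk.sub hf))
      ((Lp.memLp x).integrable_mul hf)).symm.trans ?_
    congr 1; ext a; simp; ring
  · filter_upwards [hw, hC] with k hk hCk
    calc ∫ a, (w k a - f a) ^ 2 ∂μ ≤ ∫ a, (2 * w k a ^ 2 + 2 * f a ^ 2) ∂μ :=
          integral_mono (hk.sub hf).integrable_sq
            ((hk.integrable_sq.const_mul 2).add (hf.integrable_sq.const_mul 2)) fun a => by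
            dsimp only; nlinarith [sq_nonneg (w k a + f a)]
      _ = 2 * ∫ a, w k a ^ 2 ∂μ + 2 * ∫ a, f a ^ 2 ∂μ := by
          rw [integral_add (hk.integrable_sq.const_mul 2) (hf.integrable_sq.const_mul 2),
            integral_const_mul, integral_const_mul]
      _ ≤ _ := by linarith
  · filter_upwards [hae] with a ha
    simpa using ha.sub_const (f a)

end WeakConvergence

/-! ### Weak derivatives of continuously differentiable functions -/

section WeakDerivative

variable {n : ℕ} {F : Type*} [NormedAddCommGroup F] [NormedSpace ℝ F]
  {Ω : Set (EuclideanSpace ℝ (Fin n))}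

theorem integrable_smul_of_tsupport_subset {φ : EuclideanSpace ℝ (Fin n) → ℝ}
    {g : EuclideanSpace ℝ (Fin n) → F} (hφ : Continuous φ) (hc : HasCompactSupport φ)
    (hs : tsupport φ ⊆ Ω) (hg : ContinuousOn g Ω) : Integrable (fun x => φ x • g x) := by
  have h1 : IntegrableOn (fun x => φ x • g x) (tsupport φ) :=
    (hφ.continuousOn.smul (hg.mono hs)).integrableOn_compact hc
  refine (integrableOn_iff_integrable_of_support_subset ?_).1 h1
  refine subset_trans (fun x hx => ?_) (subset_tsupport φ)
  rw [Function.mem_support] at hx ⊢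
  exact fun h => hx (by simp [h])

theorem IsWeakFDeriv.ae_eq_fderiv [CompleteSpace F] (hΩ : IsOpen Ω)
    {f : EuclideanSpace ℝ (Fin n) → F}
    {f' : EuclideanSpace ℝ (Fin n) → EuclideanSpace ℝ (Fin n) →L[ℝ] F}
    (hf : ContDiffOn ℝ 1 f Ω) (h : IsWeakFDeriv Ω f f') :
    ∀ᵐ x, x ∈ Ω → f' x = fderiv ℝ f x := by
  have hfc : ContinuousOn (fderiv ℝ f) Ω := hf.continuousOn_fderiv_of_isOpen hΩ le_rfl
  have key : ∀ v : EuclideanSpace ℝ (Fin n), ∀ᵐ x, x ∈ Ω → f' x v - fderiv ℝ f x v = 0 := by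
    intro v
    have hfv : ContinuousOn (fun x => fderiv ℝ f x v) Ω := hfc.clm_apply continuousOn_const
    have hf'v : LocallyIntegrableOn (fun x => f' x v) Ω := fun x hx => by
      obtain ⟨s, hs, hi⟩ := h.2.1 x hx
      exact ⟨s, hs, (ContinuousLinearMap.apply ℝ F v).integrable_comp hi⟩
    refine hΩ.ae_eq_zero_of_integral_contDiff_smul_eq_zero
      (hf'v.sub (hfv.locallyIntegrableOn hΩ.measurableSet)) fun φ hφ hc hs => ?_
    have hφ' : ContDiff ℝ 1 φ := hφ.of_le (by exact_mod_cast le_top)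
    have hdφ : Continuous (fun x => fderiv ℝ φ x v) :=
      (hφ'.continuous_fderiv one_ne_zero).clm_apply continuous_const
    have hdc : HasCompactSupport (fun x => fderiv ℝ φ x v) := hc.fderiv_apply ℝ v
    have hds : tsupport (fun x => fderiv ℝ φ x v) ⊆ Ω :=
      (tsupport_fderiv_apply_subset ℝ v).trans hs
    have hwd := h.2.2 φ hφ hc hs v
    have hibp : ∫ x, φ x • fderiv ℝ f x v = -∫ x, fderiv ℝ φ x v • f x := by
      refine integral_smul_fderiv_eq_neg_fderiv_smul_of_integrable
        (integrable_smul_of_tsupport_subset hdφ hdc hds hf.continuousOn)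
        (integrable_smul_of_tsupport_subset hφ.continuous hc hs hfv)
        (integrable_smul_of_tsupport_subset hφ.continuous hc hs hf.continuousOn)
        (fun x _ => hφ'.differentiable one_ne_zero x)
        (fun x hx => (hf.differentiableOn one_ne_zero).differentiableAt (hΩ.mem_nhds (hs hx)))
    have hz : ∀ x, x ∉ Ω → φ x = 0 := fun x hx =>
      image_eq_zero_of_notMem_tsupport fun h => hx (hs h)
    have hdz : ∀ x, x ∉ Ω → fderiv ℝ φ x v = 0 := fun x hx =>
      image_eq_zero_of_notMem_tsupport (f := fun x => fderiv ℝ φ x v) fun h => hx (hds h)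
    rw [setIntegral_eq_integral_of_forall_compl_eq_zero (fun x hx => by rw [hdz x hx, zero_smul]),
      setIntegral_eq_integral_of_forall_compl_eq_zero (fun x hx => by rw [hz x hx, zero_smul])]
      at hwd
    have hint : Integrable (fun x => φ x • f' x v) := by
      have h1 := (h.2.1.mono_set hs).integrableOn_isCompact hc
      have h2 : IntegrableOn (fun x => f' x v) (tsupport φ) :=
        (ContinuousLinearMap.apply ℝ F v).integrable_comp h1
      have h3 : IntegrableOn (fun x => φ x • f' x v) (tsupport φ) :=
        h2.continuousOn_smul hφ.continuous.continuousOn hc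
      refine (integrableOn_iff_integrable_of_support_subset ?_).1 h3
      refine subset_trans (fun x hx => ?_) (subset_tsupport φ)
      rw [Function.mem_support] at hx ⊢
      exact fun h => hx (by simp [h])
    simp only [smul_sub]
    rw [integral_sub hint (integrable_smul_of_tsupport_subset hφ.continuous hc hs hfv), hibp, hwd]
    abel
  have hall : ∀ᵐ x, ∀ i : Fin n, x ∈ Ω →
      f' x (EuclideanSpace.basisFun (Fin n) ℝ i) -
        fderiv ℝ f x (EuclideanSpace.basisFun (Fin n) ℝ i) = 0 :=
    ae_all_iff.2 fun i => key _
  filter_upwards [hall] with x hx hxΩ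
  refine ContinuousLinearMap.coe_injective ?_
  refine (EuclideanSpace.basisFun (Fin n) ℝ).toBasis.ext fun i => ?_
  simpa [sub_eq_zero] using hx i hxΩ

theorem IsWeakFDeriv.congr_ae (hΩ : IsOpen Ω) {f g : EuclideanSpace ℝ (Fin n) → F}
    {f' : EuclideanSpace ℝ (Fin n) → EuclideanSpace ℝ (Fin n) →L[ℝ] F}
    (h : IsWeakFDeriv Ω f f') (hfg : ∀ᵐ x, x ∈ Ω → f x = g x) (hg : LocallyIntegrableOn g Ω) :
    IsWeakFDeriv Ω g f' := by
  refine ⟨hg, h.2.1, fun φ hφ hc hs v => ?_⟩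
  rw [← h.2.2 φ hφ hc hs v]
  refine setIntegral_congr_ae hΩ.measurableSet ?_
  filter_upwards [hfg] with x hx hxΩ
  rw [hx hxΩ]

/-- For a `C²` function the infimum in `sobolevNormSq` is the integral of the classical derivatives,
since weak derivatives are unique. -/
theorem lintegral_le_sobolevNormSq (hΩ : IsOpen Ω) {f : EuclideanSpace ℝ (Fin n) → ℝ}
    (hf : ContDiffOn ℝ 2 f Ω) {μ : Measure (EuclideanSpace ℝ (Fin n))} (hμ : μ ≪ volume) :
    ∫⁻ x in Ω, (‖f x‖ₑ ^ 2 + ‖fderiv ℝ f x‖ₑ ^ 2 + ‖fderiv ℝ (fderiv ℝ f) x‖ₑ ^ 2) ∂μ ≤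
      sobolevNormSq Ω μ f := by
  refine le_iInf fun f' => le_iInf fun f'' => le_iInf fun h1 => le_iInf fun h2 => ?_
  have hd : ContDiffOn ℝ 1 (fderiv ℝ f) Ω := hf.fderiv_of_isOpen hΩ (by norm_num)
  have e1 := h1.ae_eq_fderiv hΩ (hf.of_le (by norm_num))
  have e2 := (h2.congr_ae hΩ e1 (hd.continuousOn.locallyIntegrableOn hΩ.measurableSet)).ae_eq_fderiv
    hΩ hd
  refine le_of_eq (setLIntegral_congr_fun_ae hΩ.measurableSet ?_)
  filter_upwards [hμ.ae_le e1, hμ.ae_le e2] with x hx1 hx2 hx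
  rw [hx1 hx, hx2 hx]

end WeakDerivative

/-! ### Integration by parts against a Gaussian weight -/

section IntegrationByParts

variable {n : ℕ}

local notation "𝔼" => EuclideanSpace ℝ (Fin n)

theorem fderiv_apply_eq_inner_gradient (f : 𝔼 → ℝ) (x w : 𝔼) :
    fderiv ℝ f x w = ⟪gradient f x, w⟫_ℝ := by
  rw [← toDual_gradient, InnerProductSpace.toDual_apply_apply]

theorem norm_gradient_eq (f : 𝔼 → ℝ) (x : 𝔼) : ‖gradient f x‖ = ‖fderiv ℝ f x‖ := by
  rw [← toDual_gradient, LinearIsometryEquiv.norm_map]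

theorem continuousOn_gradient_iff {f : 𝔼 → ℝ} {D : Set 𝔼} :
    ContinuousOn (gradient f) D ↔ ContinuousOn (fderiv ℝ f) D := by
  rw [← toDual_comp_gradient]
  exact ((InnerProductSpace.toDual ℝ 𝔼).comp_continuousOn_iff).symm

theorem laplacian_eq_sum_fderiv {v : 𝔼 → ℝ} {D : Set 𝔼} (hD : IsOpen D)
    (hv : ContDiffOn ℝ 2 v D) {x : 𝔼} (hx : x ∈ D) :
    (Δ v) x = ∑ i, fderiv ℝ (fun y => fderiv ℝ v y (EuclideanSpace.basisFun (Fin n) ℝ i)) x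
      (EuclideanSpace.basisFun (Fin n) ℝ i) := by
  rw [InnerProductSpace.laplacian_eq_iteratedFDeriv_orthonormalBasis v
    (EuclideanSpace.basisFun (Fin n) ℝ)]
  have hd : DifferentiableAt ℝ (fderiv ℝ v) x :=
    ((hv.fderiv_of_isOpen (m := 1) hD (by norm_num)).differentiableOn one_ne_zero).differentiableAt
      (hD.mem_nhds hx)
  refine Finset.sum_congr rfl fun i _ => ?_
  rw [iteratedFDeriv_two_apply, fderiv_clm_apply hd (differentiableAt_const _)]
  simp

theorem abs_laplacian_le {v : 𝔼 → ℝ} {x : 𝔼} :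
    |(Δ v) x| ≤ n * ‖fderiv ℝ (fderiv ℝ v) x‖ := by
  rw [InnerProductSpace.laplacian_eq_iteratedFDeriv_orthonormalBasis v
    (EuclideanSpace.basisFun (Fin n) ℝ)]
  refine (Finset.abs_sum_le_sum_abs _ _).trans ?_
  refine (Finset.sum_le_card_nsmul _ _ ‖fderiv ℝ (fderiv ℝ v) x‖ fun i _ => ?_).trans (by simp)
  rw [iteratedFDeriv_two_apply]
  have h1 := ((fderiv ℝ (fderiv ℝ v) x) (EuclideanSpace.basisFun (Fin n) ℝ i)).le_opNorm
    (EuclideanSpace.basisFun (Fin n) ℝ i)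
  have h2 := (fderiv ℝ (fderiv ℝ v) x).le_opNorm (EuclideanSpace.basisFun (Fin n) ℝ i)
  rw [OrthonormalBasis.norm_eq_one, mul_one] at h1 h2
  simpa using h1.trans h2

theorem continuousOn_laplacian {v : 𝔼 → ℝ} {D : Set 𝔼} (hD : IsOpen D)
    (hv : ContDiffOn ℝ 2 v D) : ContinuousOn (Δ v) D := by
  have h2 : ContinuousOn (fderiv ℝ (fderiv ℝ v)) D :=
    (hv.fderiv_of_isOpen (m := 1) hD (by norm_num)).continuousOn_fderiv_of_isOpen hD le_rfl
  rw [InnerProductSpace.laplacian_eq_iteratedFDeriv_orthonormalBasis v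
    (EuclideanSpace.basisFun (Fin n) ℝ)]
  simp only [iteratedFDeriv_two_apply]
  exact continuousOn_finsetSum _ fun i _ =>
    (h2.clm_apply continuousOn_const).clm_apply continuousOn_const

/-- The Gaussian measure `K exp(-|x|² / (2s)) dx`. -/
noncomputable def gaussianWeight (n : ℕ) (K s : ℝ) : Measure (EuclideanSpace ℝ (Fin n)) :=
  volume.withDensity fun x => ENNReal.ofReal (K * Real.exp (-‖x‖ ^ 2 / (2 * s)))

theorem integral_gaussianWeight {K s : ℝ} (hK : 0 ≤ K) (f : 𝔼 → ℝ) :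
    ∫ x, f x ∂(gaussianWeight n K s) = K * ∫ x, Real.exp (-‖x‖ ^ 2 / (2 * s)) * f x := by
  rw [gaussianWeight, integral_withDensity_eq_integral_toReal_smul (by fun_prop) (by simp),
    ← integral_const_mul]
  congr 1; ext x
  rw [ENNReal.toReal_ofReal (by positivity), smul_eq_mul, mul_assoc]

/-- Integration by parts for the weighted operator `s Δ - x · ∇`, which is symmetric with respect to
`exp(-|x|² / (2s)) dx`, against a compactly supported test function. -/
theorem integral_fderiv_gradient_of_hasCompactSupport {K s : ℝ} (hK : 0 ≤ K) (hs : 0 < s)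
    {D : Set 𝔼} (hD : IsOpen D) {v η : 𝔼 → ℝ} (hv : ContDiffOn ℝ 2 v D) (hη : ContDiff ℝ 1 η)
    (hc : HasCompactSupport η) (hηD : tsupport η ⊆ D) :
    s * ∫ x, fderiv ℝ η x (gradient v x) ∂(gaussianWeight n K s) =
      ∫ x, η x * (⟪x, gradient v x⟫_ℝ - s * (Δ v) x) ∂(gaussianWeight n K s) := by
  set b := EuclideanSpace.basisFun (Fin n) ℝ with hb
  set g : 𝔼 → ℝ := fun x => Real.exp (-‖x‖ ^ 2 / (2 * s)) with hg
  have hgd : ∀ x, HasFDerivAt g (g x • ((-(1 / s)) • innerSL ℝ x)) x := by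
    intro x
    have h1 : HasFDerivAt (fun x : 𝔼 => -‖x‖ ^ 2 / (2 * s)) ((-(1 / s)) • innerSL ℝ x) x := by
      have h2 := ((hasStrictFDerivAt_norm_sq x).hasFDerivAt.neg).mul_const (2 * s)⁻¹
      simp only [div_eq_mul_inv]
      refine h2.congr_fderiv ?_
      ext w
      simp
      field_simp
    exact h1.exp
  have hgc : Continuous g := by fun_prop
  have hfd : ContinuousOn (fderiv ℝ v) D := hv.continuousOn_fderiv_of_isOpen hD (by norm_num)
  have hd1 : ContDiffOn ℝ 1 (fderiv ℝ v) D := hv.fderiv_of_isOpen hD (by norm_num)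
  have hdη : Continuous (fderiv ℝ η) := hη.continuous_fderiv one_ne_zero
  have hηd : ∀ x, HasFDerivAt η (fderiv ℝ η x) x := fun x =>
    (hη.differentiable one_ne_zero x).hasFDerivAt
  have hdi : ∀ i, ContDiffOn ℝ 1 (fun y => fderiv ℝ v y (b i)) D := fun i =>
    hd1.clm_apply contDiffOn_const
  have hdic : ∀ i, ContinuousOn (fun y => fderiv ℝ (fun y => fderiv ℝ v y (b i)) y (b i)) D :=
    fun i => ((hdi i).continuousOn_fderiv_of_isOpen hD le_rfl).clm_apply continuousOn_const
  have hprod : ∀ x, HasFDerivAt (fun y => η y * g y)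
      (η x • (g x • ((-(1 / s)) • innerSL ℝ x)) + g x • fderiv ℝ η x) x := fun x =>
    (hηd x).mul (hgd x)
  have hpc : Continuous fun y => η y * g y := hη.continuous.mul hgc
  have hsup : HasCompactSupport fun y => η y * g y := hc.mul_right
  have hsupD : tsupport (fun y => η y * g y) ⊆ D := (tsupport_mul_subset_left).trans hηD
  have hdp : ∀ i, (fun x => fderiv ℝ (fun y => η y * g y) x (b i)) =
      fun x => g x * fderiv ℝ η x (b i) - s⁻¹ * (η x * g x * ⟪x, b i⟫_ℝ) := by
    intro i; ext x
    rw [(hprod x).fderiv]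
    simp
    ring
  have hdpc : ∀ i, Continuous fun x => fderiv ℝ (fun y => η y * g y) x (b i) := by
    intro i
    rw [hdp i]
    have : Continuous fun x => fderiv ℝ η x (b i) := hdη.clm_apply continuous_const
    fun_prop
  have hI1 : ∀ i, Integrable fun x => fderiv ℝ (fun y => η y * g y) x (b i) * fderiv ℝ v x (b i) :=
    fun i => integrable_smul_of_tsupport_subset (hdpc i) (hsup.fderiv_apply ℝ (b i))
      ((tsupport_fderiv_apply_subset ℝ (b i)).trans hsupD) (hdi i).continuousOn
  have hI2 : ∀ i, Integrable fun x => η x * g x * fderiv ℝ (fun y => fderiv ℝ v y (b i)) x (b i) :=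
    fun i => integrable_smul_of_tsupport_subset hpc hsup hsupD (hdic i)
  have hibp : ∀ i, ∫ x, η x * g x * fderiv ℝ (fun y => fderiv ℝ v y (b i)) x (b i) =
      -∫ x, fderiv ℝ (fun y => η y * g y) x (b i) * fderiv ℝ v x (b i) := fun i =>
    integral_mul_fderiv_eq_neg_fderiv_mul_of_integrable (hI1 i) (hI2 i)
      (integrable_smul_of_tsupport_subset hpc hsup hsupD (hdi i).continuousOn)
      (fun x _ => (hprod x).differentiableAt)
      (fun x hx => ((hdi i).differentiableOn one_ne_zero).differentiableAt (hD.mem_nhds (hsupD hx)))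
  have hsum := congrArg Finset.univ.sum (funext hibp)
  rw [Finset.sum_neg_distrib, ← integral_finsetSum _ fun i _ => hI1 i,
    ← integral_finsetSum _ fun i _ => hI2 i] at hsum
  have e1 : ∀ x, ∑ i, η x * g x * fderiv ℝ (fun y => fderiv ℝ v y (b i)) x (b i) =
      g x * (η x * (Δ v) x) := by
    intro x
    by_cases hx : x ∈ D
    · rw [laplacian_eq_sum_fderiv hD hv hx, ← Finset.mul_sum]; ring
    · have : η x = 0 := image_eq_zero_of_notMem_tsupport fun h => hx (hηD h)
      simp [this]
  have e2 : ∀ x, ∑ i, fderiv ℝ (fun y => η y * g y) x (b i) * fderiv ℝ v x (b i) =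
      g x * fderiv ℝ η x (gradient v x) - s⁻¹ * (g x * (η x * ⟪x, gradient v x⟫_ℝ)) := by
    intro x
    have h1 : ∀ i, fderiv ℝ (fun y => η y * g y) x (b i) * fderiv ℝ v x (b i) =
        g x * (⟪gradient η x, b i⟫_ℝ * ⟪b i, gradient v x⟫_ℝ) -
          s⁻¹ * (g x * η x) * (⟪x, b i⟫_ℝ * ⟪b i, gradient v x⟫_ℝ) := by
      intro i
      have := congrFun (hdp i) x
      rw [this, fderiv_apply_eq_inner_gradient v, fderiv_apply_eq_inner_gradient η,
        real_inner_comm (b i) (gradient v x)]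
      ring
    simp only [h1]
    rw [Finset.sum_sub_distrib, ← Finset.mul_sum, ← Finset.mul_sum, b.sum_inner_mul_inner,
      b.sum_inner_mul_inner, ← fderiv_apply_eq_inner_gradient]
    ring
  simp only [e1, e2] at hsum
  have hgr : ContinuousOn (gradient v) D := continuousOn_gradient_iff.2 hfd
  have hJ1 : Integrable fun x => g x * fderiv ℝ η x (gradient v x) := by
    have hJ0 : ∀ i, Integrable fun x => fderiv ℝ η x (b i) * (g x * fderiv ℝ v x (b i)) :=
      fun i => integrable_smul_of_tsupport_subset (hdη.clm_apply continuous_const)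
        (hc.fderiv_apply ℝ (b i)) ((tsupport_fderiv_apply_subset ℝ (b i)).trans hηD)
        (hgc.continuousOn.mul (hdi i).continuousOn)
    refine (integrable_finsetSum Finset.univ fun i _ => hJ0 i).congr
      (Eventually.of_forall fun x => ?_)
    beta_reduce
    rw [fderiv_apply_eq_inner_gradient η, ← b.sum_inner_mul_inner, Finset.mul_sum]
    refine Finset.sum_congr rfl fun i _ => ?_
    rw [fderiv_apply_eq_inner_gradient v, fderiv_apply_eq_inner_gradient η,
        real_inner_comm (b i) (gradient v x)]
    ring
  have hJ2 : Integrable fun x => g x * (η x * ⟪x, gradient v x⟫_ℝ) := by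
    have := integrable_smul_of_tsupport_subset hη.continuous hc hηD
      (hgc.continuousOn.mul (continuousOn_id.inner hgr))
    refine this.congr (Eventually.of_forall fun x => ?_)
    simp; ring
  have hJ3 : Integrable fun x => g x * (η x * (Δ v) x) := by
    have := integrable_smul_of_tsupport_subset hη.continuous hc hηD
      (hgc.continuousOn.mul (continuousOn_laplacian hD hv))
    refine this.congr (Eventually.of_forall fun x => ?_)
    simp; ring
  rw [integral_sub hJ1 (hJ2.const_mul _), integral_const_mul] at hsum
  rw [integral_gaussianWeight hK, integral_gaussianWeight hK]
  have e3 : ∀ x, g x * (η x * (⟪x, gradient v x⟫_ℝ - s * (Δ v) x)) =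
      g x * (η x * ⟪x, gradient v x⟫_ℝ) - s * (g x * (η x * (Δ v) x)) := fun x => by ring
  change s * (K * ∫ x, g x * fderiv ℝ η x (gradient v x)) =
    K * ∫ x, g x * (η x * (⟪x, gradient v x⟫_ℝ - s * (Δ v) x))
  simp only [e3]
  rw [integral_sub hJ2 (hJ3.const_mul s), integral_const_mul, hsum]
  field_simp
  ring

/-! ### Truncations -/

/-- Truncations of the identity of `ℝ` near `0`, with uniformly bounded slopes. -/
theorem exists_truncation : ∃ (ψ : ℕ → ℝ → ℝ) (C : ℝ), 0 ≤ C ∧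
    (∀ k, ContDiff ℝ 1 (ψ k)) ∧ (∀ (k : ℕ) r, |r| ≤ 1 / ((k : ℝ) + 1) → ψ k r = 0) ∧
    (∀ k r, |ψ k r| ≤ |r|) ∧ (∀ k r, |deriv (ψ k) r| ≤ C) ∧
    ∀ r, r ≠ 0 → ∀ᶠ k in atTop, ψ k =ᶠ[𝓝 r] id := by
  set ψ₀ : ℝ → ℝ := fun r => r * Real.smoothTransition (r ^ 2 - 1) with hψ₀
  have hsm : ContDiff ℝ 1 ψ₀ :=
    contDiff_id.mul ((Real.smoothTransition.contDiff (n := 1)).comp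
      ((contDiff_id.pow 2).sub contDiff_const))
  have hone : ∀ r : ℝ, 2 ≤ r ^ 2 → ψ₀ r = r := fun r hr => by
    simp only [hψ₀]
    rw [Real.smoothTransition.one_of_one_le (by linarith), mul_one]
  obtain ⟨C₁, hC₁⟩ := (isCompact_Icc (a := (-2 : ℝ)) (b := 2)).exists_bound_of_continuousOn
    (hsm.continuous_deriv le_rfl).continuousOn
  have hC₁' : ∀ r, |deriv ψ₀ r| ≤ max C₁ 1 := by
    intro r
    by_cases hr : r ∈ Icc (-2 : ℝ) 2
    · exact (hC₁ r hr).trans (le_max_left _ _)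
    · have h4 : 2 < r ^ 2 := by
        by_contra! h
        exact hr ⟨by nlinarith, by nlinarith⟩
      have : ψ₀ =ᶠ[𝓝 r] id := by
        filter_upwards [(continuous_pow 2).continuousAt.eventually (lt_mem_nhds h4)] with y hy
        exact hone y hy.le
      rw [this.deriv_eq]
      simp
  refine ⟨fun (k : ℕ) r => ψ₀ (((k : ℝ) + 1) * r) / ((k : ℝ) + 1), max C₁ 1,
    zero_le_one.trans (le_max_right _ _), fun k => ?_,
    fun k r hr => ?_, fun k r => ?_, fun k r => ?_, fun r hr => ?_⟩
  · exact (hsm.comp (contDiff_const.mul contDiff_id)).div_const _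
  · have hk : (0 : ℝ) < k + 1 := by positivity
    have h1 : |(k + 1) * r| ≤ 1 := by
      rw [abs_mul, abs_of_pos hk, mul_comm]; rwa [le_div_iff₀ hk] at hr
    have h2 : ((k + 1) * r) ^ 2 ≤ 1 := by rw [← sq_abs]; nlinarith [abs_nonneg ((k + 1) * r)]
    simp only [hψ₀]
    rw [Real.smoothTransition.zero_of_nonpos (by linarith)]
    simp
  · have hk : (0 : ℝ) < k + 1 := by positivity
    simp only [hψ₀]
    rw [mul_assoc, mul_div_cancel_left₀ _ hk.ne', abs_mul,
      abs_of_nonneg (Real.smoothTransition.nonneg _)]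
    exact mul_le_of_le_one_right (abs_nonneg _) (Real.smoothTransition.le_one _)
  · have hk : (0 : ℝ) < k + 1 := by positivity
    have : HasDerivAt (fun r => ψ₀ (((k : ℝ) + 1) * r) / ((k : ℝ) + 1))
        (deriv ψ₀ ((k + 1) * r) * ((k + 1) * 1) / (k + 1)) r :=
      (HasDerivAt.comp r ((hsm.differentiable one_ne_zero _).hasDerivAt)
        ((hasDerivAt_id r).const_mul ((k : ℝ) + 1))).div_const _
    rw [this.deriv, mul_one, mul_div_cancel_right₀ _ hk.ne']
    exact hC₁' _
  · obtain ⟨k₀, hk₀⟩ := exists_nat_gt (2 / |r|)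
    have hr' := abs_pos.2 hr
    filter_upwards [eventually_ge_atTop k₀] with k hk
    have hk' : (k₀ : ℝ) ≤ k := by exact_mod_cast hk
    rw [div_lt_iff₀ hr'] at hk₀
    have hlt : 2 < ((k + 1) * r) ^ 2 := by
      rw [← sq_abs, abs_mul, abs_of_pos (by positivity : (0 : ℝ) < k + 1)]
      have h3 : 2 < ((k : ℝ) + 1) * |r| := by nlinarith
      nlinarith
    have hct : ContinuousAt (fun y : ℝ => ((k + 1) * y) ^ 2) r := by fun_prop
    filter_upwards [hct.eventually (lt_mem_nhds hlt)] with y hy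
    rw [hone _ hy.le]
    field_simp
    rfl

/-- Cutoff functions exhausting `ℝⁿ`, with uniformly bounded gradients. -/
theorem exists_cutoff (n : ℕ) : ∃ (χ : ℕ → EuclideanSpace ℝ (Fin n) → ℝ) (C : ℝ), 0 ≤ C ∧
    (∀ k, ContDiff ℝ 1 (χ k)) ∧ (∀ k, HasCompactSupport (χ k)) ∧ (∀ k x, |χ k x| ≤ 1) ∧
    (∀ k x, ‖fderiv ℝ (χ k) x‖ ≤ C) ∧ ∀ x, ∀ᶠ k in atTop, χ k =ᶠ[𝓝 x] fun _ => 1 := by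
  let χ₀ : ContDiffBump (0 : EuclideanSpace ℝ (Fin n)) := ⟨1, 2, one_pos, one_lt_two⟩
  have hsm : ContDiff ℝ 1 χ₀ := χ₀.contDiff
  obtain ⟨C, hC⟩ := (hsm.continuous_fderiv one_ne_zero).bounded_above_of_compact_support
    (χ₀.hasCompactSupport.fderiv (𝕜 := ℝ))
  have hk : ∀ k : ℕ, (0 : ℝ) < k + 1 := fun k => by positivity
  refine ⟨fun (k : ℕ) x => χ₀ (((k : ℝ) + 1)⁻¹ • x), C, (norm_nonneg _).trans (hC 0), fun k => ?_,
    fun k => ?_, fun k x => ?_, fun k x => ?_, fun x => ?_⟩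
  · exact hsm.comp (contDiff_id.const_smul _)
  · exact χ₀.hasCompactSupport.comp_smul (inv_ne_zero (hk k).ne')
  · rw [abs_of_nonneg χ₀.nonneg]; exact χ₀.le_one
  · have h1 : HasFDerivAt (fun y : EuclideanSpace ℝ (Fin n) => ((k : ℝ) + 1)⁻¹ • y)
        (((k : ℝ) + 1)⁻¹ • ContinuousLinearMap.id ℝ (EuclideanSpace ℝ (Fin n))) x :=
      (((k : ℝ) + 1)⁻¹ • ContinuousLinearMap.id ℝ (EuclideanSpace ℝ (Fin n))).hasFDerivAt
    have h2 := HasFDerivAt.comp x (hsm.differentiable one_ne_zero _).hasFDerivAt h1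
    have h3 : fderiv ℝ (fun x => χ₀ (((k : ℝ) + 1)⁻¹ • x)) x = _ := h2.fderiv
    rw [h3, ContinuousLinearMap.comp_smul, ContinuousLinearMap.comp_id, norm_smul, norm_inv,
      Real.norm_of_nonneg (hk k).le]
    have h4 := hC (((k : ℝ) + 1)⁻¹ • x)
    rw [inv_mul_le_iff₀ (hk k)]
    nlinarith [norm_nonneg (fderiv ℝ χ₀ (((k : ℝ) + 1)⁻¹ • x))]
  · obtain ⟨k₀, hk₀⟩ := exists_nat_gt ‖x‖
    filter_upwards [eventually_ge_atTop k₀] with k hkk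
    have hk' : (k₀ : ℝ) ≤ k := by exact_mod_cast hkk
    filter_upwards [continuous_norm.continuousAt.eventually (gt_mem_nhds hk₀)] with y hy
    refine χ₀.one_of_mem_closedBall ?_
    rw [mem_closedBall_zero_iff, norm_smul, norm_inv, Real.norm_of_nonneg (hk k).le,
      inv_mul_le_iff₀ (hk k)]
    change ‖y‖ ≤ (k + 1) * 1
    linarith

end IntegrationByParts

/-! ### Integration by parts without boundary regularity -/

section BoundaryIntegrationByParts

variable {n : ℕ}

local notation "𝔼" => EuclideanSpace ℝ (Fin n)

/-- The derivative of a differentiable function vanishes at almost every zero: on the zero set the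
function is approximated by the linear map `0` with no error. -/
theorem ae_fderiv_eq_zero_of_eq_zero {D : Set 𝔼} (hD : IsOpen D) {f : 𝔼 → ℝ}
    (hf : DifferentiableOn ℝ f D) : ∀ᵐ x, x ∈ D → f x = 0 → fderiv ℝ f x = 0 := by
  rcases subsingleton_or_nontrivial 𝔼 with h | h
  · exact Eventually.of_forall fun x _ _ => ContinuousLinearMap.ext fun w => by
      rw [Subsingleton.elim w 0]; simp
  obtain ⟨e, he⟩ := exists_ne (0 : 𝔼)
  obtain ⟨t, ht, hte⟩ := continuousOn_iff_isClosed.1 hf.continuousOn {0} isClosed_singleton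
  set S : Set 𝔼 := f ⁻¹' {0} ∩ D with hS
  have hSm : MeasurableSet S := hte ▸ ht.measurableSet.inter hD.measurableSet
  have happ : ApproximatesLinearOn (fun x => f x • e) (0 : 𝔼 →L[ℝ] 𝔼) S 0 := by
    intro x hx y hy
    have h1 : f x = 0 := hx.1
    have h2 : f y = 0 := hy.1
    simp [h1, h2]
  have h1 := happ.norm_fderiv_sub_le volume hSm (fun x => (fderiv ℝ f x).smulRight e) fun x hx =>
    (((hf.differentiableAt (hD.mem_nhds hx.2)).hasFDerivAt).smul_const e).hasFDerivWithinAt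
  rw [ae_restrict_iff' hSm] at h1
  filter_upwards [h1] with x hx hxD hfx
  have h2 := hx ⟨hfx, hxD⟩
  rw [sub_zero, nonpos_iff_eq_zero, nnnorm_eq_zero] at h2
  ext w
  have h3 := DFunLike.congr_fun h2 w
  simpa [he] using h3

/-- Integration by parts for `s Δ - x · ∇` against a continuous function `φ` that vanishes off `D`
and is `C¹` where it does not vanish. No regularity of `∂D` enters: `φ` is replaced by truncations
that vanish near `∂D` and near infinity. -/
theorem integral_fderiv_gradient_of_continuous {K s : ℝ} (hK : 0 ≤ K) (hs : 0 < s)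
    {D : Set 𝔼} (hD : IsOpen D) {v φ : 𝔼 → ℝ} (hv : ContDiffOn ℝ 2 v D) (hφ : Continuous φ)
    (hφD : ∀ x, φ x ≠ 0 → x ∈ D) (hφ1 : ∀ x, φ x ≠ 0 → ContDiffAt ℝ 1 φ x)
    (hv1 : MemLp (D.indicator fun x => ‖gradient v x‖) 2 (gaussianWeight n K s))
    (hb : MemLp (D.indicator fun x => ⟪x, gradient v x⟫_ℝ - s * (Δ v) x) 2 (gaussianWeight n K s))
    (hφ2 : MemLp φ 2 (gaussianWeight n K s))
    (hdφ : MemLp ({x | φ x ≠ 0}.indicator fun x => ‖fderiv ℝ φ x‖) 2 (gaussianWeight n K s)) :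
    s * ∫ x, {x | φ x ≠ 0}.indicator (fun x => fderiv ℝ φ x (gradient v x)) x
        ∂(gaussianWeight n K s) =
      ∫ x, φ x * D.indicator (fun x => ⟪x, gradient v x⟫_ℝ - s * (Δ v) x) x
        ∂(gaussianWeight n K s) := by
  set ν := gaussianWeight n K s with hν
  set β : 𝔼 → ℝ := D.indicator fun x => ⟪x, gradient v x⟫_ℝ - s * (Δ v) x with hβ
  obtain ⟨ψ, C₁, hC₁, hψd, hψ0, hψle, hψ', hψlim⟩ := exists_truncation
  obtain ⟨χ, C₂, hC₂, hχd, hχc, hχ1, hχ', hχlim⟩ := exists_cutoff n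
  set η : ℕ → 𝔼 → ℝ := fun k x => ψ k (φ x) * χ k x with hη
  have hψφ : ∀ k, ContDiff ℝ 1 fun x => ψ k (φ x) := by
    intro k
    refine contDiff_iff_contDiffAt.2 fun x => ?_
    by_cases hx : φ x = 0
    · have h1 : (fun x => ψ k (φ x)) =ᶠ[𝓝 x] fun _ => 0 := by
        have h2 : |φ x| < 1 / ((k : ℝ) + 1) := by rw [hx, abs_zero]; positivity
        filter_upwards [hφ.abs.continuousAt.eventually (gt_mem_nhds h2)] with y hy
        exact hψ0 k _ hy.le
      exact contDiffAt_const.congr_of_eventuallyEq h1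
    · exact (hψd k).contDiffAt.comp x (hφ1 x hx)
  have hηd : ∀ k, ContDiff ℝ 1 (η k) := fun k => (hψφ k).mul (hχd k)
  have hηc : ∀ k, HasCompactSupport (η k) := fun k => (hχc k).mul_left
  have hηD : ∀ k, tsupport (η k) ⊆ D := by
    intro k
    have h1 : tsupport (η k) ⊆ {x | 1 / ((k : ℝ) + 1) ≤ |φ x|} := by
      refine closure_minimal (fun x hx => ?_) (isClosed_le continuous_const hφ.abs)
      by_contra h
      refine hx ?_
      have h0 := hψ0 k (φ x) (not_le.1 h).le
      simp only [hη, h0, zero_mul]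
    refine h1.trans fun x hx => hφD x ?_
    have h2 : 0 < |φ x| := lt_of_lt_of_le (by positivity) (mem_ofPred_eq ▸ hx)
    exact abs_pos.1 h2
  -- values and derivatives of the truncations
  have hηle : ∀ k x, |η k x| ≤ |φ x| := fun k x => by
    simp only [hη, abs_mul]
    nlinarith [hψle k (φ x), hχ1 k x, abs_nonneg (χ k x), abs_nonneg (φ x)]
  have hdη0 : ∀ k x, φ x = 0 → fderiv ℝ (η k) x = 0 := by
    intro k x hx
    have h2 : |φ x| < 1 / ((k : ℝ) + 1) := by rw [hx, abs_zero]; positivity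
    have h1 : η k =ᶠ[𝓝 x] fun _ => 0 := by
      filter_upwards [hφ.abs.continuousAt.eventually (gt_mem_nhds h2)] with y hy
      simp only [hη, hψ0 k _ hy.le, zero_mul]
    rw [h1.fderiv_eq]; simp
  have hdηle : ∀ k x, φ x ≠ 0 → ‖fderiv ℝ (η k) x‖ ≤ C₁ * ‖fderiv ℝ φ x‖ + C₂ * |φ x| := by
    intro k x hx
    have h1 : HasFDerivAt φ (fderiv ℝ φ x) x :=
      ((hφ1 x hx).differentiableAt one_ne_zero).hasFDerivAt
    have h2 : HasFDerivAt (fun y => ψ k (φ y)) (deriv (ψ k) (φ x) • fderiv ℝ φ x) x :=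
      (((hψd k).differentiable one_ne_zero _).hasDerivAt).comp_hasFDerivAt x h1
    have h3 : HasFDerivAt (χ k) (fderiv ℝ (χ k) x) x :=
      ((hχd k).differentiable one_ne_zero x).hasFDerivAt
    have h4 : fderiv ℝ (η k) x = _ := (h2.mul h3).fderiv
    rw [h4]
    refine (norm_add_le _ _).trans ?_
    rw [norm_smul, norm_smul, norm_smul, Real.norm_eq_abs, Real.norm_eq_abs, Real.norm_eq_abs]
    have h5 : |ψ k (φ x)| * ‖fderiv ℝ (χ k) x‖ ≤ |φ x| * C₂ :=
      mul_le_mul (hψle k _) (hχ' k x) (norm_nonneg _) (abs_nonneg _)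
    have h6 : |χ k x| * (|deriv (ψ k) (φ x)| * ‖fderiv ℝ φ x‖) ≤ 1 * (C₁ * ‖fderiv ℝ φ x‖) :=
      mul_le_mul (hχ1 k x) (mul_le_mul_of_nonneg_right (hψ' k _) (norm_nonneg _))
        (by positivity) zero_le_one
    linarith
  have hev : ∀ x, φ x ≠ 0 → ∀ᶠ k in atTop, η k =ᶠ[𝓝 x] φ := by
    intro x hx
    filter_upwards [hψlim _ hx, hχlim x] with k h1 h2
    filter_upwards [hφ.continuousAt.eventually h1, h2] with y h3 h4
    simp only [hη, h3, h4, id, mul_one]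
  have hstep : ∀ k, s * ∫ x, fderiv ℝ (η k) x (gradient v x) ∂ν =
      ∫ x, η k x * β x ∂ν := by
    intro k
    rw [hν, integral_fderiv_gradient_of_hasCompactSupport hK hs hD hv (hηd k) (hηc k) (hηD k)]
    congr 1; ext x
    by_cases hx : x ∈ D
    · rw [hβ, indicator_of_mem hx]
    · have : η k x = 0 := image_eq_zero_of_notMem_tsupport fun h => hx (hηD k h)
      rw [this, zero_mul, zero_mul]
  -- passage to the limit
  have hgr : ContinuousOn (gradient v) D :=
    continuousOn_gradient_iff.2 (hv.continuousOn_fderiv_of_isOpen hD (by norm_num))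
  have hlimL : Tendsto (fun k => ∫ x, fderiv ℝ (η k) x (gradient v x) ∂ν) atTop
      (𝓝 (∫ x, {x | φ x ≠ 0}.indicator (fun x => fderiv ℝ φ x (gradient v x)) x ∂ν)) := by
    refine tendsto_integral_of_dominated_convergence
      (fun x => (C₁ * {x | φ x ≠ 0}.indicator (fun x => ‖fderiv ℝ φ x‖) x + C₂ * ‖φ x‖) *
        D.indicator (fun x => ‖gradient v x‖) x) (fun k => ?_)
      (((hdφ.const_mul C₁).add (hφ2.norm.const_mul C₂)).integrable_mul hv1) (fun k => ?_) ?_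
    · have h0 : (fun x => fderiv ℝ (η k) x (gradient v x)) =
          fun x => fderiv ℝ (η k) x (D.indicator (gradient v) x) := by
        ext x
        by_cases hx : x ∈ D
        · rw [indicator_of_mem hx]
        · have : fderiv ℝ (η k) x = 0 := hdη0 k x (by by_contra h; exact hx (hφD x h))
          simp [this]
      rw [h0]
      have h1 : AEStronglyMeasurable (D.indicator (gradient v)) ν :=
        (aestronglyMeasurable_indicator_iff hD.measurableSet).2
          (hgr.aestronglyMeasurable hD.measurableSet)
      have h2 : Continuous (gradient (η k)) := continuousOn_univ.1
        (continuousOn_gradient_iff.2 ((hηd k).continuous_fderiv one_ne_zero).continuousOn)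
      simp only [fderiv_apply_eq_inner_gradient]
      exact h2.aestronglyMeasurable.inner h1
    · refine Eventually.of_forall fun x => ?_
      by_cases hx : φ x = 0
      · rw [hdη0 k x hx, indicator_of_notMem (by simpa using hx)]
        simp [hx]
      · rw [indicator_of_mem (show x ∈ {x | φ x ≠ 0} from hx), indicator_of_mem (hφD x hx)]
        exact ((fderiv ℝ (η k) x).le_opNorm _).trans
          (mul_le_mul_of_nonneg_right (hdηle k x hx) (norm_nonneg _))
    · refine Eventually.of_forall fun x => ?_
      by_cases hx : φ x = 0
      · rw [indicator_of_notMem (by simpa using hx)]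
        simp only [hdη0 _ x hx]
        simp
      · rw [indicator_of_mem (show x ∈ {x | φ x ≠ 0} from hx)]
        refine tendsto_const_nhds.congr' ?_
        filter_upwards [hev x hx] with k hk
        rw [hk.fderiv_eq]
  have hlimR : Tendsto (fun k => ∫ x, η k x *
        β x ∂ν) atTop
      (𝓝 (∫ x, φ x * β x ∂ν)) := by
    refine tendsto_integral_of_dominated_convergence
      (fun x => ‖φ x‖ * ‖β x‖) (fun k => ?_)
      (hφ2.norm.integrable_mul hb.norm) (fun k => ?_) ?_
    · exact (hηd k).continuous.aestronglyMeasurable.mul hb.1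
    · refine Eventually.of_forall fun x => ?_
      rw [norm_mul]
      exact mul_le_mul_of_nonneg_right (hηle k x) (norm_nonneg _)
    · refine Eventually.of_forall fun x => Tendsto.mul_const _ ?_
      by_cases hx : φ x = 0
      · have : ∀ k, η k x = 0 := fun k => abs_nonpos_iff.1 (by simpa [hx] using hηle k x)
        simp only [this, hx]
        exact tendsto_const_nhds
      · refine tendsto_const_nhds.congr' ?_
        filter_upwards [hev x hx] with k hk
        exact hk.eq_of_nhds.symm
  exact tendsto_nhds_unique ((hlimL.const_mul s).congr hstep) hlimR

end BoundaryIntegrationByParts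

/-! ### The Mehler kernel and Gaussian scaling -/

section Mehler

/-- The variance `1 - e^{-2τ}` of the Gaussian measure `M(·, -τ) dγ`. -/
noncomputable def mehlerVar (τ : ℝ) : ℝ := 1 - Real.exp (-2 * τ)

theorem mehlerVar_lt_one (τ : ℝ) : mehlerVar τ < 1 := by
  have := Real.exp_pos (-2 * τ)
  unfold mehlerVar; linarith

theorem mehlerVar_strictMono : StrictMono mehlerVar := fun a b h => by
  have := Real.exp_lt_exp.2 (show -2 * b < -2 * a by linarith)
  unfold mehlerVar; linarith

theorem mehlerVar_pos {τ : ℝ} (hτ : 0 < τ) : 0 < mehlerVar τ := by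
  have h := mehlerVar_strictMono hτ
  simpa [mehlerVar] using h

theorem hasDerivAt_mehlerVar (τ : ℝ) : HasDerivAt mehlerVar (2 * (1 - mehlerVar τ)) τ := by
  have h := (((hasDerivAt_id τ).const_mul (-2)).exp).const_sub 1
  refine h.congr_deriv ?_
  simp [mehlerVar]; ring

theorem continuous_mehlerVar : Continuous mehlerVar := by
  unfold mehlerVar; fun_prop

theorem hasDerivAt_sqrt_mehlerVar {τ : ℝ} (hτ : 0 < τ) :
    HasDerivAt (fun τ => √(mehlerVar τ)) ((1 - mehlerVar τ) / √(mehlerVar τ)) τ := by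
  refine ((hasDerivAt_mehlerVar τ).sqrt (mehlerVar_pos hτ).ne').congr_deriv ?_
  have := Real.sqrt_pos.2 (mehlerVar_pos hτ)
  field_simp

theorem sqrt_mehlerVar_pos {τ : ℝ} (hτ : 0 < τ) : 0 < √(mehlerVar τ) :=
  Real.sqrt_pos.2 (mehlerVar_pos hτ)

variable {n : ℕ}

local notation "𝔼" => EuclideanSpace ℝ (Fin n)

theorem map_smul_gaussianWeight {K r : ℝ} (hr : 0 < r) :
    (gaussianWeight n K 1).map (fun x => r • x) = gaussianWeight n (K / r ^ n) (r ^ 2) := by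
  have hme : MeasurableEmbedding (fun x : 𝔼 => r • x) := measurableEmbedding_const_smul₀ hr.ne'
  refine Measure.ext_of_lintegral _ fun F hF => ?_
  rw [hme.lintegral_map, gaussianWeight, gaussianWeight,
    lintegral_withDensity_eq_lintegral_mul _ (by fun_prop) (g := fun x => F (r • x))
      (hF.comp hme.measurable),
    lintegral_withDensity_eq_lintegral_mul _ (by fun_prop) hF]
  have hm := Measure.map_addHaar_smul (volume : Measure 𝔼) hr.ne'
  have h1 : ∀ x : 𝔼, ((fun x : 𝔼 => ENNReal.ofReal (K * Real.exp (-‖x‖ ^ 2 / (2 * 1)))) *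
      fun x => F (r • x)) x =
        ENNReal.ofReal (K * Real.exp (-‖r • x‖ ^ 2 / (2 * r ^ 2))) * F (r • x) := by
    intro x
    simp only [Pi.mul_apply]
    congr 4
    rw [norm_smul, Real.norm_of_nonneg hr.le]
    field_simp
  rw [lintegral_congr h1, ← hme.lintegral_map
    (f := fun x => ENNReal.ofReal (K * Real.exp (-‖x‖ ^ 2 / (2 * r ^ 2))) * F x), hm,
    lintegral_smul_measure, smul_eq_mul, ← lintegral_const_mul _ (by fun_prop)]
  refine lintegral_congr fun x => ?_
  simp only [Pi.mul_apply]
  rw [← mul_assoc, ← ENNReal.ofReal_mul (abs_nonneg _), finrank_euclideanSpace_fin,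
    abs_of_pos (by positivity)]
  congr 2
  field_simp

theorem gaussianSpaceMeasure_eq :
    gaussianSpaceMeasure n = gaussianWeight n (1 / (2 * Real.pi) ^ ((n : ℝ) / 2)) 1 := by
  simp only [gaussianSpaceMeasure, gaussianWeight, mul_one]

theorem gaussianSpaceMeasure_absolutelyContinuous : gaussianSpaceMeasure n ≪ volume :=
  withDensity_absolutelyContinuous _ _

theorem measurable_backwardMehlerKernel (t : ℝ) :
    Measurable fun x : 𝔼 => backwardMehlerKernel x t := by
  unfold backwardMehlerKernel; fun_prop

theorem exp_two_mul_neg (τ : ℝ) : 1 - Real.exp (2 * -τ) = mehlerVar τ := by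
  rw [mehlerVar]; ring_nf

theorem backwardMehlerKernel_pos {τ : ℝ} (hτ : 0 < τ) (x : 𝔼) :
    0 < backwardMehlerKernel x (-τ) := by
  unfold backwardMehlerKernel
  rw [exp_two_mul_neg]
  have := mehlerVar_pos hτ
  positivity

/-- The measure `M(·, -τ) dγ`. -/
noncomputable def mehlerMeasure (n : ℕ) (τ : ℝ) : Measure (EuclideanSpace ℝ (Fin n)) :=
  (gaussianSpaceMeasure n).withDensity fun x => ENNReal.ofReal (backwardMehlerKernel x (-τ))

/-- The normalising constant of the Gaussian measure `M(·, -τ) dγ`. -/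
noncomputable def mehlerConst (n : ℕ) (τ : ℝ) : ℝ :=
  1 / (2 * Real.pi) ^ ((n : ℝ) / 2) * (1 / mehlerVar τ ^ ((n : ℝ) / 2))

theorem mehlerConst_nonneg {τ : ℝ} (hτ : 0 < τ) : 0 ≤ mehlerConst n τ := by
  have := mehlerVar_pos hτ
  unfold mehlerConst; positivity

theorem mehlerMeasure_eq_gaussianWeight {τ : ℝ} (hτ : 0 < τ) :
    mehlerMeasure n τ = gaussianWeight n (mehlerConst n τ) (mehlerVar τ) := by
  rw [mehlerMeasure, gaussianSpaceMeasure, gaussianWeight, ← withDensity_mul _ (by fun_prop)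
    (measurable_backwardMehlerKernel _).ennreal_ofReal]
  congr 1
  ext x
  have hs := mehlerVar_pos hτ
  rw [Pi.mul_apply, ← ENNReal.ofReal_mul (by positivity), backwardMehlerKernel, exp_two_mul_neg,
    mehlerConst]
  congr 1
  have h1 : Real.exp (2 * -τ) = 1 - mehlerVar τ := by rw [← exp_two_mul_neg]; ring
  rw [h1]
  have h2 : Real.exp (-‖x‖ ^ 2 / (2 * mehlerVar τ)) = Real.exp (-‖x‖ ^ 2 / 2) *
      Real.exp (-(1 / 2) * ((1 - mehlerVar τ) * ‖x‖ ^ 2 / mehlerVar τ)) := by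
    rw [← Real.exp_add]
    congr 1
    field_simp
    ring
  rw [h2]
  ring

/-- `M(·, -τ) dγ` is the image of `dγ` under the dilation by `√(1 - e^{-2τ})`. -/
theorem map_smul_gaussianSpaceMeasure {τ : ℝ} (hτ : 0 < τ) :
    (gaussianSpaceMeasure n).map (fun x => √(mehlerVar τ) • x) = mehlerMeasure n τ := by
  have hs := mehlerVar_pos hτ
  rw [gaussianSpaceMeasure_eq, map_smul_gaussianWeight (Real.sqrt_pos.2 hs),
    mehlerMeasure_eq_gaussianWeight hτ, Real.sq_sqrt hs.le, mehlerConst]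
  congr 1
  rw [Real.sqrt_eq_rpow, ← Real.rpow_natCast, ← Real.rpow_mul hs.le]
  have : 1 / 2 * (n : ℝ) = n / 2 := by ring
  rw [this]
  ring

theorem measurableEmbedding_sqrt_mehlerVar_smul {τ : ℝ} (hτ : 0 < τ) :
    MeasurableEmbedding fun x : 𝔼 => √(mehlerVar τ) • x :=
  measurableEmbedding_const_smul₀ (sqrt_mehlerVar_pos hτ).ne'

theorem integral_mehlerMeasure {τ : ℝ} (hτ : 0 < τ) (f : 𝔼 → ℝ) :
    ∫ x, f x ∂(mehlerMeasure n τ) = ∫ z, f (√(mehlerVar τ) • z) ∂(gaussianSpaceMeasure n) := by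
  rw [← map_smul_gaussianSpaceMeasure hτ, (measurableEmbedding_sqrt_mehlerVar_smul hτ).integral_map]

theorem setIntegral_mul_backwardMehlerKernel {τ : ℝ} (hτ : 0 < τ) {Ω : Set 𝔼}
    (hΩ : MeasurableSet Ω) (f : 𝔼 → ℝ) :
    ∫ x in Ω, f x * backwardMehlerKernel x (-τ) ∂(gaussianSpaceMeasure n) =
      ∫ x in Ω, f x ∂(mehlerMeasure n τ) := by
  rw [mehlerMeasure, setIntegral_withDensity_eq_setIntegral_toReal_smul
    (measurable_backwardMehlerKernel _).ennreal_ofReal (by simp) _ hΩ]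
  refine integral_congr_ae (Eventually.of_forall fun x => ?_)
  beta_reduce
  rw [ENNReal.toReal_ofReal (backwardMehlerKernel_pos hτ x).le, smul_eq_mul, mul_comm]

/-- For `τ < T₀` the kernel `M(·, -τ)` decays fast enough to absorb a quadratic factor against the
weight `exp(-2A|x|²)`. -/
theorem backwardMehlerKernel_mul_le {A T τ : ℝ} (hA : 0 < A) (hτ : τ ∈ Ioo 0 (freqTime A T))
    (x : 𝔼) :
    backwardMehlerKernel x (-τ) * (1 + ‖x‖ ^ 2) ≤
      1 / mehlerVar τ ^ ((n : ℝ) / 2) * Real.exp (-2 * A * ‖x‖ ^ 2) := by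
  have hs := mehlerVar_pos hτ.1
  have hpi := Real.pi_gt_three
  have h1 : Real.exp (2 * τ) < 1 + 1 / (8 * (A + Real.pi)) := by
    rw [← Real.lt_log_iff_exp_lt (by positivity)]
    have h2 := hτ.2
    have h3 := min_le_left (Real.log (1 + 1 / (8 * (A + Real.pi)))) T
    unfold freqTime at h2
    linarith
  have hexp : Real.exp (-2 * τ) * Real.exp (2 * τ) = 1 := by
    rw [← Real.exp_add]; simp
  -- `e^{-2τ} / (1 - e^{-2τ}) = 1 / (e^{2τ} - 1) > 8 (A + π)`
  have h4 : 8 * (A + Real.pi) * mehlerVar τ ≤ 1 - mehlerVar τ := by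
    have h5 : 8 * (A + Real.pi) * (Real.exp (2 * τ) - 1) ≤ 1 := by
      have : Real.exp (2 * τ) - 1 ≤ 1 / (8 * (A + Real.pi)) := by linarith
      calc 8 * (A + Real.pi) * (Real.exp (2 * τ) - 1)
          ≤ 8 * (A + Real.pi) * (1 / (8 * (A + Real.pi))) := by gcongr
        _ = 1 := by field_simp
    have h6 := mul_le_mul_of_nonneg_left h5 (Real.exp_pos (-2 * τ)).le
    unfold mehlerVar
    nlinarith
  have h7 : (4 * A + 2) * ‖x‖ ^ 2 ≤ (1 - mehlerVar τ) * ‖x‖ ^ 2 / mehlerVar τ := by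
    rw [le_div_iff₀ hs]
    have h8 : (4 * A + 2) * mehlerVar τ ≤ 1 - mehlerVar τ := by nlinarith
    nlinarith [sq_nonneg ‖x‖]
  have he : Real.exp (2 * -τ) = 1 - mehlerVar τ := by rw [← exp_two_mul_neg]; ring
  rw [backwardMehlerKernel, he]
  have h9 : 1 - (1 - mehlerVar τ) = mehlerVar τ := by ring
  rw [h9, mul_assoc]
  refine mul_le_mul_of_nonneg_left ?_ (by positivity)
  calc Real.exp (-(1 / 2) * ((1 - mehlerVar τ) * ‖x‖ ^ 2 / mehlerVar τ)) * (1 + ‖x‖ ^ 2)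
      ≤ Real.exp (-(1 / 2) * ((4 * A + 2) * ‖x‖ ^ 2)) * Real.exp (‖x‖ ^ 2) := by
        refine mul_le_mul (Real.exp_le_exp.2 (by linarith)) ?_ (by positivity) (by positivity)
        have := Real.add_one_le_exp (‖x‖ ^ 2)
        linarith
    _ = Real.exp (-2 * A * ‖x‖ ^ 2) := by rw [← Real.exp_add]; congr 1; ring

theorem setLIntegral_mehlerMeasure_le {A T τ : ℝ} (hA : 0 < A) (hτ : τ ∈ Ioo 0 (freqTime A T))
    {Ω : Set 𝔼} (hΩ : MeasurableSet Ω) {F G : 𝔼 → ℝ≥0∞}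
    (hFG : ∀ x ∈ Ω, F x ≤ ENNReal.ofReal (1 + ‖x‖ ^ 2) * G x) :
    ∫⁻ x in Ω, F x ∂(mehlerMeasure n τ) ≤
      ENNReal.ofReal (1 / mehlerVar τ ^ ((n : ℝ) / 2)) *
        ∫⁻ x in Ω, G x ∂(weightedGaussianMeasure n A) := by
  have hs := mehlerVar_pos hτ.1
  rw [mehlerMeasure, weightedGaussianMeasure,
    setLIntegral_withDensity_eq_setLIntegral_mul_non_measurable _
      (measurable_backwardMehlerKernel _).ennreal_ofReal _ hΩ (by simp),
    setLIntegral_withDensity_eq_setLIntegral_mul_non_measurable _ (by fun_prop) _ hΩ (by simp),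
    ← lintegral_const_mul' _ _ ENNReal.ofReal_ne_top]
  refine setLIntegral_mono' hΩ fun x hx => ?_
  simp only [Pi.mul_apply]
  calc ENNReal.ofReal (backwardMehlerKernel x (-τ)) * F x
      ≤ ENNReal.ofReal (backwardMehlerKernel x (-τ)) * (ENNReal.ofReal (1 + ‖x‖ ^ 2) * G x) := by
        gcongr; exact hFG x hx
    _ = ENNReal.ofReal (backwardMehlerKernel x (-τ) * (1 + ‖x‖ ^ 2)) * G x := by
        rw [ENNReal.ofReal_mul (backwardMehlerKernel_pos hτ.1 x).le, mul_assoc]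
    _ ≤ ENNReal.ofReal (1 / mehlerVar τ ^ ((n : ℝ) / 2) * Real.exp (-2 * A * ‖x‖ ^ 2)) * G x := by
        exact mul_le_mul_left (ENNReal.ofReal_le_ofReal (backwardMehlerKernel_mul_le hA hτ x)) _
    _ = _ := by rw [ENNReal.ofReal_mul (by positivity), mul_assoc]

end Mehler

/-! ### The solution in self-similar variables -/

section SelfSimilar

variable {n : ℕ}

local notation "𝔼" => EuclideanSpace ℝ (Fin n)

variable {Ω : Set (EuclideanSpace ℝ (Fin n))} {T A : ℝ} {u : EuclideanSpace ℝ (Fin n) → ℝ → ℝ}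

/-- The function `f(·, τ)` on `Ω`, extended by zero and pulled back by the dilation
`z ↦ √(1 - e^{-2τ}) z`, which carries `dγ` to `M(·, -τ) dγ`. -/
noncomputable def rescaled (Ω : Set (EuclideanSpace ℝ (Fin n)))
    (f : EuclideanSpace ℝ (Fin n) → ℝ → ℝ) (τ : ℝ) (z : EuclideanSpace ℝ (Fin n)) : ℝ :=
  Ω.indicator (fun x => f x τ) (√(mehlerVar τ) • z)

/-- The solution as a function of backward time `τ = -t`. -/
def reversed (u : EuclideanSpace ℝ (Fin n) → ℝ → ℝ) (x : EuclideanSpace ℝ (Fin n)) (τ : ℝ) : ℝ :=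
  u x (-τ)

/-- `x · ∇u - s Δu` at time `-τ`, with `s = 1 - e^{-2τ}`: minus the Ornstein–Uhlenbeck operator that
is symmetric with respect to `M(·, -τ) dγ`, multiplied by `s`. -/
noncomputable def mehlerGenerator (u : EuclideanSpace ℝ (Fin n) → ℝ → ℝ)
    (x : EuclideanSpace ℝ (Fin n)) (τ : ℝ) : ℝ :=
  ⟪x, gradient (fun y => u y (-τ)) x⟫_ℝ - mehlerVar τ * (Δ (fun y => u y (-τ))) x

/-- The length of the gradient at time `-τ`. -/
noncomputable def gradNorm (u : EuclideanSpace ℝ (Fin n) → ℝ → ℝ)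
    (x : EuclideanSpace ℝ (Fin n)) (τ : ℝ) : ℝ :=
  ‖gradient (fun y => u y (-τ)) x‖

theorem sqrt_mehlerVar_smul_mem (hΩc : Convex ℝ Ω) (hΩ0 : (0 : 𝔼) ∈ Ω) {r r' : ℝ} (hr' : 0 < r')
    (hrr' : r' ≤ r) {z : 𝔼} (hz : √(mehlerVar r) • z ∈ Ω) : √(mehlerVar r') • z ∈ Ω := by
  have h1 := sqrt_mehlerVar_pos (hr'.trans_le hrr')
  have h2 := Real.sqrt_le_sqrt (mehlerVar_strictMono.monotone hrr')
  have h3 : √(mehlerVar r') • z = (√(mehlerVar r') / √(mehlerVar r)) • √(mehlerVar r) • z := by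
    rw [smul_smul, div_mul_cancel₀ _ h1.ne']
  rw [h3]
  exact hΩc.smul_mem_of_zero_mem hΩ0 hz ⟨by positivity, (div_le_one h1).2 h2⟩

theorem neg_lt_neg_of_mem_Ioo_freqTime (hT : 0 < T) {τ : ℝ} (hτ : τ ∈ Ioo 0 (freqTime A T)) :
    -T < -τ := by
  have h1 := hτ.2
  have h2 := min_le_right (Real.log (1 + 1 / (8 * (A + Real.pi)))) T
  unfold freqTime at h1
  linarith

/-! #### Bounds in `L²` -/

theorem exists_lintegral_derivatives_le (hΩo : IsOpen Ω) (hT : 0 < T) (hu : IsOUHeatSolution Ω T u)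
    (hW : ∀ a b : ℝ, -T < a → ∃ K : ℝ≥0, ∀ t ∈ Icc a b,
      sobolevNormSq Ω (weightedGaussianMeasure n A) (fun x => u x t) ≤ K) {a b : ℝ}
    (hb : b ∈ Ioo 0 (freqTime A T)) :
    ∃ K : ℝ≥0, ∀ τ ∈ Icc a b, ∫⁻ x in Ω, (‖u x (-τ)‖ₑ ^ 2 + ‖fderiv ℝ (fun y => u y (-τ)) x‖ₑ ^ 2 +
      ‖fderiv ℝ (fderiv ℝ (fun y => u y (-τ))) x‖ₑ ^ 2) ∂(weightedGaussianMeasure n A) ≤ K := by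
  have hbT := neg_lt_neg_of_mem_Ioo_freqTime hT hb
  obtain ⟨K, hK⟩ := hW (-b) (-a) hbT
  refine ⟨K, fun τ hτ => ?_⟩
  have hac : weightedGaussianMeasure n A ≪ volume :=
    (withDensity_absolutelyContinuous _ _).trans gaussianSpaceMeasure_absolutelyContinuous
  exact (lintegral_le_sobolevNormSq hΩo
    (hu.contDiffOn_space (-τ) (hbT.trans_le (neg_le_neg hτ.2))) hac).trans
    (hK (-τ) ⟨neg_le_neg hτ.2, neg_le_neg hτ.1⟩)

theorem memLp_rescaled_iff {f : 𝔼 → ℝ → ℝ} {τ : ℝ} (hτ : 0 < τ) :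
    MemLp (rescaled Ω f τ) 2 (gaussianSpaceMeasure n) ↔
      MemLp (Ω.indicator fun x => f x τ) 2 (mehlerMeasure n τ) := by
  rw [← map_smul_gaussianSpaceMeasure hτ,
    (measurableEmbedding_sqrt_mehlerVar_smul hτ).memLp_map_measure_iff]
  rfl

theorem integral_sq_eq_toReal {α : Type*} [MeasurableSpace α] {μ : Measure α} {f : α → ℝ}
    (hf : AEStronglyMeasurable f μ) : ∫ x, f x ^ 2 ∂μ = (∫⁻ x, ‖f x‖ₑ ^ 2 ∂μ).toReal := by
  rw [integral_eq_lintegral_of_nonneg_ae (Eventually.of_forall fun x => sq_nonneg _) (hf.pow 2)]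
  congr 1
  refine lintegral_congr fun x => ?_
  rw [← enorm_pow, Real.enorm_of_nonneg (sq_nonneg _)]

theorem enorm_sq_eq_ofReal {G : Type*} [SeminormedAddCommGroup G] (y : G) :
    ‖y‖ₑ ^ 2 = ENNReal.ofReal (‖y‖ ^ 2) := by
  rw [← ofReal_norm, ENNReal.ofReal_pow (norm_nonneg _)]

theorem memLp_two_of_lintegral_lt_top {α : Type*} [MeasurableSpace α] {μ : Measure α} {f : α → ℝ}
    (hf : AEStronglyMeasurable f μ) (h : ∫⁻ x, ‖f x‖ₑ ^ 2 ∂μ < ⊤) : MemLp f 2 μ := by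
  rw [memLp_two_iff_integrable_sq hf]
  refine ⟨hf.pow 2, ?_⟩
  rw [HasFiniteIntegral]
  refine lt_of_le_of_lt (le_of_eq (lintegral_congr fun x => ?_)) h
  rw [enorm_pow]

/-- A quantity controlled by `(1 + |x|) (|u| + |∇u| + |∇²u|)` is bounded in `L²(M(·, -τ) dγ)`,
locally uniformly in `τ`. -/
theorem exists_memLp_rescaled (hΩo : IsOpen Ω) (hT : 0 < T) (hA : 0 < A)
    (hu : IsOUHeatSolution Ω T u)
    (hW : ∀ a b : ℝ, -T < a → ∃ K : ℝ≥0, ∀ t ∈ Icc a b,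
      sobolevNormSq Ω (weightedGaussianMeasure n A) (fun x => u x t) ≤ K)
    {f : 𝔼 → ℝ → ℝ} {c : ℝ} (hc : 0 ≤ c)
    (hfc : ∀ τ ∈ Ioo 0 (freqTime A T), ContinuousOn (fun x => f x τ) Ω)
    (hf : ∀ τ ∈ Ioo 0 (freqTime A T), ∀ x ∈ Ω, f x τ ^ 2 ≤ c * (1 + ‖x‖ ^ 2) *
      (u x (-τ) ^ 2 + ‖fderiv ℝ (fun y => u y (-τ)) x‖ ^ 2 +
        ‖fderiv ℝ (fderiv ℝ (fun y => u y (-τ))) x‖ ^ 2)) {a b : ℝ}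
    (ha : a ∈ Ioo 0 (freqTime A T)) (hb : b ∈ Ioo 0 (freqTime A T)) :
    ∃ C : ℝ≥0, ∀ τ ∈ Icc a b, MemLp (rescaled Ω f τ) 2 (gaussianSpaceMeasure n) ∧
      ∫⁻ z, ‖rescaled Ω f τ z‖ₑ ^ 2 ∂(gaussianSpaceMeasure n) ≤ C := by
  obtain ⟨K, hK⟩ := exists_lintegral_derivatives_le (a := a) hΩo hT hu hW hb
  refine ⟨(1 / mehlerVar a ^ ((n : ℝ) / 2)).toNNReal * (c.toNNReal * K), fun τ hτ => ?_⟩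
  have hτI : τ ∈ Ioo 0 (freqTime A T) := ⟨ha.1.trans_le hτ.1, hτ.2.trans_lt hb.2⟩
  have hmeas : AEStronglyMeasurable (Ω.indicator fun x => f x τ) (mehlerMeasure n τ) :=
    (aestronglyMeasurable_indicator_iff hΩo.measurableSet).2
      ((hfc τ hτI).aestronglyMeasurable hΩo.measurableSet)
  have hbound : ∫⁻ z, ‖rescaled Ω f τ z‖ₑ ^ 2 ∂(gaussianSpaceMeasure n) ≤
      (((1 / mehlerVar a ^ ((n : ℝ) / 2)).toNNReal * (c.toNNReal * K) : ℝ≥0) : ℝ≥0∞) := by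
    have h1 : ∫⁻ z, ‖rescaled Ω f τ z‖ₑ ^ 2 ∂(gaussianSpaceMeasure n) =
        ∫⁻ x, ‖Ω.indicator (fun x => f x τ) x‖ₑ ^ 2 ∂(mehlerMeasure n τ) := by
      rw [← map_smul_gaussianSpaceMeasure hτI.1,
        (measurableEmbedding_sqrt_mehlerVar_smul hτI.1).lintegral_map]
      rfl
    have h2 : ∫⁻ x, ‖Ω.indicator (fun x => f x τ) x‖ₑ ^ 2 ∂(mehlerMeasure n τ) =
        ∫⁻ x in Ω, ‖f x τ‖ₑ ^ 2 ∂(mehlerMeasure n τ) := by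
      rw [← lintegral_indicator hΩo.measurableSet]
      refine lintegral_congr fun x => ?_
      by_cases hx : x ∈ Ω
      · simp [hx]
      · simp [hx]
    rw [h1, h2]
    have h3 := setLIntegral_mehlerMeasure_le (n := n) hA hτI hΩo.measurableSet
      (F := fun x => ‖f x τ‖ₑ ^ 2) (G := fun x => ENNReal.ofReal c *
        (‖u x (-τ)‖ₑ ^ 2 + ‖fderiv ℝ (fun y => u y (-τ)) x‖ₑ ^ 2 +
          ‖fderiv ℝ (fderiv ℝ (fun y => u y (-τ))) x‖ₑ ^ 2)) (fun x hx => by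
        have h4 : ∀ y : ℝ, ‖y‖ₑ ^ 2 = ENNReal.ofReal (y ^ 2) := fun y => by
          rw [← enorm_pow, Real.enorm_of_nonneg (sq_nonneg _)]
        have h5 : ‖fderiv ℝ (fun y => u y (-τ)) x‖ₑ ^ 2 =
            ENNReal.ofReal (‖fderiv ℝ (fun y => u y (-τ)) x‖ ^ 2) := enorm_sq_eq_ofReal _
        have h6 : ‖fderiv ℝ (fderiv ℝ (fun y => u y (-τ))) x‖ₑ ^ 2 =
            ENNReal.ofReal (‖fderiv ℝ (fderiv ℝ (fun y => u y (-τ))) x‖ ^ 2) :=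
          enorm_sq_eq_ofReal _
        rw [h4, h4, h5, h6, ← ENNReal.ofReal_add (by positivity) (by positivity),
          ← ENNReal.ofReal_add (by positivity) (by positivity), ← ENNReal.ofReal_mul hc,
          ← ENNReal.ofReal_mul (by positivity)]
        refine ENNReal.ofReal_le_ofReal ((hf τ hτI x hx).trans (le_of_eq ?_))
        ring)
    refine h3.trans ?_
    rw [lintegral_const_mul' _ _ ENNReal.ofReal_ne_top, ENNReal.coe_mul, ENNReal.coe_mul]
    refine mul_le_mul' (ENNReal.ofReal_le_ofReal ?_) (mul_le_mul' le_rfl (hK τ hτ))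
    have := mehlerVar_pos ha.1
    gcongr
    exact mehlerVar_strictMono.monotone hτ.1
  refine ⟨(memLp_rescaled_iff hτI.1).2 ?_, hbound⟩
  rw [← memLp_rescaled_iff hτI.1]
  refine memLp_two_of_lintegral_lt_top ?_ (hbound.trans_lt ENNReal.coe_lt_top)
  rw [← map_smul_gaussianSpaceMeasure hτI.1,
    (measurableEmbedding_sqrt_mehlerVar_smul hτI.1).aestronglyMeasurable_map_iff] at hmeas
  exact hmeas

theorem continuousOn_mehlerGenerator (hΩo : IsOpen Ω) (hu : IsOUHeatSolution Ω T u) {τ : ℝ}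
    (hτ : -T < -τ) : ContinuousOn (fun x => mehlerGenerator u x τ) Ω := by
  have hv := hu.contDiffOn_space (-τ) hτ
  exact (continuousOn_id.inner (continuousOn_gradient_iff.2
    (hv.continuousOn_fderiv_of_isOpen hΩo (by norm_num)))).sub
    ((continuousOn_laplacian hΩo hv).const_smul (mehlerVar τ))

theorem exists_memLp_reversed (hΩo : IsOpen Ω) (hT : 0 < T) (hA : 0 < A)
    (hu : IsOUHeatSolution Ω T u)
    (hW : ∀ a b : ℝ, -T < a → ∃ K : ℝ≥0, ∀ t ∈ Icc a b,
      sobolevNormSq Ω (weightedGaussianMeasure n A) (fun x => u x t) ≤ K) {a b : ℝ}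
    (ha : a ∈ Ioo 0 (freqTime A T)) (hb : b ∈ Ioo 0 (freqTime A T)) :
    ∃ C : ℝ≥0, ∀ τ ∈ Icc a b, MemLp (rescaled Ω (reversed u) τ) 2 (gaussianSpaceMeasure n) ∧
      ∫⁻ z, ‖rescaled Ω (reversed u) τ z‖ₑ ^ 2 ∂(gaussianSpaceMeasure n) ≤ C := by
  refine exists_memLp_rescaled hΩo hT hA hu hW zero_le_one (fun τ hτ => ?_)
    (fun τ hτ x _ => ?_) ha hb
  · exact (hu.contDiffOn_space (-τ) (neg_lt_neg_of_mem_Ioo_freqTime hT hτ)).continuousOn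
  · unfold reversed
    nlinarith [sq_nonneg (u x (-τ)), sq_nonneg ‖fderiv ℝ (fun y => u y (-τ)) x‖, sq_nonneg ‖x‖,
      sq_nonneg ‖fderiv ℝ (fderiv ℝ (fun y => u y (-τ))) x‖,
      mul_nonneg (sq_nonneg ‖x‖) (sq_nonneg (u x (-τ))),
      mul_nonneg (sq_nonneg ‖x‖) (sq_nonneg ‖fderiv ℝ (fun y => u y (-τ)) x‖),
      mul_nonneg (sq_nonneg ‖x‖) (sq_nonneg ‖fderiv ℝ (fderiv ℝ (fun y => u y (-τ))) x‖)]

theorem exists_memLp_gradNorm (hΩo : IsOpen Ω) (hT : 0 < T) (hA : 0 < A)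
    (hu : IsOUHeatSolution Ω T u)
    (hW : ∀ a b : ℝ, -T < a → ∃ K : ℝ≥0, ∀ t ∈ Icc a b,
      sobolevNormSq Ω (weightedGaussianMeasure n A) (fun x => u x t) ≤ K) {a b : ℝ}
    (ha : a ∈ Ioo 0 (freqTime A T)) (hb : b ∈ Ioo 0 (freqTime A T)) :
    ∃ C : ℝ≥0, ∀ τ ∈ Icc a b, MemLp (rescaled Ω (gradNorm u) τ) 2 (gaussianSpaceMeasure n) ∧
      ∫⁻ z, ‖rescaled Ω (gradNorm u) τ z‖ₑ ^ 2 ∂(gaussianSpaceMeasure n) ≤ C := by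
  refine exists_memLp_rescaled hΩo hT hA hu hW zero_le_one (fun τ hτ => ?_)
    (fun τ hτ x _ => ?_) ha hb
  · exact (continuousOn_gradient_iff.2 ((hu.contDiffOn_space (-τ)
      (neg_lt_neg_of_mem_Ioo_freqTime hT hτ)).continuousOn_fderiv_of_isOpen hΩo (by norm_num))).norm
  · unfold gradNorm
    rw [norm_gradient_eq]
    nlinarith [sq_nonneg (u x (-τ)), sq_nonneg ‖fderiv ℝ (fun y => u y (-τ)) x‖, sq_nonneg ‖x‖,
      sq_nonneg ‖fderiv ℝ (fderiv ℝ (fun y => u y (-τ))) x‖,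
      mul_nonneg (sq_nonneg ‖x‖) (sq_nonneg (u x (-τ))),
      mul_nonneg (sq_nonneg ‖x‖) (sq_nonneg ‖fderiv ℝ (fun y => u y (-τ)) x‖),
      mul_nonneg (sq_nonneg ‖x‖) (sq_nonneg ‖fderiv ℝ (fderiv ℝ (fun y => u y (-τ))) x‖)]

theorem exists_memLp_mehlerGenerator (hΩo : IsOpen Ω) (hT : 0 < T) (hA : 0 < A)
    (hu : IsOUHeatSolution Ω T u)
    (hW : ∀ a b : ℝ, -T < a → ∃ K : ℝ≥0, ∀ t ∈ Icc a b,
      sobolevNormSq Ω (weightedGaussianMeasure n A) (fun x => u x t) ≤ K) {a b : ℝ}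
    (ha : a ∈ Ioo 0 (freqTime A T)) (hb : b ∈ Ioo 0 (freqTime A T)) :
    ∃ C : ℝ≥0, ∀ τ ∈ Icc a b, MemLp (rescaled Ω (mehlerGenerator u) τ) 2 (gaussianSpaceMeasure n) ∧
      ∫⁻ z, ‖rescaled Ω (mehlerGenerator u) τ z‖ₑ ^ 2 ∂(gaussianSpaceMeasure n) ≤ C := by
  refine exists_memLp_rescaled hΩo hT hA hu hW (c := 2 + 2 * (n : ℝ) ^ 2) (by positivity)
    (fun τ hτ => continuousOn_mehlerGenerator hΩo hu (neg_lt_neg_of_mem_Ioo_freqTime hT hτ))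
    (fun τ hτ x _ => ?_) ha hb
  unfold mehlerGenerator
  set p := ⟪x, gradient (fun y => u y (-τ)) x⟫_ℝ with hp
  set l := (Δ (fun y => u y (-τ))) x with hl
  set d := ‖fderiv ℝ (fun y => u y (-τ)) x‖ with hd
  set q := ‖fderiv ℝ (fderiv ℝ (fun y => u y (-τ))) x‖ with hq
  have hs0 := (mehlerVar_pos hτ.1).le
  have hs1 := (mehlerVar_lt_one τ).le
  have h1 : p ^ 2 ≤ ‖x‖ ^ 2 * d ^ 2 := by
    have : |p| ≤ ‖x‖ * d := by
      rw [hd, ← norm_gradient_eq]; exact abs_real_inner_le_norm _ _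
    rw [← sq_abs, ← mul_pow]; gcongr
  have h2 : (mehlerVar τ * l) ^ 2 ≤ (n : ℝ) ^ 2 * q ^ 2 := by
    have h3 : |mehlerVar τ * l| ≤ n * q := by
      rw [abs_mul, abs_of_nonneg hs0]
      exact (mul_le_of_le_one_left (abs_nonneg _) hs1).trans abs_laplacian_le
    rw [← sq_abs, ← mul_pow]; gcongr
  have h4 : (p - mehlerVar τ * l) ^ 2 ≤ 2 * (‖x‖ ^ 2 * d ^ 2) + 2 * ((n : ℝ) ^ 2 * q ^ 2) := by
    nlinarith [sq_nonneg (p + mehlerVar τ * l)]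
  refine h4.trans ?_
  have e : (2 + 2 * (n : ℝ) ^ 2) * (1 + ‖x‖ ^ 2) * (u x (-τ) ^ 2 + d ^ 2 + q ^ 2) =
      2 * (‖x‖ ^ 2 * d ^ 2) + 2 * ((n : ℝ) ^ 2 * q ^ 2) +
      ((2 + 2 * (n : ℝ) ^ 2) * (1 + ‖x‖ ^ 2) * u x (-τ) ^ 2 + 2 * d ^ 2 +
        2 * (n : ℝ) ^ 2 * (1 + ‖x‖ ^ 2) * d ^ 2 + 2 * (1 + ‖x‖ ^ 2) * q ^ 2 +
        2 * (n : ℝ) ^ 2 * ‖x‖ ^ 2 * q ^ 2) := by ring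
  rw [e]
  exact le_add_of_nonneg_right (by positivity)

/-! #### The evolution along the self-similar curves -/

theorem hasDerivAt_reversed (hΩo : IsOpen Ω) (hu : IsOUHeatSolution Ω T u) {z : 𝔼} {τ : ℝ}
    (hτ0 : 0 < τ) (hτ : -T < -τ) (hz : √(mehlerVar τ) • z ∈ Ω) :
    HasDerivAt (fun r => reversed u (√(mehlerVar r) • z) r)
      ((mehlerVar τ)⁻¹ * mehlerGenerator u (√(mehlerVar τ) • z) τ) τ := by
  set x := √(mehlerVar τ) • z with hx
  have hs := mehlerVar_pos hτ0
  have hO : IsOpen (Ω ×ˢ Ioi (-T)) := hΩo.prod isOpen_Ioi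
  have hmem : (x, -τ) ∈ Ω ×ˢ Ioi (-T) := ⟨hz, hτ⟩
  have hnhds := hO.mem_nhds hmem
  have hstrict := hasStrictFDerivAt_uncurry_coprod (𝕜 := ℝ) (u := (x, -τ)) (f := u)
    (f₁ := fun y t => fderiv ℝ (fun y => u y t) y)
    (f₂ := fun y t => (ContinuousLinearMap.toSpanSingleton ℝ (deriv (u y) t)))
    (by
      filter_upwards [hnhds] with p hp
      exact (((hu.contDiffOn_space p.2 hp.2).differentiableOn (by norm_num)).differentiableAt
        (hΩo.mem_nhds hp.1)).hasFDerivAt)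
    (by
      filter_upwards [hnhds] with p hp
      exact (hu.differentiableAt_time p.1 hp.1 p.2 hp.2).hasDerivAt.hasFDerivAt)
    (by
      have h1 := ((InnerProductSpace.toDual ℝ 𝔼).continuous.comp_continuousOn
        hu.continuousOn_gradient).continuousAt hnhds
      refine h1.congr (Eventually.of_forall fun p => ?_)
      exact toDual_gradient ..)
    (by
      have h1 := hu.continuousOn_deriv_time.continuousAt hnhds
      exact (ContinuousLinearMap.toSpanSingletonCLE (𝕜 := ℝ)
          (E := ℝ)).continuous.continuousAt.comp h1)
  have hcurve : HasDerivAt (fun r : ℝ => (√(mehlerVar r) • z, -r))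
      (((1 - mehlerVar τ) / √(mehlerVar τ)) • z, -1) τ :=
    ((hasDerivAt_sqrt_mehlerVar hτ0).smul_const z).prodMk (hasDerivAt_neg τ)
  have hcomp := HasFDerivAt.comp_hasDerivAt τ (f := fun r : ℝ => (√(mehlerVar r) • z, -r))
    hstrict.hasFDerivAt hcurve
  refine hcomp.congr_deriv ?_
  have hz' : ((1 - mehlerVar τ) / √(mehlerVar τ)) • z = ((1 - mehlerVar τ) / mehlerVar τ) • x := by
    rw [hx, smul_smul]
    congr 1
    have h1 := sqrt_mehlerVar_pos hτ0
    have h2 := Real.mul_self_sqrt hs.le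
    field_simp
    rw [sq, h2, mul_comm]
  have heq := hu.equation x hz (-τ) hτ
  rw [hz']
  simp only [Function.HasUncurry.uncurry, id, ContinuousLinearMap.coprod_apply, map_smul,
    ContinuousLinearMap.toSpanSingleton_apply, smul_eq_mul]
  rw [fderiv_apply_eq_inner_gradient, heq, ornsteinUhlenbeck, mehlerGenerator, real_inner_comm]
  field_simp
  ring

theorem continuousOn_indicator_reversed (hΩo : IsOpen Ω) (hu : IsOUHeatSolution Ω T u) :
    ContinuousOn (fun p : 𝔼 × ℝ => Ω.indicator (fun x => u x p.2) p.1) (univ ×ˢ Ioi (-T)) := by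
  rintro ⟨x, t⟩ ⟨-, ht⟩
  have hcover : (univ ×ˢ Ioi (-T) : Set (𝔼 × ℝ)) = closure Ω ×ˢ Ioi (-T) ∪ Ωᶜ ×ˢ Ioi (-T) := by
    rw [← union_prod]
    congr 1
    exact (eq_univ_of_forall fun y => (em (y ∈ Ω)).imp (fun h => subset_closure h) id).symm
  have h0 : ∀ p ∈ Ωᶜ ×ˢ Ioi (-T), Ω.indicator (fun x => u x p.2) p.1 = 0 := fun p hp =>
    indicator_of_notMem hp.1 _
  have h1 : ∀ p ∈ closure Ω ×ˢ Ioi (-T), Ω.indicator (fun x => u x p.2) p.1 = u p.1 p.2 := by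
    intro p hp
    by_cases hpΩ : p.1 ∈ Ω
    · exact indicator_of_mem hpΩ _
    · rw [indicator_of_notMem hpΩ]
      exact (hu.dirichlet p.1 (by rw [hΩo.frontier_eq]; exact ⟨hp.1, hpΩ⟩) p.2 hp.2).symm
  rw [hcover]
  refine ContinuousWithinAt.union ?_ ?_
  · by_cases hx : x ∈ closure Ω
    · exact (hu.continuousOn (x, t) ⟨hx, ht⟩).congr h1 (h1 _ ⟨hx, ht⟩)
    · refine continuousWithinAt_of_notMem_closure fun h => hx ?_
      rw [closure_prod_eq, closure_closure] at h
      exact h.1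
  · by_cases hx : x ∈ Ω
    · refine continuousWithinAt_of_notMem_closure fun h => ?_
      rw [closure_prod_eq, hΩo.isClosed_compl.closure_eq] at h
      exact h.1 hx
    · exact continuousWithinAt_const.congr h0 (h0 _ ⟨hx, ht⟩)

theorem continuousOn_rescaled_reversed (hΩo : IsOpen Ω) (hu : IsOUHeatSolution Ω T u) (z : 𝔼) :
    ContinuousOn (fun r => rescaled Ω (reversed u) r z) (Iio T) := by
  have h1 : ContinuousOn (fun r : ℝ => ((√(mehlerVar r) • z, -r) : 𝔼 × ℝ)) (Iio T) := by
    have := continuous_mehlerVar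
    exact Continuous.continuousOn (by fun_prop)
  exact (continuousOn_indicator_reversed hΩo hu).comp h1
    (fun r hr => ⟨mem_univ _, neg_lt_neg (mem_Iio.1 hr)⟩)

theorem continuous_indicator_reversed (hΩo : IsOpen Ω) (hu : IsOUHeatSolution Ω T u) {τ : ℝ}
    (hτ : -T < -τ) : Continuous (Ω.indicator fun x => reversed u x τ) := by
  have h1 : Continuous (fun x : 𝔼 => ((x, -τ) : 𝔼 × ℝ)) := by fun_prop
  exact continuousOn_univ.1 ((continuousOn_indicator_reversed hΩo hu).comp h1.continuousOn
    (fun x _ => ⟨mem_univ _, hτ⟩))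

/-- In backward self-similar variables the solution satisfies `∂_τ W = B / s`, with `B` the rescaled
`mehlerGenerator`. -/
theorem hasDerivAt_rescaled_reversed (hΩo : IsOpen Ω) (hu : IsOUHeatSolution Ω T u) {z : 𝔼} {τ : ℝ}
    (hτ0 : 0 < τ) (hτ : -T < -τ) (hz : √(mehlerVar τ) • z ∈ Ω) :
    HasDerivAt (fun r => rescaled Ω (reversed u) r z)
      ((mehlerVar τ)⁻¹ * rescaled Ω (mehlerGenerator u) τ z) τ := by
  have h1 := hasDerivAt_reversed hΩo hu hτ0 hτ hz
  rw [rescaled, indicator_of_mem hz]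
  refine h1.congr_of_eventuallyEq ?_
  have hc : ContinuousAt (fun r : ℝ => √(mehlerVar r) • z) τ := by
    have := continuous_mehlerVar
    exact Continuous.continuousAt (by fun_prop)
  filter_upwards [hc.eventually (hΩo.mem_nhds hz)] with r hr
  rw [rescaled, indicator_of_mem hr]

end SelfSimilar

/-! ### Lipschitz continuity and weak differentiability in time -/

section TimeRegularity

theorem sq_integral_le_mul_integral_sq {a b : ℝ} (hab : a < b) {f : ℝ → ℝ}
    (hf : MemLp f 2 (volume.restrict (Ioc a b))) :
    (∫ r in Ioc a b, f r) ^ 2 ≤ (b - a) * ∫ r in Ioc a b, f r ^ 2 := by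
  have hba : 0 < b - a := sub_pos.2 hab
  have hi : Integrable f (volume.restrict (Ioc a b)) := hf.integrable one_le_two
  set J := ∫ r in Ioc a b, f r with hJ
  set m := J / (b - a) with hm
  have h0 : 0 ≤ ∫ r in Ioc a b, (f r - m) ^ 2 := integral_nonneg fun r => sq_nonneg _
  have h1 : ∫ r in Ioc a b, (f r - m) ^ 2 =
      (∫ r in Ioc a b, f r ^ 2) - 2 * m * J + m ^ 2 * (b - a) := by
    have e : ∀ r, (f r - m) ^ 2 = f r ^ 2 - 2 * m * f r + m ^ 2 := fun r => by ring
    simp only [e]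
    have i1 : Integrable (fun r => f r ^ 2 - 2 * m * f r) (volume.restrict (Ioc a b)) :=
      hf.integrable_sq.sub (hi.const_mul _)
    rw [integral_add i1 (integrable_const _),
      integral_sub hf.integrable_sq (hi.const_mul _), integral_const_mul, setIntegral_const,
      Real.volume_real_Ioc_of_le hab.le, smul_eq_mul]
    ring
  rw [h1] at h0
  have h2 : m * (b - a) = J := div_mul_cancel₀ _ hba.ne'
  have h3 : 0 ≤ (b - a) * ((∫ r in Ioc a b, f r ^ 2) - 2 * m * J + m ^ 2 * (b - a)) :=
    mul_nonneg hba.le h0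
  nlinarith

/-- Cauchy–Schwarz for increments of a function that is differentiable off a countable set. Nothing
is claimed if the derivative is not square integrable. -/
theorem enorm_sub_sq_le_lintegral {a b : ℝ} (hab : a < b) {f f' : ℝ → ℝ} {S : Set ℝ}
    (hS : S.Countable) (hf : ContinuousOn f (Icc a b))
    (hd : ∀ r ∈ Ioo a b \ S, HasDerivAt f (f' r) r)
    (hf' : AEStronglyMeasurable f' (volume.restrict (Ioc a b))) :
    ‖f b - f a‖ₑ ^ 2 ≤ ENNReal.ofReal (b - a) * ∫⁻ r in Ioc a b, ‖f' r‖ₑ ^ 2 := by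
  have hba : 0 < b - a := sub_pos.2 hab
  by_cases htop : ∫⁻ r in Ioc a b, ‖f' r‖ₑ ^ 2 = ⊤
  · rw [htop, ENNReal.mul_top (by simpa using hab)]
    exact le_top
  have hL2 : MemLp f' 2 (volume.restrict (Ioc a b)) :=
    memLp_two_of_lintegral_lt_top hf' (lt_top_iff_ne_top.2 htop)
  have hint : IntervalIntegrable f' volume a b :=
    (intervalIntegrable_iff_integrableOn_Ioc_of_le hab.le).2 (hL2.integrable one_le_two)
  have hftc := integral_eq_of_hasDerivAt_off_countable_of_le f f' hab.le hS hf hd hint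
  rw [intervalIntegral.integral_of_le hab.le] at hftc
  have h1 := sq_integral_le_mul_integral_sq hab hL2
  rw [integral_sq_eq_toReal hf', hftc] at h1
  rw [enorm_sq_eq_ofReal, Real.norm_eq_abs, sq_abs, ← ENNReal.ofReal_toReal htop,
    ← ENNReal.ofReal_mul hba.le]
  exact ENNReal.ofReal_le_ofReal h1

variable {n : ℕ}

local notation "𝔼" => EuclideanSpace ℝ (Fin n)

variable {Ω : Set (EuclideanSpace ℝ (Fin n))} {T A : ℝ} {u : EuclideanSpace ℝ (Fin n) → ℝ → ℝ}

theorem continuousOn_mehlerGenerator_prod (hu : IsOUHeatSolution Ω T u) :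
    ContinuousOn (fun p : 𝔼 × ℝ => mehlerGenerator u p.1 p.2) (Ω ×ˢ Iio T) := by
  have hneg : ContinuousOn (fun p : 𝔼 × ℝ => (p.1, -p.2)) (Ω ×ˢ Iio T) :=
    Continuous.continuousOn (by fun_prop)
  have hmaps : MapsTo (fun p : 𝔼 × ℝ => (p.1, -p.2)) (Ω ×ˢ Iio T) (Ω ×ˢ Ioi (-T)) :=
    fun p hp => ⟨hp.1, neg_lt_neg (mem_Iio.1 hp.2)⟩
  have hg := hu.continuousOn_gradient.comp hneg hmaps
  have ht := hu.continuousOn_deriv_time.comp hneg hmaps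
  have hs : ContinuousOn (fun p : 𝔼 × ℝ => mehlerVar p.2) (Ω ×ˢ Iio T) :=
    (continuous_mehlerVar.comp continuous_snd).continuousOn
  have hin : ContinuousOn (fun p : 𝔼 × ℝ => ⟪p.1, gradient (fun y => u y (-p.2)) p.1⟫_ℝ)
      (Ω ×ˢ Iio T) := continuousOn_fst.inner hg
  refine (hin.sub (hs.mul (ht.add hin))).congr fun p hp => ?_
  have heq := hu.equation p.1 hp.1 (-p.2) (neg_lt_neg (mem_Iio.1 hp.2))
  change mehlerGenerator u p.1 p.2 = ⟪p.1, gradient (fun y => u y (-p.2)) p.1⟫_ℝ -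
    mehlerVar p.2 * (deriv (u p.1) (-p.2) + ⟪p.1, gradient (fun y => u y (-p.2)) p.1⟫_ℝ)
  rw [heq, ornsteinUhlenbeck, mehlerGenerator]
  ring

/-- The set of `(z, r)`, `0 < r < T`, for which the dilated point lies in `Ω`. -/
def selfSimilarDomain (Ω : Set (EuclideanSpace ℝ (Fin n))) (T : ℝ) :
    Set (EuclideanSpace ℝ (Fin n) × ℝ) :=
  {p | √(mehlerVar p.2) • p.1 ∈ Ω ∧ p.2 ∈ Ioo 0 T}

theorem isOpen_selfSimilarDomain (hΩo : IsOpen Ω) : IsOpen (selfSimilarDomain Ω T) := by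
  have hc : Continuous fun p : 𝔼 × ℝ => √(mehlerVar p.2) • p.1 := by
    have := continuous_mehlerVar
    fun_prop
  exact (hΩo.preimage hc).inter (isOpen_Ioo.preimage continuous_snd)

theorem measurable_indicator_of_continuousOn {α : Type*} [TopologicalSpace α] [MeasurableSpace α]
    [OpensMeasurableSpace α] {S : Set α} {f : α → ℝ} (hf : ContinuousOn f S)
    (hS : MeasurableSet S) : Measurable (S.indicator f) := by
  classical
  rw [← piecewise_eq_indicator]
  exact hf.measurable_piecewise continuousOn_const hS

theorem continuousOn_selfSimilarDomain (hu : IsOUHeatSolution Ω T u) :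
    ContinuousOn
      (fun p : 𝔼 × ℝ => (mehlerVar p.2)⁻¹ * mehlerGenerator u (√(mehlerVar p.2) • p.1) p.2)
      (selfSimilarDomain Ω T) := by
  have hm := continuous_mehlerVar
  have hc : Continuous fun p : 𝔼 × ℝ => ((√(mehlerVar p.2) • p.1, p.2) : 𝔼 × ℝ) := by
    fun_prop
  have hinv : ContinuousOn (fun p : 𝔼 × ℝ => (mehlerVar p.2)⁻¹) (selfSimilarDomain Ω T) :=
    ContinuousOn.inv₀ (hm.comp continuous_snd).continuousOn fun p hp => (mehlerVar_pos hp.2.1).ne'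
  have hmaps : MapsTo (fun p : 𝔼 × ℝ => ((√(mehlerVar p.2) • p.1, p.2) : 𝔼 × ℝ))
      (selfSimilarDomain Ω T) (Ω ×ˢ Iio T) := fun p hp => ⟨hp.1, mem_Iio.2 hp.2.2⟩
  have hgen : ContinuousOn (fun p : 𝔼 × ℝ => mehlerGenerator u (√(mehlerVar p.2) • p.1) p.2)
      (selfSimilarDomain Ω T) :=
    ContinuousOn.comp (g := fun p : 𝔼 × ℝ => mehlerGenerator u p.1 p.2)
      (f := fun p : 𝔼 × ℝ => ((√(mehlerVar p.2) • p.1, p.2) : 𝔼 × ℝ)) (t := Ω ×ˢ Iio T)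
      (continuousOn_mehlerGenerator_prod hu) hc.continuousOn hmaps
  exact hinv.mul hgen

/-- The time derivative `B / s` is jointly measurable. -/
theorem measurable_indicator_mehlerGenerator (hΩo : IsOpen Ω) (hu : IsOUHeatSolution Ω T u) :
    Measurable ((selfSimilarDomain Ω T).indicator fun p : 𝔼 × ℝ =>
      (mehlerVar p.2)⁻¹ * mehlerGenerator u (√(mehlerVar p.2) • p.1) p.2) :=
  measurable_indicator_of_continuousOn (continuousOn_selfSimilarDomain hu)
    (isOpen_selfSimilarDomain hΩo).measurableSet

theorem indicator_mehlerGenerator_eq {r : ℝ} (hr : r ∈ Ioo 0 T) (z : 𝔼) :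
    (selfSimilarDomain Ω T).indicator (fun p : 𝔼 × ℝ =>
      (mehlerVar p.2)⁻¹ * mehlerGenerator u (√(mehlerVar p.2) • p.1) p.2) (z, r) =
      (mehlerVar r)⁻¹ * rescaled Ω (mehlerGenerator u) r z := by
  by_cases hz : √(mehlerVar r) • z ∈ Ω
  · rw [indicator_of_mem (show (z, r) ∈ selfSimilarDomain Ω T from ⟨hz, hr⟩), rescaled,
      indicator_of_mem hz]
  · rw [indicator_of_notMem (fun h : (z, r) ∈ selfSimilarDomain Ω T => hz h.1), rescaled,
      indicator_of_notMem hz, mul_zero]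

/-- The exceptional set for the fundamental theorem of calculus is the time at which the dilated
point leaves `Ω`; there is at most one, because `Ω` is star-shaped about `0`. -/
theorem enorm_rescaled_sub_sq_le (hΩo : IsOpen Ω) (hΩc : Convex ℝ Ω) (hΩ0 : (0 : 𝔼) ∈ Ω)
    (hu : IsOUHeatSolution Ω T u) {a b : ℝ} (ha : 0 < a) (hab : a < b) (hb : b < T) (z : 𝔼) :
    ‖rescaled Ω (reversed u) b z - rescaled Ω (reversed u) a z‖ₑ ^ 2 ≤
      ENNReal.ofReal (b - a) * ∫⁻ r in Ioc a b, ‖(selfSimilarDomain Ω T).indicator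
        (fun p : 𝔼 × ℝ => (mehlerVar p.2)⁻¹ * mehlerGenerator u (√(mehlerVar p.2) • p.1) p.2)
        (z, r)‖ₑ ^ 2 := by
  set S : Set ℝ := {r | 0 < r ∧ √(mehlerVar r) • z ∉ Ω ∧
    ∀ r', 0 < r' → r' < r → √(mehlerVar r') • z ∈ Ω} with hS
  have hSc : S.Countable := by
    refine Set.Subsingleton.countable fun r hr r' hr' => ?_
    by_contra hne
    rcases lt_or_gt_of_ne hne with h | h
    · exact hr.2.1 (hr'.2.2 r hr.1 h)
    · exact hr'.2.1 (hr.2.2 r' hr'.1 h)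
  refine enorm_sub_sq_le_lintegral hab hSc (f := fun r => rescaled Ω (reversed u) r z)
    ((continuousOn_rescaled_reversed hΩo hu z).mono fun r hr => mem_Iio.2 (hr.2.trans_lt hb))
    (fun r hr => ?_) ?_
  · have hr0 : 0 < r := ha.trans hr.1.1
    have hrT : r < T := hr.1.2.trans hb
    rw [indicator_mehlerGenerator_eq ⟨hr0, hrT⟩]
    by_cases hz : √(mehlerVar r) • z ∈ Ω
    · exact hasDerivAt_rescaled_reversed hΩo hu hr0 (neg_lt_neg hrT) hz
    · have hnS : ¬ ∀ r', 0 < r' → r' < r → √(mehlerVar r') • z ∈ Ω := fun h => hr.2 ⟨hr0, hz, h⟩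
      push Not at hnS
      obtain ⟨r', hr'0, hr'r, hr'⟩ := hnS
      rw [rescaled, indicator_of_notMem hz, mul_zero]
      refine (hasDerivAt_const r (0 : ℝ)).congr_of_eventuallyEq ?_
      filter_upwards [lt_mem_nhds hr'r] with y hy
      rw [rescaled, indicator_of_notMem]
      exact fun h => hr' (sqrt_mehlerVar_smul_mem hΩc hΩ0 hr'0 hy.le h)
  · exact ((measurable_indicator_mehlerGenerator hΩo hu).comp
      measurable_prodMk_left).aestronglyMeasurable

/-- Locally in time, the solution in self-similar variables is Lipschitz with values in `L²(γ)`. -/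
theorem lintegral_rescaled_sub_sq_le (hΩo : IsOpen Ω) (hΩc : Convex ℝ Ω) (hΩ0 : (0 : 𝔼) ∈ Ω)
    (hu : IsOUHeatSolution Ω T u) {a₀ b₀ a b : ℝ} {C : ℝ≥0}
    (hC : ∀ τ ∈ Icc a₀ b₀,
      ∫⁻ z, ‖rescaled Ω (mehlerGenerator u) τ z‖ₑ ^ 2 ∂(gaussianSpaceMeasure n) ≤ C)
    (ha₀ : 0 < a₀) (hb₀ : b₀ < T) (ha : a ∈ Icc a₀ b₀) (hb : b ∈ Icc a₀ b₀) (hab : a < b) :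
    ∫⁻ z, ‖rescaled Ω (reversed u) b z - rescaled Ω (reversed u) a z‖ₑ ^ 2
      ∂(gaussianSpaceMeasure n) ≤
      ENNReal.ofReal ((b - a) ^ 2 * ((mehlerVar a₀)⁻¹ ^ 2 * C)) := by
  set γ := gaussianSpaceMeasure n with hγ
  have hsf : SFinite γ := by rw [hγ, gaussianSpaceMeasure]; infer_instance
  have hs0 := mehlerVar_pos ha₀
  set G := (selfSimilarDomain Ω T).indicator
    (fun p : 𝔼 × ℝ => (mehlerVar p.2)⁻¹ * mehlerGenerator u (√(mehlerVar p.2) • p.1) p.2) with hG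
  have hGm : Measurable G := measurable_indicator_mehlerGenerator hΩo hu
  have hGm2 : Measurable fun p => ‖G p‖ₑ ^ 2 := hGm.enorm.pow_const 2
  calc ∫⁻ z, ‖rescaled Ω (reversed u) b z - rescaled Ω (reversed u) a z‖ₑ ^ 2 ∂γ
      ≤ ∫⁻ z, (ENNReal.ofReal (b - a) * ∫⁻ r in Ioc a b, ‖G (z, r)‖ₑ ^ 2) ∂γ :=
        lintegral_mono fun z => enorm_rescaled_sub_sq_le hΩo hΩc hΩ0 hu (ha₀.trans_le ha.1) hab
          (hb.2.trans_lt hb₀) z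
    _ = ENNReal.ofReal (b - a) * ∫⁻ r in Ioc a b, ∫⁻ z, ‖G (z, r)‖ₑ ^ 2 ∂γ := by
        rw [lintegral_const_mul' _ _ ENNReal.ofReal_ne_top]
        congr 1
        exact lintegral_lintegral_swap (f := fun z r => ‖G (z, r)‖ₑ ^ 2) hGm2.aemeasurable
    _ ≤ ENNReal.ofReal (b - a) * ∫⁻ r in Ioc a b, ENNReal.ofReal ((mehlerVar a₀)⁻¹ ^ 2 * C) := by
        gcongr 1
        refine setLIntegral_mono' measurableSet_Ioc fun r hr => ?_
        have hr' : r ∈ Icc a₀ b₀ := ⟨ha.1.trans hr.1.le, hr.2.trans hb.2⟩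
        have hrT : r ∈ Ioo 0 T := ⟨ha₀.trans_le hr'.1, hr'.2.trans_lt hb₀⟩
        have h1 : ∀ z, ‖G (z, r)‖ₑ ^ 2 ≤ ENNReal.ofReal ((mehlerVar a₀)⁻¹ ^ 2) *
            ‖rescaled Ω (mehlerGenerator u) r z‖ₑ ^ 2 := fun z => by
          rw [hG, indicator_mehlerGenerator_eq hrT, enorm_mul, mul_pow]
          refine mul_le_mul' ?_ le_rfl
          rw [enorm_sq_eq_ofReal]
          refine ENNReal.ofReal_le_ofReal ?_
          have := mehlerVar_strictMono.monotone hr'.1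
          rw [Real.norm_of_nonneg (inv_nonneg.2 (hs0.le.trans this))]
          exact pow_le_pow_left₀ (inv_nonneg.2 (hs0.le.trans this)) (inv_anti₀ hs0 this) 2
        refine (lintegral_mono h1).trans ?_
        rw [lintegral_const_mul' _ _ ENNReal.ofReal_ne_top, ENNReal.ofReal_mul (by positivity)]
        gcongr
        simpa using hC r hr'
    _ = _ := by
        rw [setLIntegral_const, Real.volume_Ioc, mul_comm (ENNReal.ofReal (_ * _)), ← mul_assoc,
          ← ENNReal.ofReal_mul (sub_nonneg.2 hab.le), ← ENNReal.ofReal_mul (by positivity)]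
        congr 1; ring

/-- The solution as a curve in `L²(γ)`. -/
noncomputable def solutionCurve (Ω : Set (EuclideanSpace ℝ (Fin n)))
    (u : EuclideanSpace ℝ (Fin n) → ℝ → ℝ) (τ : ℝ) : Lp ℝ 2 (gaussianSpaceMeasure n) :=
  toL2 (gaussianSpaceMeasure n) (rescaled Ω (reversed u) τ)

/-- The rescaled `mehlerGenerator` as a curve in `L²(γ)`. -/
noncomputable def generatorCurve (Ω : Set (EuclideanSpace ℝ (Fin n)))
    (u : EuclideanSpace ℝ (Fin n) → ℝ → ℝ) (τ : ℝ) : Lp ℝ 2 (gaussianSpaceMeasure n) :=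
  toL2 (gaussianSpaceMeasure n) (rescaled Ω (mehlerGenerator u) τ)

theorem freqTime_le (hT : 0 < T) : freqTime A T ≤ T := by
  have h2 := min_le_right (Real.log (1 + 1 / (8 * (A + Real.pi)))) T
  unfold freqTime; linarith

theorem exists_Icc_mem_nhds {τ : ℝ} (hτ : τ ∈ Ioo 0 (freqTime A T)) :
    ∃ a ∈ Ioo 0 (freqTime A T), ∃ b ∈ Ioo 0 (freqTime A T), a < τ ∧ τ < b := by
  obtain ⟨a, ha0, haτ⟩ := exists_between hτ.1
  obtain ⟨b, hbτ, hb⟩ := exists_between hτ.2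
  exact ⟨a, ⟨ha0, haτ.trans hτ.2⟩, b, ⟨hτ.1.trans hbτ, hb⟩, haτ, hbτ⟩

theorem exists_integral_rescaled_sub_sq_le (hΩo : IsOpen Ω) (hΩc : Convex ℝ Ω) (hΩ0 : (0 : 𝔼) ∈ Ω)
    (hT : 0 < T) (hA : 0 < A) (hu : IsOUHeatSolution Ω T u)
    (hW : ∀ a b : ℝ, -T < a → ∃ K : ℝ≥0, ∀ t ∈ Icc a b,
      sobolevNormSq Ω (weightedGaussianMeasure n A) (fun x => u x t) ≤ K) {a₀ b₀ : ℝ}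
    (ha₀ : a₀ ∈ Ioo 0 (freqTime A T)) (hb₀ : b₀ ∈ Ioo 0 (freqTime A T)) :
    ∃ C : ℝ, 0 ≤ C ∧ ∀ a ∈ Icc a₀ b₀, ∀ b ∈ Icc a₀ b₀,
      ∫ z, (rescaled Ω (reversed u) b z - rescaled Ω (reversed u) a z) ^ 2
        ∂(gaussianSpaceMeasure n) ≤ (C * (b - a)) ^ 2 := by
  obtain ⟨C, hC⟩ := exists_memLp_mehlerGenerator hΩo hT hA hu hW ha₀ hb₀
  obtain ⟨D, hD⟩ := exists_memLp_reversed hΩo hT hA hu hW ha₀ hb₀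
  have hs0 := mehlerVar_pos ha₀.1
  refine ⟨√((mehlerVar a₀)⁻¹ ^ 2 * C), Real.sqrt_nonneg _, ?_⟩
  have key : ∀ a ∈ Icc a₀ b₀, ∀ b ∈ Icc a₀ b₀, a < b →
      ∫ z, (rescaled Ω (reversed u) b z - rescaled Ω (reversed u) a z) ^ 2
        ∂(gaussianSpaceMeasure n) ≤ (√((mehlerVar a₀)⁻¹ ^ 2 * C) * (b - a)) ^ 2 := by
    intro a ha b hb hab
    have h1 := lintegral_rescaled_sub_sq_le hΩo hΩc hΩ0 hu (fun τ hτ => (hC τ hτ).2) ha₀.1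
      (hb₀.2.trans_le (freqTime_le hT)) ha hb hab
    rw [integral_sq_eq_toReal
      (f := fun z => rescaled Ω (reversed u) b z - rescaled Ω (reversed u) a z)
      ((hD b hb).1.1.sub (hD a ha).1.1), mul_pow,
      Real.sq_sqrt (by positivity), mul_comm]
    exact ENNReal.toReal_le_of_le_ofReal (by positivity) h1
  intro a ha b hb
  rcases lt_trichotomy a b with h | h | h
  · exact key a ha b hb h
  · subst h; simp
  · have h1 := key b hb a ha h
    have e1 : ∀ z, (rescaled Ω (reversed u) b z - rescaled Ω (reversed u) a z) ^ 2 =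
      (rescaled Ω (reversed u) a z - rescaled Ω (reversed u) b z) ^ 2 := fun z => by ring
    simp only [e1]
    refine h1.trans (le_of_eq ?_)
    ring

theorem solutionCurve_lipschitz (hΩo : IsOpen Ω) (hΩc : Convex ℝ Ω) (hΩ0 : (0 : 𝔼) ∈ Ω)
    (hT : 0 < T) (hA : 0 < A) (hu : IsOUHeatSolution Ω T u)
    (hW : ∀ a b : ℝ, -T < a → ∃ K : ℝ≥0, ∀ t ∈ Icc a b,
      sobolevNormSq Ω (weightedGaussianMeasure n A) (fun x => u x t) ≤ K) {τ : ℝ}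
    (hτ : τ ∈ Ioo 0 (freqTime A T)) :
    ∃ C : ℝ, ∀ᶠ τ' in 𝓝 τ, ‖solutionCurve Ω u τ' - solutionCurve Ω u τ‖ ≤ C * |τ' - τ| := by
  obtain ⟨a, ha, b, hb, haτ, hτb⟩ := exists_Icc_mem_nhds hτ
  obtain ⟨C, hC0, hC⟩ := exists_integral_rescaled_sub_sq_le hΩo hΩc hΩ0 hT hA hu hW ha hb
  obtain ⟨D, hD⟩ := exists_memLp_reversed hΩo hT hA hu hW ha hb
  refine ⟨C, ?_⟩
  filter_upwards [Icc_mem_nhds haτ hτb] with τ' hτ'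
  have hτI : τ ∈ Icc a b := ⟨haτ.le, hτb.le⟩
  have h1 := hC τ hτI τ' hτ'
  have h2 := (hD τ' hτ').1
  have h3 := (hD τ hτI).1
  have h4 : MemLp (fun z => rescaled Ω (reversed u) τ' z - rescaled Ω (reversed u) τ z) 2
    (gaussianSpaceMeasure n) := h2.sub h3
  rw [solutionCurve, solutionCurve, toL2_sub h2 h3]
  refine le_of_sq_le_sq ?_ (by positivity)
  rw [norm_sq_toL2 h4, mul_pow, sq_abs, ← mul_pow]
  exact h1

/-- The difference quotients converge to `B / s` pointwise, also off the dilated domain, where they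
vanish eventually, and are bounded in `L²(γ)`; hence they converge weakly. -/
theorem tendsto_slope_solutionCurve (hΩo : IsOpen Ω) (hΩc : Convex ℝ Ω) (hΩ0 : (0 : 𝔼) ∈ Ω)
    (hT : 0 < T) (hA : 0 < A) (hu : IsOUHeatSolution Ω T u)
    (hW : ∀ a b : ℝ, -T < a → ∃ K : ℝ≥0, ∀ t ∈ Icc a b,
      sobolevNormSq Ω (weightedGaussianMeasure n A) (fun x => u x t) ≤ K) {τ : ℝ}
    (hτ : τ ∈ Ioo 0 (freqTime A T)) (x : Lp ℝ 2 (gaussianSpaceMeasure n)) :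
    Tendsto (fun τ' => (τ' - τ)⁻¹ * ⟪x, solutionCurve Ω u τ' - solutionCurve Ω u τ⟫_ℝ) (𝓝[>] τ)
      (𝓝 ((mehlerVar τ)⁻¹ * ⟪x, generatorCurve Ω u τ⟫_ℝ)) := by
  obtain ⟨a, ha, b, hb, haτ, hτb⟩ := exists_Icc_mem_nhds hτ
  obtain ⟨C, hC0, hC⟩ := exists_integral_rescaled_sub_sq_le hΩo hΩc hΩ0 hT hA hu hW ha hb
  obtain ⟨D, hD⟩ := exists_memLp_reversed hΩo hT hA hu hW ha hb
  obtain ⟨D', hD'⟩ := exists_memLp_mehlerGenerator hΩo hT hA hu hW ha hb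
  have hτI : τ ∈ Icc a b := ⟨haτ.le, hτb.le⟩
  have hWτ := (hD τ hτI).1
  have hBτ := (hD' τ hτI).1
  have hnear : ∀ᶠ τ' in 𝓝[>] τ, τ' ∈ Icc a b ∧ τ < τ' := by
    filter_upwards [nhdsWithin_le_nhds (Icc_mem_nhds haτ hτb), self_mem_nhdsWithin] with τ' h1 h2
    exact ⟨h1, h2⟩
  have hq : ∀ τ' ∈ Icc a b, MemLp (fun z => (τ' - τ)⁻¹ * (rescaled Ω (reversed u) τ' z -
      rescaled Ω (reversed u) τ z)) 2 (gaussianSpaceMeasure n) := fun τ' hτ' =>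
    ((hD τ' hτ').1.sub hWτ).const_mul _
  have hlim := tendsto_inner_toL2 (l := 𝓝[>] τ) (μ := gaussianSpaceMeasure n)
    (f := fun z => (mehlerVar τ)⁻¹ * rescaled Ω (mehlerGenerator u) τ z)
    (w := fun τ' z => (τ' - τ)⁻¹ * (rescaled Ω (reversed u) τ' z - rescaled Ω (reversed u) τ z))
    (hBτ.const_mul _) (hnear.mono fun τ' h => hq τ' h.1) (C := C ^ 2) ?_ ?_ x
  · rw [inner_toL2_right (hBτ.const_mul _)] at hlim
    rw [generatorCurve, inner_toL2_right hBτ, ← integral_const_mul]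
    have e1 : ∫ z, (mehlerVar τ)⁻¹ * (x z * rescaled Ω (mehlerGenerator u) τ z)
        ∂(gaussianSpaceMeasure n) =
        ∫ z, x z * ((mehlerVar τ)⁻¹ * rescaled Ω (mehlerGenerator u) τ z)
        ∂(gaussianSpaceMeasure n) := by
      congr 1; ext z; ring
    rw [e1]
    refine hlim.congr' ?_
    filter_upwards [hnear] with τ' h
    have h4 : MemLp (fun z => rescaled Ω (reversed u) τ' z - rescaled Ω (reversed u) τ z) 2
      (gaussianSpaceMeasure n) := (hD τ' h.1).1.sub hWτ
    rw [solutionCurve, solutionCurve, toL2_sub (hD τ' h.1).1 hWτ, inner_toL2_right h4,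
      inner_toL2_right (hq τ' h.1), ← integral_const_mul]
    congr 1; ext z; ring
  · filter_upwards [hnear] with τ' h
    have hpos : 0 < τ' - τ := sub_pos.2 h.2
    have h1 := hC τ hτI τ' h.1
    have e1 : ∀ z, ((τ' - τ)⁻¹ * (rescaled Ω (reversed u) τ' z - rescaled Ω (reversed u) τ z)) ^ 2 =
        ((τ' - τ) ^ 2)⁻¹ * (rescaled Ω (reversed u) τ' z - rescaled Ω (reversed u) τ z) ^ 2 :=
      fun z => by rw [mul_pow, inv_pow]
    simp only [e1]
    rw [integral_const_mul, inv_mul_le_iff₀ (by positivity)]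
    linarith
  · refine Eventually.of_forall fun z => ?_
    by_cases hz : √(mehlerVar τ) • z ∈ Ω
    · have hd := hasDerivAt_rescaled_reversed hΩo hu hτ.1
        (neg_lt_neg_of_mem_Ioo_freqTime hT hτ) hz
      have h1 := (hasDerivAt_iff_tendsto_slope.1 hd).mono_left
        (nhdsWithin_mono τ fun y (hy : τ < y) => (ne_of_gt hy : y ∈ ({τ}ᶜ : Set ℝ)))
      refine h1.congr fun τ' => ?_
      rw [slope_def_field, div_eq_inv_mul]
    -- a dilated point outside `Ω` stays outside when `τ` increases
    · have h0 : rescaled Ω (reversed u) τ z = 0 := indicator_of_notMem hz _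
      have h1 : rescaled Ω (mehlerGenerator u) τ z = 0 := indicator_of_notMem hz _
      rw [h1, mul_zero]
      refine tendsto_const_nhds.congr' ?_
      filter_upwards [hnear] with τ' h
      have h2 : rescaled Ω (reversed u) τ' z = 0 := indicator_of_notMem
        (fun h' => hz (sqrt_mehlerVar_smul_mem hΩc hΩ0 hτ.1 h.2.le h')) _
      rw [h0, h2, sub_zero, mul_zero]

theorem generatorCurve_bounded (hΩo : IsOpen Ω) (hT : 0 < T) (hA : 0 < A)
    (hu : IsOUHeatSolution Ω T u)
    (hW : ∀ a b : ℝ, -T < a → ∃ K : ℝ≥0, ∀ t ∈ Icc a b,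
      sobolevNormSq Ω (weightedGaussianMeasure n A) (fun x => u x t) ≤ K) {τ : ℝ}
    (hτ : τ ∈ Ioo 0 (freqTime A T)) :
    ∃ C : ℝ, ∀ᶠ τ' in 𝓝 τ, MemLp (rescaled Ω (mehlerGenerator u) τ') 2 (gaussianSpaceMeasure n) ∧
      ‖generatorCurve Ω u τ'‖ ^ 2 ≤ C := by
  obtain ⟨a, ha, b, hb, haτ, hτb⟩ := exists_Icc_mem_nhds hτ
  obtain ⟨D, hD⟩ := exists_memLp_mehlerGenerator hΩo hT hA hu hW ha hb
  refine ⟨D, ?_⟩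
  filter_upwards [Icc_mem_nhds haτ hτb] with τ' hτ'
  have h1 := hD τ' hτ'
  refine ⟨h1.1, ?_⟩
  rw [generatorCurve, norm_sq_toL2 h1.1, integral_sq_eq_toReal h1.1.1]
  exact ENNReal.toReal_le_of_le_ofReal D.coe_nonneg (by simpa using h1.2)

/-- Weak continuity; the points that the dilation maps to `∂Ω` are negligible since `Ω` is
convex. -/
theorem tendsto_inner_generatorCurve (hΩo : IsOpen Ω) (hΩc : Convex ℝ Ω)
    (hT : 0 < T) (hA : 0 < A) (hu : IsOUHeatSolution Ω T u)
    (hW : ∀ a b : ℝ, -T < a → ∃ K : ℝ≥0, ∀ t ∈ Icc a b,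
      sobolevNormSq Ω (weightedGaussianMeasure n A) (fun x => u x t) ≤ K) {τ : ℝ}
    (hτ : τ ∈ Ioo 0 (freqTime A T)) (x : Lp ℝ 2 (gaussianSpaceMeasure n)) :
    Tendsto (fun τ' => ⟪x, generatorCurve Ω u τ'⟫_ℝ) (𝓝 τ) (𝓝 ⟪x, generatorCurve Ω u τ⟫_ℝ) := by
  obtain ⟨C, hC⟩ := generatorCurve_bounded hΩo hT hA hu hW hτ
  refine tendsto_inner_toL2 (C := C) hC.self_of_nhds.1 (hC.mono fun τ' h => h.1)
    (hC.mono fun τ' h => ?_) ?_ x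
  · have := h.2
    rwa [generatorCurve, norm_sq_toL2 h.1] at this
  have hfr : ∀ᵐ z ∂(gaussianSpaceMeasure n), √(mehlerVar τ) • z ∉ frontier Ω := by
    have h1 : ∀ᵐ x ∂(mehlerMeasure n τ), x ∉ frontier Ω := by
      have h2 : mehlerMeasure n τ ≪ volume :=
        (withDensity_absolutelyContinuous _ _).trans gaussianSpaceMeasure_absolutelyContinuous
      exact h2.ae_le (measure_eq_zero_iff_ae_notMem.1 (hΩc.addHaar_frontier volume))
    rw [← map_smul_gaussianSpaceMeasure hτ.1] at h1
    exact ae_of_ae_map (measurableEmbedding_sqrt_mehlerVar_smul hτ.1).measurable.aemeasurable h1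
  have hm := continuous_mehlerVar
  filter_upwards [hfr] with z hz
  have hc : ContinuousAt (fun r : ℝ => √(mehlerVar r) • z) τ :=
    Continuous.continuousAt (by fun_prop)
  by_cases hzΩ : √(mehlerVar τ) • z ∈ Ω
  · have hτT : τ < T := hτ.2.trans_le (freqTime_le hT)
    have h1 := (continuousOn_mehlerGenerator_prod hu).continuousAt
      ((hΩo.prod isOpen_Iio).mem_nhds (show (√(mehlerVar τ) • z, τ) ∈ Ω ×ˢ Iio T from ⟨hzΩ, hτT⟩))
    have h2 : ContinuousAt (fun r : ℝ => mehlerGenerator u (√(mehlerVar r) • z) r) τ :=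
      ContinuousAt.comp (f := fun r : ℝ => ((√(mehlerVar r) • z, r) : 𝔼 × ℝ)) h1
        (hc.prodMk continuousAt_id)
    have h3 : rescaled Ω (mehlerGenerator u) τ z = mehlerGenerator u (√(mehlerVar τ) • z) τ :=
      indicator_of_mem hzΩ _
    rw [h3]
    refine h2.tendsto.congr' ?_
    filter_upwards [hc.eventually (hΩo.mem_nhds hzΩ)] with r hr
    rw [rescaled, indicator_of_mem hr]
  · have hcl : √(mehlerVar τ) • z ∈ (closure Ω)ᶜ := fun h => hz (by
      rw [hΩo.frontier_eq]; exact ⟨h, hzΩ⟩)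
    have h3 : rescaled Ω (mehlerGenerator u) τ z = 0 := indicator_of_notMem hzΩ _
    rw [h3]
    refine tendsto_const_nhds.congr' ?_
    filter_upwards [hc.eventually (isClosed_closure.isOpen_compl.mem_nhds hcl)] with r hr
    rw [rescaled, indicator_of_notMem fun h => hr (subset_closure h)]

end TimeRegularity

/-! ### The energy identity and the variational inequality -/

section Energy

variable {n : ℕ}

local notation "𝔼" => EuclideanSpace ℝ (Fin n)

variable {Ω : Set (EuclideanSpace ℝ (Fin n))} {T A : ℝ} {u : EuclideanSpace ℝ (Fin n) → ℝ → ℝ}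

theorem hasFDerivAt_indicator_dilate (hΩo : IsOpen Ω) {v : 𝔼 → ℝ} (hv : ContDiffOn ℝ 2 v Ω)
    {k : ℝ} {x : 𝔼} (hx : k • x ∈ Ω) :
    HasFDerivAt (fun y => Ω.indicator v (k • y)) (k • fderiv ℝ v (k • x)) x ∧
      ContDiffAt ℝ 1 (fun y => Ω.indicator v (k • y)) x := by
  have hev : (fun y => Ω.indicator v (k • y)) =ᶠ[𝓝 x] fun y => v (k • y) := by
    have hc : ContinuousAt (fun y : 𝔼 => k • y) x := by fun_prop
    filter_upwards [hc.eventually (hΩo.mem_nhds hx)] with y hy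
    exact indicator_of_mem hy _
  have hvx : ContDiffAt ℝ 2 v (k • x) := hv.contDiffAt (hΩo.mem_nhds hx)
  have h1 : HasFDerivAt (fun y : 𝔼 => k • y) (k • ContinuousLinearMap.id ℝ 𝔼) x :=
    (k • ContinuousLinearMap.id ℝ 𝔼).hasFDerivAt
  constructor
  · have h2 := HasFDerivAt.comp x (hvx.differentiableAt (by norm_num)).hasFDerivAt h1
    rw [ContinuousLinearMap.comp_smul, ContinuousLinearMap.comp_id] at h2
    exact h2.congr_of_eventuallyEq hev
  · have h3 : ContDiffAt ℝ 1 (fun y => v (k • y)) x :=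
      ContDiffAt.comp x (hvx.of_le (by norm_num)) (contDiff_id.const_smul k).contDiffAt
    exact h3.congr_of_eventuallyEq hev

theorem memLp_indicator_dilate_iff {f : 𝔼 → ℝ → ℝ} {τ τ' : ℝ} (hτ : 0 < τ) :
    MemLp (fun x => Ω.indicator (fun y => f y τ') ((√(mehlerVar τ') / √(mehlerVar τ)) • x)) 2
      (mehlerMeasure n τ) ↔ MemLp (rescaled Ω f τ') 2 (gaussianSpaceMeasure n) := by
  rw [← map_smul_gaussianSpaceMeasure hτ,
    (measurableEmbedding_sqrt_mehlerVar_smul hτ).memLp_map_measure_iff]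
  have h1 := (sqrt_mehlerVar_pos hτ).ne'
  refine iff_of_eq (congrArg (fun g => MemLp g 2 _) (funext fun z => ?_))
  simp only [Function.comp, rescaled, smul_smul, div_mul_cancel₀ _ h1]

theorem integral_indicator_dilate {f : 𝔼 → ℝ → ℝ} {τ τ' : ℝ} (hτ : 0 < τ) (g : 𝔼 → ℝ → ℝ) :
    ∫ x, g x (Ω.indicator (fun y => f y τ') ((√(mehlerVar τ') / √(mehlerVar τ)) • x))
      ∂(mehlerMeasure n τ) =
      ∫ z, g (√(mehlerVar τ) • z) (rescaled Ω f τ' z) ∂(gaussianSpaceMeasure n) := by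
  rw [integral_mehlerMeasure hτ]
  have h1 := (sqrt_mehlerVar_pos hτ).ne'
  simp only [rescaled, smul_smul, div_mul_cancel₀ _ h1]

theorem integral_fderiv_gradient_mehlerMeasure {τ : ℝ} (hτ : 0 < τ) {D : Set 𝔼} (hD : IsOpen D)
    {v φ : 𝔼 → ℝ} (hv : ContDiffOn ℝ 2 v D) (hφ : Continuous φ)
    (hφD : ∀ x, φ x ≠ 0 → x ∈ D) (hφ1 : ∀ x, φ x ≠ 0 → ContDiffAt ℝ 1 φ x)
    (hv1 : MemLp (D.indicator fun x => ‖gradient v x‖) 2 (mehlerMeasure n τ))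
    (hb : MemLp (D.indicator fun x => ⟪x, gradient v x⟫_ℝ - mehlerVar τ * (Δ v) x) 2
      (mehlerMeasure n τ))
    (hφ2 : MemLp φ 2 (mehlerMeasure n τ))
    (hdφ : MemLp ({x | φ x ≠ 0}.indicator fun x => ‖fderiv ℝ φ x‖) 2 (mehlerMeasure n τ)) :
    mehlerVar τ * ∫ x, {x | φ x ≠ 0}.indicator (fun x => fderiv ℝ φ x (gradient v x)) x
        ∂(mehlerMeasure n τ) =
      ∫ x, φ x * D.indicator (fun x => ⟪x, gradient v x⟫_ℝ - mehlerVar τ * (Δ v) x) x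
        ∂(mehlerMeasure n τ) := by
  rw [mehlerMeasure_eq_gaussianWeight hτ] at *
  exact integral_fderiv_gradient_of_continuous (mehlerConst_nonneg hτ) (mehlerVar_pos hτ) hD hv
    hφ hφD hφ1 hv1 hb hφ2 hdφ

theorem inner_generatorCurve_solutionCurve_eq_integral {τ τ' : ℝ} (hτ : 0 < τ)
    (hB : MemLp (rescaled Ω (mehlerGenerator u) τ) 2 (gaussianSpaceMeasure n))
    (hW : MemLp (rescaled Ω (reversed u) τ') 2 (gaussianSpaceMeasure n)) :
    ⟪generatorCurve Ω u τ, solutionCurve Ω u τ'⟫_ℝ =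
      ∫ x, Ω.indicator (fun y => reversed u y τ') ((√(mehlerVar τ') / √(mehlerVar τ)) • x) *
        Ω.indicator (fun y => mehlerGenerator u y τ) x ∂(mehlerMeasure n τ) := by
  rw [generatorCurve, solutionCurve, inner_toL2 hB hW,
    integral_indicator_dilate (Ω := Ω) (f := reversed u) (τ' := τ') hτ
      (g := fun x y => y * Ω.indicator (fun y => mehlerGenerator u y τ) x)]
  exact integral_congr_ae (Eventually.of_forall fun z => mul_comm _ _)

/-- The state at an earlier time (larger `τ'`), dilated to the scale of `τ`, is supported in `Ω` and
vanishes on its boundary; it is thus an admissible test function at time `τ`. -/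
theorem inner_generatorCurve_solutionCurve (hΩo : IsOpen Ω) (hΩc : Convex ℝ Ω)
    (hΩ0 : (0 : 𝔼) ∈ Ω) (hT : 0 < T) (hA : 0 < A) (hu : IsOUHeatSolution Ω T u)
    (hW : ∀ a b : ℝ, -T < a → ∃ K : ℝ≥0, ∀ t ∈ Icc a b,
      sobolevNormSq Ω (weightedGaussianMeasure n A) (fun x => u x t) ≤ K) {τ τ' : ℝ}
    (hτ : τ ∈ Ioo 0 (freqTime A T)) (hτ' : τ' ∈ Ioo 0 (freqTime A T)) (hττ' : τ ≤ τ') {φ : 𝔼 → ℝ}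
    (hφ : φ = fun x => Ω.indicator (fun y => reversed u y τ')
      ((√(mehlerVar τ') / √(mehlerVar τ)) • x)) :
    ⟪generatorCurve Ω u τ, solutionCurve Ω u τ'⟫_ℝ = mehlerVar τ *
      ∫ x, {x | φ x ≠ 0}.indicator (fun x => fderiv ℝ φ x (gradient (fun y => u y (-τ)) x)) x
        ∂(mehlerMeasure n τ) ∧
    MemLp ({x | φ x ≠ 0}.indicator fun x => ‖fderiv ℝ φ x‖) 2 (mehlerMeasure n τ) := by
  obtain ⟨C₁, hC₁⟩ := exists_memLp_reversed hΩo hT hA hu hW hτ' hτ'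
  obtain ⟨C₂, hC₂⟩ := exists_memLp_gradNorm hΩo hT hA hu hW hτ hτ
  obtain ⟨C₃, hC₃⟩ := exists_memLp_gradNorm hΩo hT hA hu hW hτ' hτ'
  obtain ⟨C₄, hC₄⟩ := exists_memLp_mehlerGenerator hΩo hT hA hu hW hτ hτ
  have hmW := (hC₁ τ' ⟨le_rfl, le_rfl⟩).1
  have hmG := (hC₂ τ ⟨le_rfl, le_rfl⟩).1
  have hmG' := (hC₃ τ' ⟨le_rfl, le_rfl⟩).1
  have hmB := (hC₄ τ ⟨le_rfl, le_rfl⟩).1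
  have hτT := neg_lt_neg_of_mem_Ioo_freqTime hT hτ
  have hτT' := neg_lt_neg_of_mem_Ioo_freqTime hT hτ'
  have hs := mehlerVar_pos hτ.1
  have hσ := sqrt_mehlerVar_pos hτ.1
  have hv := hu.contDiffOn_space (-τ) hτT
  have hv' := hu.contDiffOn_space (-τ') hτT'
  set k := √(mehlerVar τ') / √(mehlerVar τ) with hk
  have hk1 : 1 ≤ k := by
    rw [hk, one_le_div hσ]
    exact Real.sqrt_le_sqrt (mehlerVar_strictMono.monotone hττ')
  have hφc : Continuous φ := by
    rw [hφ]
    exact (continuous_indicator_reversed hΩo hu hτT').comp (continuous_const_smul k)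
  have hmem : ∀ x, φ x ≠ 0 → k • x ∈ Ω := fun x hx => by
    by_contra h
    rw [hφ] at hx
    exact hx (indicator_of_notMem h _)
  -- `Ω` is star-shaped about `0` and `k ≥ 1`, so the support of `φ` shrinks
  have hφD : ∀ x, φ x ≠ 0 → x ∈ Ω := fun x hx => by
    have h1 := hΩc.smul_mem_of_zero_mem hΩ0 (hmem x hx)
      (t := k⁻¹) ⟨by positivity, inv_le_one_of_one_le₀ hk1⟩
    rwa [smul_smul, inv_mul_cancel₀ (by positivity), one_smul] at h1
  have hφd : ∀ x, φ x ≠ 0 → HasFDerivAt φ (k • fderiv ℝ (fun y => u y (-τ')) (k • x)) x ∧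
      ContDiffAt ℝ 1 φ x := fun x hx => by
    have := hasFDerivAt_indicator_dilate hΩo hv' (hmem x hx)
    rw [hφ]; exact this
  have hφ2 : MemLp φ 2 (mehlerMeasure n τ) := by
    rw [hφ]; exact (memLp_indicator_dilate_iff hτ.1).2 hmW
  have hopen : IsOpen {x | φ x ≠ 0} := isOpen_ne_fun hφc continuous_const
  have hdφ : MemLp ({x | φ x ≠ 0}.indicator fun x => ‖fderiv ℝ φ x‖) 2 (mehlerMeasure n τ) := by
    have h1 := ((memLp_indicator_dilate_iff (Ω := Ω) (f := gradNorm u) (τ := τ) (τ' := τ')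
      hτ.1).2 hmG').const_mul k
    have h2 : ContDiffOn ℝ 1 φ {x | φ x ≠ 0} := fun x hx => (hφd x hx).2.contDiffWithinAt
    refine h1.of_le ((aestronglyMeasurable_indicator_iff hopen.measurableSet).2
      ((h2.continuousOn_fderiv_of_isOpen hopen le_rfl).norm.aestronglyMeasurable
        hopen.measurableSet)) (Eventually.of_forall fun x => ?_)
    by_cases hx : φ x = 0
    · rw [indicator_of_notMem (by simpa using hx), norm_zero]
      exact norm_nonneg _
    · rw [indicator_of_mem (show x ∈ {x | φ x ≠ 0} from hx), (hφd x hx).1.fderiv, ← hk,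
        indicator_of_mem (hmem x hx), gradNorm, norm_gradient_eq, norm_norm, norm_smul, norm_mul,
        norm_norm]
  refine ⟨?_, hdφ⟩
  have hgrad : MemLp (Ω.indicator fun x => gradNorm u x τ) 2 (mehlerMeasure n τ) :=
    (memLp_rescaled_iff hτ.1).1 hmG
  have hgen : MemLp (Ω.indicator fun x => mehlerGenerator u x τ) 2 (mehlerMeasure n τ) :=
    (memLp_rescaled_iff hτ.1).1 hmB
  simp only [gradNorm] at hgrad
  simp only [mehlerGenerator] at hgen
  have hibp := integral_fderiv_gradient_mehlerMeasure hτ.1 hΩo hv hφc hφD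
    (fun x hx => (hφd x hx).2) hgrad hgen hφ2 hdφ
  rw [hibp, inner_generatorCurve_solutionCurve_eq_integral hτ.1 hmB hmW, ← hk]
  simp only [mehlerGenerator, hφ]

/-- The case `τ' = τ` of the pairing above. The integral over `{u ≠ 0}` is the full Dirichlet energy
since `∇u = 0` almost everywhere on `{u = 0}`. -/
theorem inner_generatorCurve_self (hΩo : IsOpen Ω) (hΩc : Convex ℝ Ω)
    (hΩ0 : (0 : 𝔼) ∈ Ω) (hT : 0 < T) (hA : 0 < A) (hu : IsOUHeatSolution Ω T u)
    (hW : ∀ a b : ℝ, -T < a → ∃ K : ℝ≥0, ∀ t ∈ Icc a b,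
      sobolevNormSq Ω (weightedGaussianMeasure n A) (fun x => u x t) ≤ K) {τ : ℝ}
    (hτ : τ ∈ Ioo 0 (freqTime A T)) :
    ⟪generatorCurve Ω u τ, solutionCurve Ω u τ⟫_ℝ = mehlerVar τ *
      ∫ z, rescaled Ω (gradNorm u) τ z ^ 2 ∂(gaussianSpaceMeasure n) := by
  have h1 := (inner_generatorCurve_solutionCurve hΩo hΩc hΩ0 hT hA hu hW hτ hτ le_rfl rfl).1
  have hσ := sqrt_mehlerVar_pos hτ.1
  simp only [div_self hσ.ne', one_smul] at h1
  have hv := hu.contDiffOn_space (-τ) (neg_lt_neg_of_mem_Ioo_freqTime hT hτ)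
  rw [h1]
  congr 1
  have h2 : ∫ z, rescaled Ω (gradNorm u) τ z ^ 2 ∂(gaussianSpaceMeasure n) =
      ∫ x, (Ω.indicator (fun x => gradNorm u x τ) x) ^ 2 ∂(mehlerMeasure n τ) := by
    rw [integral_mehlerMeasure hτ.1]; rfl
  rw [h2]
  have hac : mehlerMeasure n τ ≪ volume :=
    (withDensity_absolutelyContinuous _ _).trans gaussianSpaceMeasure_absolutelyContinuous
  refine integral_congr_ae ?_
  filter_upwards [hac.ae_le (ae_fderiv_eq_zero_of_eq_zero hΩo (hv.differentiableOn (by norm_num)))]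
    with x hx
  by_cases hxΩ : x ∈ Ω
  · rw [indicator_of_mem hxΩ]
    have hφx : Ω.indicator (fun y => reversed u y τ) x = u x (-τ) := indicator_of_mem hxΩ _
    by_cases h0 : u x (-τ) = 0
    · rw [indicator_of_notMem (by rw [mem_ofPred_eq, not_not, hφx, h0]), gradNorm,
        norm_gradient_eq, hx hxΩ h0]
      simp
    · rw [indicator_of_mem (by rw [mem_ofPred_eq, hφx]; exact h0)]
      have h3 := (hasFDerivAt_indicator_dilate hΩo hv (k := 1) (x := x) (by rwa [one_smul])).1
      simp only [one_smul] at h3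
      have h4 : fderiv ℝ (fun x => Ω.indicator (fun y => reversed u y τ) x) x =
        fderiv ℝ (fun y => u y (-τ)) x := h3.fderiv
      rw [h4, fderiv_apply_eq_inner_gradient, real_inner_self_eq_norm_sq, gradNorm]
  · have hφx : Ω.indicator (fun y => reversed u y τ) x = 0 := indicator_of_notMem hxΩ _
    rw [indicator_of_notMem hxΩ, indicator_of_notMem (by rw [mem_ofPred_eq, not_not, hφx])]
    simp

/-- Young's inequality `2 ∇φ · ∇v ≤ |∇v|² + |∇φ|²`, integrated: the energy at `τ'` lies above the
tangent at the state of time `τ ≤ τ'`. -/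
theorem two_mul_inner_generatorCurve_le (hΩo : IsOpen Ω) (hΩc : Convex ℝ Ω)
    (hΩ0 : (0 : 𝔼) ∈ Ω) (hT : 0 < T) (hA : 0 < A) (hu : IsOUHeatSolution Ω T u)
    (hW : ∀ a b : ℝ, -T < a → ∃ K : ℝ≥0, ∀ t ∈ Icc a b,
      sobolevNormSq Ω (weightedGaussianMeasure n A) (fun x => u x t) ≤ K) {τ τ' : ℝ}
    (hτ : τ ∈ Ioo 0 (freqTime A T)) (hτ' : τ' ∈ Ioo 0 (freqTime A T)) (hττ' : τ ≤ τ') :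
    2 * ⟪generatorCurve Ω u τ, solutionCurve Ω u τ'⟫_ℝ ≤
      ⟪generatorCurve Ω u τ, solutionCurve Ω u τ⟫_ℝ +
        ⟪generatorCurve Ω u τ', solutionCurve Ω u τ'⟫_ℝ := by
  obtain ⟨C₂, hC₂⟩ := exists_memLp_gradNorm hΩo hT hA hu hW hτ hτ
  obtain ⟨C₃, hC₃⟩ := exists_memLp_gradNorm hΩo hT hA hu hW hτ' hτ'
  have hmG := (hC₂ τ ⟨le_rfl, le_rfl⟩).1
  have hmG' := (hC₃ τ' ⟨le_rfl, le_rfl⟩).1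
  have hs := mehlerVar_pos hτ.1
  have hs' := mehlerVar_pos hτ'.1
  have hσ := sqrt_mehlerVar_pos hτ.1
  have hv' := hu.contDiffOn_space (-τ') (neg_lt_neg_of_mem_Ioo_freqTime hT hτ')
  set k := √(mehlerVar τ') / √(mehlerVar τ) with hk
  have hk0 : 0 ≤ k := by positivity
  -- the scaling of the Dirichlet energy: `s k² = s'`
  have hk2 : mehlerVar τ * k ^ 2 = mehlerVar τ' := by
    rw [hk, div_pow, Real.sq_sqrt hs.le, Real.sq_sqrt hs'.le, mul_div_cancel₀ _ hs.ne']
  obtain ⟨φ, hφ⟩ : ∃ φ : 𝔼 → ℝ, φ = fun x => Ω.indicator (fun y => reversed u y τ') (k • x) :=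
    ⟨_, rfl⟩
  obtain ⟨h1, hdφ⟩ := inner_generatorCurve_solutionCurve hΩo hΩc hΩ0 hT hA hu hW hτ hτ' hττ' hφ
  rw [inner_generatorCurve_self hΩo hΩc hΩ0 hT hA hu hW hτ,
    inner_generatorCurve_self hΩo hΩc hΩ0 hT hA hu hW hτ', h1]
  set ν := mehlerMeasure n τ with hν
  obtain ⟨G, hG⟩ : ∃ G : 𝔼 → ℝ, G = Ω.indicator fun x => gradNorm u x τ := ⟨_, rfl⟩
  obtain ⟨G', hG'⟩ : ∃ G' : 𝔼 → ℝ, G' = fun x => Ω.indicator (fun y => gradNorm u y τ') (k • x) :=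
    ⟨_, rfl⟩
  have hGm : MemLp G 2 ν := by rw [hG]; exact (memLp_rescaled_iff hτ.1).1 hmG
  have hG'm : MemLp G' 2 ν := by rw [hG']; exact (memLp_indicator_dilate_iff hτ.1).2 hmG'
  have e1 : ∫ z, rescaled Ω (gradNorm u) τ z ^ 2 ∂(gaussianSpaceMeasure n) = ∫ x, G x ^ 2 ∂ν := by
    rw [hG, hν, integral_mehlerMeasure hτ.1]; rfl
  have e2 : ∫ z, rescaled Ω (gradNorm u) τ' z ^ 2 ∂(gaussianSpaceMeasure n) =
      ∫ x, G' x ^ 2 ∂ν := by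
    rw [hG']
    exact (integral_indicator_dilate (Ω := Ω) (f := gradNorm u) (τ' := τ') hτ.1
      (g := fun _ y => y ^ 2)).symm
  have hpt : ∀ x, 2 * {x | φ x ≠ 0}.indicator
      (fun x => fderiv ℝ φ x (gradient (fun y => u y (-τ)) x)) x ≤ G x ^ 2 + k ^ 2 * G' x ^ 2 := by
    intro x
    by_cases hx : φ x = 0
    · rw [indicator_of_notMem (by simpa using hx), mul_zero]
      positivity
    · rw [indicator_of_mem (show x ∈ {x | φ x ≠ 0} from hx)]
      have hkx : k • x ∈ Ω := by
        by_contra h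
        rw [hφ] at hx
        exact hx (indicator_of_notMem h _)
      have hxΩ : x ∈ Ω := by
        have hk1 : 1 ≤ k := by
          rw [hk, one_le_div hσ]
          exact Real.sqrt_le_sqrt (mehlerVar_strictMono.monotone hττ')
        have h2 := hΩc.smul_mem_of_zero_mem hΩ0 hkx
          (t := k⁻¹) ⟨by positivity, inv_le_one_of_one_le₀ hk1⟩
        rwa [smul_smul, inv_mul_cancel₀ (by positivity), one_smul] at h2
      have h2 : fderiv ℝ φ x = k • fderiv ℝ (fun y => u y (-τ')) (k • x) := by
        rw [hφ]
        exact (hasFDerivAt_indicator_dilate hΩo hv' hkx).1.fderiv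
      have h3 : G x = ‖gradient (fun y => u y (-τ)) x‖ := by
        rw [hG, indicator_of_mem hxΩ, gradNorm]
      have h4 : G' x = ‖fderiv ℝ (fun y => u y (-τ')) (k • x)‖ := by
        rw [← norm_gradient_eq, hG']
        beta_reduce
        rw [indicator_of_mem hkx, gradNorm]
      have h5 := (le_abs_self _).trans ((fderiv ℝ φ x).le_opNorm (gradient (fun y => u y (-τ)) x))
      rw [h2, norm_smul, Real.norm_of_nonneg hk0, ← h4, ← h3] at h5
      rw [h2]
      nlinarith [sq_nonneg (G x - k * G' x)]
  have hint : Integrable (fun x => G x ^ 2 + k ^ 2 * G' x ^ 2) ν :=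
    hGm.integrable_sq.add (hG'm.integrable_sq.const_mul _)
  have hle : 2 * ∫ x, {x | φ x ≠ 0}.indicator
      (fun x => fderiv ℝ φ x (gradient (fun y => u y (-τ)) x)) x ∂ν ≤
      ∫ x, G x ^ 2 + k ^ 2 * G' x ^ 2 ∂ν := by
    rw [← integral_const_mul]
    by_cases hi : Integrable (fun x => 2 * {x | φ x ≠ 0}.indicator
      (fun x => fderiv ℝ φ x (gradient (fun y => u y (-τ)) x)) x) ν
    · exact integral_mono hi hint hpt
    -- otherwise the left-hand integral is `0` by convention, and the bound still holds
    · rw [integral_undef hi]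
      exact integral_nonneg fun x => by positivity
  rw [integral_add hGm.integrable_sq (hG'm.integrable_sq.const_mul _), integral_const_mul] at hle
  rw [e1, e2]
  calc 2 * (mehlerVar τ * ∫ x, {x | φ x ≠ 0}.indicator
      (fun x => fderiv ℝ φ x (gradient (fun y => u y (-τ)) x)) x ∂ν)
      = mehlerVar τ * (2 * ∫ x, {x | φ x ≠ 0}.indicator
        (fun x => fderiv ℝ φ x (gradient (fun y => u y (-τ)) x)) x ∂ν) := by ring
    _ ≤ mehlerVar τ * (∫ x, G x ^ 2 ∂ν + k ^ 2 * ∫ x, G' x ^ 2 ∂ν) :=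
        mul_le_mul_of_nonneg_left hle hs.le
    _ = _ := by rw [mul_add, ← mul_assoc, hk2]

/-! ### The frequency -/

theorem integrableOn_sq_mul_backwardMehlerKernel (hΩo : IsOpen Ω) {f : 𝔼 → ℝ → ℝ} {τ : ℝ}
    (hτ : 0 < τ) (hf : MemLp (rescaled Ω f τ) 2 (gaussianSpaceMeasure n)) :
    IntegrableOn (fun x => f x τ ^ 2 * backwardMehlerKernel x (-τ)) Ω (gaussianSpaceMeasure n) ∧
    ∫ x in Ω, f x τ ^ 2 * backwardMehlerKernel x (-τ) ∂(gaussianSpaceMeasure n) =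
      ∫ z, rescaled Ω f τ z ^ 2 ∂(gaussianSpaceMeasure n) := by
  have h1 := (memLp_rescaled_iff hτ).1 hf
  have h2 : (fun x => (Ω.indicator (fun x => f x τ) x) ^ 2) = Ω.indicator fun x => f x τ ^ 2 := by
    ext x
    by_cases hx : x ∈ Ω
    · simp [hx]
    · simp [hx]
  constructor
  · have h3 := h1.integrable_sq
    rw [h2, integrable_indicator_iff hΩo.measurableSet, IntegrableOn, mehlerMeasure,
      restrict_withDensity hΩo.measurableSet, integrable_withDensity_iff_integrable_smul'
        (measurable_backwardMehlerKernel _).ennreal_ofReal (by simp)] at h3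
    refine h3.congr (Eventually.of_forall fun x => ?_)
    beta_reduce
    rw [ENNReal.toReal_ofReal (backwardMehlerKernel_pos hτ x).le, smul_eq_mul, mul_comm]
  · rw [setIntegral_mul_backwardMehlerKernel hτ hΩo.measurableSet,
      ← integral_indicator hΩo.measurableSet, ← h2, integral_mehlerMeasure hτ]
    rfl

theorem eq_zero_of_solutionCurve_eq_zero (hΩo : IsOpen Ω) (hu : IsOUHeatSolution Ω T u) {τ : ℝ}
    (hτ0 : 0 < τ) (hτ : -T < -τ)
    (hm : MemLp (rescaled Ω (reversed u) τ) 2 (gaussianSpaceMeasure n))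
    (h0 : solutionCurve Ω u τ = 0) {x : 𝔼} (hx : x ∈ Ω) : u x (-τ) = 0 := by
  have h1 : rescaled Ω (reversed u) τ =ᵐ[gaussianSpaceMeasure n] 0 := by
    have h2 := coeFn_toL2 hm
    rw [show toL2 (gaussianSpaceMeasure n) (rescaled Ω (reversed u) τ) = 0 from h0] at h2
    exact h2.symm.trans (Lp.coeFn_zero ..)
  have hac : (volume : Measure 𝔼) ≪ gaussianSpaceMeasure n := by
    refine withDensity_absolutelyContinuous' (by fun_prop) (Eventually.of_forall fun x => ?_)
    simp only [ne_eq, ENNReal.ofReal_eq_zero, not_le]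
    positivity
  have hc : Continuous (rescaled Ω (reversed u) τ) :=
    (continuous_indicator_reversed hΩo hu hτ).comp (continuous_const_smul _)
  have h3 : rescaled Ω (reversed u) τ = 0 :=
    (hc.ae_eq_iff_eq volume continuous_zero).1 (hac.ae_eq h1)
  have h4 := congrFun h3 ((√(mehlerVar τ))⁻¹ • x)
  rw [rescaled, smul_smul, mul_inv_cancel₀ (sqrt_mehlerVar_pos hτ0).ne', one_smul,
    indicator_of_mem hx] at h4
  exact h4

end Energy

theorem theorem1p1 (n : ℕ) (Ω : Set (EuclideanSpace ℝ (Fin n))) (hΩ_open : IsOpen Ω)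
    (hΩ_convex : Convex ℝ Ω) (hΩ_zero : (0 : EuclideanSpace ℝ (Fin n)) ∈ Ω)
    (T A : ℝ) (hT : 0 < T) (hA : 0 < A) (u : EuclideanSpace ℝ (Fin n) → ℝ → ℝ)
    (hu : IsOUHeatSolution Ω T u)
    (hW : ∀ t, -T < t → MemW22 Ω (weightedGaussianMeasure n A) (fun x => u x t))
    (hW_loc : ∀ a b : ℝ, -T < a → ∃ K : ℝ≥0, ∀ t ∈ Icc a b,
      sobolevNormSq Ω (weightedGaussianMeasure n A) (fun x => u x t) ≤ K) :
    (∀ τ ∈ Ioo 0 (freqTime A T),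
      IntegrableOn (fun x => u x (-τ) ^ 2 * backwardMehlerKernel x (-τ)) Ω
        (gaussianSpaceMeasure n) ∧
      IntegrableOn
        (fun x => ‖gradient (fun y => u y (-τ)) x‖ ^ 2 * backwardMehlerKernel x (-τ)) Ω
        (gaussianSpaceMeasure n)) ∧
    ((∀ x ∈ Ω, ∀ t ∈ Ioo (-freqTime A T) 0, u x t = 0) ∨
      ∀ τ ∈ Ioo 0 (freqTime A T), 0 < freqH Ω u τ) ∧
    MonotoneOn (parabolicFrequency Ω u) (Ioo 0 (freqTime A T)) := by
  have hmW : ∀ τ ∈ Ioo 0 (freqTime A T),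
      MemLp (rescaled Ω (reversed u) τ) 2 (gaussianSpaceMeasure n) := fun τ hτ => by
    obtain ⟨C, hC⟩ := exists_memLp_reversed hΩ_open hT hA hu hW_loc hτ hτ
    exact (hC τ ⟨le_rfl, le_rfl⟩).1
  have hmG : ∀ τ ∈ Ioo 0 (freqTime A T),
      MemLp (rescaled Ω (gradNorm u) τ) 2 (gaussianSpaceMeasure n) := fun τ hτ => by
    obtain ⟨C, hC⟩ := exists_memLp_gradNorm hΩ_open hT hA hu hW_loc hτ hτ
    exact (hC τ ⟨le_rfl, le_rfl⟩).1
  have hH : ∀ τ ∈ Ioo 0 (freqTime A T), freqH Ω u τ = ‖solutionCurve Ω u τ‖ ^ 2 := fun τ hτ => by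
    rw [solutionCurve, norm_sq_toL2 (hmW τ hτ)]
    exact (integrableOn_sq_mul_backwardMehlerKernel hΩ_open hτ.1 (hmW τ hτ)).2
  have hI : ∀ τ ∈ Ioo 0 (freqTime A T), mehlerVar τ * freqI Ω u τ =
      ⟪generatorCurve Ω u τ, solutionCurve Ω u τ⟫_ℝ := fun τ hτ => by
    rw [inner_generatorCurve_self hΩ_open hΩ_convex hΩ_zero hT hA hu hW_loc hτ]
    congr 1
    exact (integrableOn_sq_mul_backwardMehlerKernel hΩ_open hτ.1 (hmG τ hτ)).2
  have hN : ∀ τ ∈ Ioo 0 (freqTime A T), parabolicFrequency Ω u τ =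
      ⟪generatorCurve Ω u τ, solutionCurve Ω u τ⟫_ℝ / ‖solutionCurve Ω u τ‖ ^ 2 := fun τ hτ => by
    rw [← hI τ hτ, ← hH τ hτ, parabolicFrequency, mul_div_assoc]
    rfl
  have hinv : ∀ τ ∈ Ioo 0 (freqTime A T), 0 < (mehlerVar τ)⁻¹ := fun τ hτ =>
    inv_pos.2 (mehlerVar_pos hτ.1)
  have hlip : ∀ τ ∈ Ioo 0 (freqTime A T), _ := fun τ hτ =>
    solutionCurve_lipschitz hΩ_open hΩ_convex hΩ_zero hT hA hu hW_loc hτ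
  have hder : ∀ τ ∈ Ioo 0 (freqTime A T), _ := fun τ hτ =>
    tendsto_slope_solutionCurve hΩ_open hΩ_convex hΩ_zero hT hA hu hW_loc hτ
  have hsub : ∀ {a b : ℝ}, a ∈ Ioo 0 (freqTime A T) → b ∈ Ioo 0 (freqTime A T) →
      Icc a b ⊆ Ioo 0 (freqTime A T) :=
    fun ha hb x hx => ⟨ha.1.trans_le hx.1, hx.2.trans_lt hb.2⟩
  have hmono : ∀ a ∈ Ioo 0 (freqTime A T), ∀ b ∈ Ioo 0 (freqTime A T), a ≤ b →
      (∀ τ ∈ Icc a b, solutionCurve Ω u τ ≠ 0) →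
      ⟪generatorCurve Ω u a, solutionCurve Ω u a⟫_ℝ / ‖solutionCurve Ω u a‖ ^ 2 ≤
        ⟪generatorCurve Ω u b, solutionCurve Ω u b⟫_ℝ / ‖solutionCurve Ω u b‖ ^ 2 := by
    intro a ha b hb hab hne
    refine rayleigh_le_of_forall_ne_zero (c := fun τ => (mehlerVar τ)⁻¹) hab
      (fun τ hτ => hinv τ (hsub ha hb hτ)) (fun τ hτ => hlip τ (hsub ha hb hτ))
      (fun τ hτ => hder τ (hsub ha hb hτ)) (fun τ hτ => ?_)
      (fun τ hτ => tendsto_inner_generatorCurve hΩ_open hΩ_convex hT hA hu hW_loc (hsub ha hb hτ))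
      (fun τ hτ τ' hτ' hττ' => two_mul_inner_generatorCurve_le hΩ_open hΩ_convex hΩ_zero hT hA hu
        hW_loc (hsub ha hb hτ) (hsub ha hb hτ') hττ') hne
    obtain ⟨C, hC⟩ := generatorCurve_bounded hΩ_open hT hA hu hW_loc (hsub ha hb hτ)
    exact ⟨√C, hC.mono fun τ' h => Real.le_sqrt_of_sq_le h.2⟩
  have hdich := forall_eq_zero_or_forall_ne_zero (c := fun τ => (mehlerVar τ)⁻¹)
    (W := solutionCurve Ω u) (B := generatorCurve Ω u)
    (continuous_mehlerVar.continuousOn.inv₀ fun τ hτ => (mehlerVar_pos hτ.1).ne') hinv hlip hder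
    (fun τ hτ => by
      rw [inner_generatorCurve_self hΩ_open hΩ_convex hΩ_zero hT hA hu hW_loc hτ]
      exact mul_nonneg (mehlerVar_pos hτ.1).le (integral_nonneg fun z => sq_nonneg _)) hmono
  refine ⟨fun τ hτ => ⟨?_, ?_⟩, ?_, fun a ha b hb hab => ?_⟩
  · exact (integrableOn_sq_mul_backwardMehlerKernel hΩ_open hτ.1 (hmW τ hτ)).1
  · exact (integrableOn_sq_mul_backwardMehlerKernel hΩ_open hτ.1 (hmG τ hτ)).1
  · refine hdich.imp (fun h x hx t ht => ?_) (fun h τ hτ => ?_)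
    · have hτ : -t ∈ Ioo 0 (freqTime A T) := ⟨neg_pos.2 ht.2, neg_lt.1 ht.1⟩
      have h1 := eq_zero_of_solutionCurve_eq_zero hΩ_open hu hτ.1
        (neg_lt_neg_of_mem_Ioo_freqTime hT hτ) (hmW _ hτ) (h _ hτ) hx
      rwa [neg_neg] at h1
    · rw [hH τ hτ]
      have := norm_pos_iff.2 (h τ hτ)
      positivity
  · rw [hN a ha, hN b hb]
    rcases hdich with h | h
    -- in the trivial case both quotients are `0 / 0 = 0`
    · simp [h a ha, h b hb]
    · exact hmono a ha b hb hab fun τ hτ => h τ (hsub ha hb hτ)
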